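/- Let $\mathbb{k}$ be a field. Write $\mathsf{Ord}$ (resp. $\mathsf{Fin}$) for the category of nonempty finite linearly ordered sets with order-preserving bijections (resp. nonempty finite sets with bijections). A *nonsymmetric* (resp. *symmetric*) *collection* is a contravariant functor from $\mathsf{Ord}$ (resp. $\mathsf{Fin}$) to $\mathbb{k}$-vector spaces. For $I\in\mathsf{Ord}$ let $I^f$ be its underlying set; the forgetful functor ${}^f$ from symmetric to nonsymmetric collections is $\mathcal P^f(I)=\mathcal P(I^f)$. The *shuffle composition* of nonsymmetric collections is $$(\mathcal P\circ_{sh}\mathcal Q)(I)=\bigoplus_{n\ge1}\mathcal P([n])\otimes\Big(\bigoplus_{h\colon I\twoheadrightarrow[n]}\mathcal Q(h^{-1}(1))\otimes\dots\otimes\mathcal Q(h^{-1}(n))\Big),$$ the sum being over the shuffling surjections $h$, i.e. those with $\min h^{-1}(i)<\min h^{-1}(j)$ whenever $i<j$. The *symmetric composition* $\mathcal P\circ\mathcal Q$ of symmetric collections is given by the same formula with the sum over all surjections $h$ and with $\otimes$ after $\mathcal P([n])$ replaced by $\otimes_{\mathbb{k}S_n}$. For an (admissible) surjection $h\colon I\to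 K$ onto any $K$, and $p\in\mathcal P(K)$, $q_i\in\mathcal Q(h^{-1}(i))$, write $p\otimes_h(q_i)_{i\in K}$ for the corresponding element of the composition (transport along any isomorphism $K\cong[n]$). Then: 1. With the evident associators and unit isomorphisms, and with unit the collection that is $\mathbb{k}$ on one-element sets and $0$ on larger sets, both compositions are monoidal structures, and the forgetful functor is a (strong) monoidal functor from symmetric collections with $\circ$ to nonsymmetric collections with $\circ_{sh}$. Its structure isomorphism $\mathcal P^f\circ_{sh}\mathcal Q^f\to(\mathcal P\circ\mathcal Q)^f$ sends $p\otimes_h(q_i)$ to $p\otimes_{h^f}(q_i)$, and the unit isomorphism is the identity on scalars. In particular, for every symmetric operad (monoid for $\circ$) $\mathcal F$, $\mathcal F^f$ is a shuffle operad (monoid for $\circ_{sh}$). 2. Let $\mathcal V$ be a symmetric collection. A free symmetric operad $\iota\colon\mathcal V\to\mathcal F$ on $\mathcal V$ and a free shuffle operad $j\colon\mathcal V^f\to\mathcal G$ on $\mathcal V^f$ exist (free meaning the universal property: every morphism of collections from the generators to an operad extends to a unique morphism of operads). For any such $(\mathcal F,\iota)$ and $(\mathcal G,j)$ there is a unique isomorphism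 of shuffle operads $e\colon\mathcal F^f\to\mathcal G$ with $e\circ\iota^f=j$. 3. An *ideal* of a (symmetric or shuffle) operad is a subcollection that contains the composite of $p\otimes_h(q_i)_i$ as soon as it contains $p$ or one of the $q_i$; $(\mathcal R)$ denotes the smallest ideal containing a subcollection $\mathcal R$. In the situation of 2, for every symmetric subcollection $\mathcal R$ of $\mathcal F$, the restriction $(\mathcal R)^f$ of the symmetric ideal is the shuffle ideal $(\mathcal R^f)$ of $\mathcal F^f$ generated by $\mathcal R^f$, and $e$ maps $(\mathcal R)^f$ onto the shuffle ideal $(e(\mathcal R^f))$ of $\mathcal G$. -/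

import Mathlib

open CategoryTheory Opposite

universe u

noncomputable section

namespace ShuffleOperad

/-- A kind of structure on finite sets (no structure, or a linear order), with the induced
structures on subsets, the structure-preserving injections, and the surjections that index the
summands of a composition of collections. -/
class Kind (S : Type → Type) where
  /-- the induced structure on a subset -/
  sub : ∀ {A : Type}, S A → (p : A → Prop) → S {x // p x}
  /-- the map is an embedding of structures -/
  emb : ∀ {A B : Type}, S A → S B → (A → B) → Prop
  /-- the map is an admissible surjection -/
  surj : ∀ {A B : Type}, S A → S B → (A → B) → Prop
  emb_id : ∀ {A : Type} (s : S A), emb s s id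
  emb_val : ∀ {A : Type} (s : S A) (p : A → Prop), emb (sub s p) s Subtype.val
  emb_comp : ∀ {A B C : Type} {s : S A} {t : S B} {r : S C} {f : A → B} {g : B → C},
    emb t r g → emb s t f → emb s r (g ∘ f)
  emb_cancel : ∀ {A B C : Type} {s : S A} {t : S B} {r : S C} {f : A → B} {g : B → C},
    emb t r g → emb s r (g ∘ f) → emb s t f
  surjective : ∀ {A B : Type} {s : S A} {t : S B} {f : A → B}, surj s t f → f.Surjective
  surj_of_emb : ∀ {A B : Type} {s : S A} {t : S B} {f : A → B},
    f.Bijective → emb s t f → surj s t f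
  emb_of_surj : ∀ {A B : Type} [Finite A] {s : S A} {t : S B} {f : A → B},
    f.Injective → surj s t f → emb s t f
  surj_comp : ∀ {A B C : Type} [Finite A] [Finite B] {s : S A} {t : S B} {r : S C} {f : A → B}
    {g : B → C}, surj t r g → surj s t f → surj s r (g ∘ f)
  surj_restrict : ∀ {A B C : Type} [Finite A] [Finite B] {s : S A} {t : S B} {r : S C}
    {f : A → B} {g : B → C}, surj t r g → surj s t f → ∀ c : C,
    surj (sub s fun x => g (f x) = c) (sub t fun y => g y = c) (fun x => ⟨f x.1, x.2⟩)
  surj_point : ∀ {A B : Type} [Subsingleton B] {s : S A} {t : S B} {f : A → B},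
    f.Surjective → surj s t f

/-- No structure. -/
def NoStr (_ : Type) : Type := Unit

instance : Kind NoStr where
  sub _ _ := ()
  emb _ _ _ := True
  surj _ _ f := f.Surjective
  emb_id _ := trivial
  emb_val _ _ := trivial
  emb_comp _ _ := trivial
  emb_cancel _ _ := trivial
  surjective h := h
  surj_of_emb h _ := h.2
  emb_of_surj _ _ := trivial
  surj_comp hg hf := hg.comp hf
  surj_restrict {A B C _ _ s t r f g} hg hf c y := by
    obtain ⟨x, hx⟩ := hf y.1
    exact ⟨⟨x, by rw [hx]; exact y.2⟩, Subtype.ext hx⟩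
  surj_point h := h

/-- A shuffling surjection: `min f⁻¹(i) < min f⁻¹(j)` whenever `i < j`. -/
def IsShuffling {A B : Type} (_ : LinearOrder A) (_ : LinearOrder B) (f : A → B) : Prop :=
  f.Surjective ∧
    ∀ (i j : B) (a b : A), i < j → IsLeast (f ⁻¹' {i}) a → IsLeast (f ⁻¹' {j}) b → a < b

theorem isShuffling_iff {A B : Type} [Finite A] (s : LinearOrder A) (t : LinearOrder B)
    (f : A → B) : IsShuffling s t f ↔
      f.Surjective ∧ ∀ (i : B) (y : A), i < f y → ∃ x, f x = i ∧ x < y := by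
  have least : ∀ (b : B), f.Surjective → ∃ a, IsLeast (f ⁻¹' {b}) a := fun b hf => by
    obtain ⟨a, ha⟩ := hf b
    obtain ⟨m, hm, hm'⟩ := Set.exists_min_image (f ⁻¹' {b}) id (Set.toFinite _) ⟨a, ha⟩
    exact ⟨m, hm, fun x hx => hm' x hx⟩
  constructor
  · rintro ⟨hs, h⟩
    refine ⟨hs, fun i y hy => ?_⟩
    obtain ⟨a, ha⟩ := least i hs
    obtain ⟨b, hb⟩ := least (f y) hs
    exact ⟨a, ha.1, (h i (f y) a b hy ha hb).trans_le (hb.2 rfl)⟩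
  · rintro ⟨hs, h⟩
    refine ⟨hs, fun i j a b hij ha hb => ?_⟩
    obtain ⟨x, hx, hxb⟩ := h i b (by rw [show f b = j from hb.1]; exact hij)
    exact (ha.2 hx).trans_lt hxb

instance : Kind LinearOrder where
  sub s p := LinearOrder.lift' Subtype.val Subtype.val_injective
  emb _ _ f := ∀ a b, f a ≤ f b ↔ a ≤ b
  surj s t f := IsShuffling s t f
  emb_id _ _ _ := Iff.rfl
  emb_val _ _ _ _ := Iff.rfl
  emb_comp hg hf a b := (hg _ _).trans (hf a b)
  emb_cancel hg h a b := (hg _ _).symm.trans (h a b)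
  surjective h := h.1
  surj_of_emb {A B s t f} hf h := by
    refine ⟨hf.2, fun i j a b hij ha hb => ?_⟩
    have ha' : f a = i := ha.1
    have hb' : f b = j := hb.1
    subst ha' hb'
    exact lt_of_not_ge fun hba => not_le_of_gt hij ((h b a).2 hba)
  emb_of_surj {A B _ s t f} hf h a b := by
    have key : ∀ a b, f a < f b → a < b := fun a b hab => by
      obtain ⟨x, hx, hxb⟩ := ((isShuffling_iff s t f).1 h).2 (f a) b hab
      rwa [← hf hx]
    refine ⟨fun hab => ?_, fun hab => ?_⟩
    · rcases hab.lt_or_eq with h1 | h1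
      · exact (key a b h1).le
      · exact (hf h1).le
    · exact le_of_not_gt fun hba => not_le_of_gt (key b a hba) hab
  surj_comp {A B C _ _ s t r f g} hg hf := by
    rw [isShuffling_iff] at *
    refine ⟨hg.1.comp hf.1, fun i y hy => ?_⟩
    obtain ⟨z, hz, hzy⟩ := hg.2 i (f y) hy
    obtain ⟨x, hx, hxy⟩ := hf.2 z y hzy
    exact ⟨x, by simp [hx, hz], hxy⟩
  surj_restrict {A B C _ _ s t r f g} hg hf c := by
    rw [isShuffling_iff] at *
    refine ⟨fun y => ?_, fun i y hy => ?_⟩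
    · obtain ⟨x, hx⟩ := hf.1 y.1
      exact ⟨⟨x, by rw [hx]; exact y.2⟩, Subtype.ext hx⟩
    · obtain ⟨x, hx, hxy⟩ := hf.2 i.1 y.1 hy
      exact ⟨⟨x, by rw [hx]; exact i.2⟩, Subtype.ext hx, hxy⟩
  surj_point {A B _ s t f} h :=
    ⟨h, fun i j _ _ hij => absurd hij (by rw [Subsingleton.elim i j]; exact lt_irrefl _)⟩

/-- A nonempty finite set with a structure of kind `S`. -/
structure Obj (S : Type → Type) where
  carrier : Type
  str : S carrier
  [finite : Finite carrier]
  [nonempty : Nonempty carrier]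

attribute [instance] Obj.finite Obj.nonempty

variable {S : Type → Type} [Kind S]

instance : CoeSort (Obj S) Type := ⟨Obj.carrier⟩

/-- Structure-preserving bijections. -/
@[ext] structure OIso (I J : Obj S) where
  toEquiv : I ≃ J
  emb : Kind.emb I.str J.str toEquiv

namespace OIso

instance (I J : Obj S) : CoeFun (OIso I J) (fun _ => I → J) := ⟨fun e => e.toEquiv⟩

theorem ext' {I J : Obj S} {e e' : OIso I J} (h : ∀ x, e x = e' x) : e = e' :=
  OIso.ext (Equiv.ext h)

def refl (I : Obj S) : OIso I I := ⟨Equiv.refl _, Kind.emb_id _⟩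

def trans {I J K : Obj S} (e : OIso I J) (e' : OIso J K) : OIso I K :=
  ⟨e.toEquiv.trans e'.toEquiv,
    Kind.emb_comp (f := e.toEquiv) (g := e'.toEquiv) e'.emb e.emb⟩

def symm {I J : Obj S} (e : OIso I J) : OIso J I :=
  ⟨e.toEquiv.symm, Kind.emb_cancel e.emb (by
    have : (e.toEquiv ∘ e.toEquiv.symm : J → J) = id := by ext x; simp
    rw [this]; exact Kind.emb_id _)⟩

@[simp] theorem refl_apply {I : Obj S} (x : I) : refl I x = x := rfl
@[simp] theorem trans_apply {I J K : Obj S} (e : OIso I J) (e' : OIso J K) (x : I) :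
    (e.trans e') x = e' (e x) := rfl
theorem injective {I J : Obj S} (e : OIso I J) : Function.Injective e := e.toEquiv.injective
@[simp] theorem apply_symm {I J : Obj S} (e : OIso I J) (x : J) : e (e.symm x) = x :=
  e.toEquiv.apply_symm_apply x
@[simp] theorem symm_apply {I J : Obj S} (e : OIso I J) (x : I) : e.symm (e x) = x :=
  e.toEquiv.symm_apply_apply x
@[simp] theorem symm_trans {I J : Obj S} (e : OIso I J) : e.symm.trans e = refl J :=
  ext' fun x => e.apply_symm x
@[simp] theorem trans_symm {I J : Obj S} (e : OIso I J) : e.trans e.symm = refl I :=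
  ext' fun x => e.symm_apply x

end OIso

/-- The category of nonempty finite sets with a structure of kind `S`; its morphisms are the
structure-preserving bijections. -/
instance : Category (Obj S) where
  Hom I J := OIso I J
  id I := OIso.refl I
  comp e e' := e.trans e'

/-- The admissible surjections from `I` to `K`: all surjections between sets without structure,
the shuffling surjections between ordered sets. -/
@[ext] structure Surj (I K : Obj S) where
  toFun : I → K
  surj : Kind.surj I.str K.str toFun

instance (I K : Obj S) : CoeFun (Surj I K) (fun _ => I → K) := ⟨Surj.toFun⟩

theorem Surj.ext' {I K : Obj S} {f g : Surj I K} (h : ∀ x, f x = g x) : f = g :=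
  Surj.ext (funext h)

/-- The fibre `f⁻¹(i)` with its induced structure. -/
def fib {I K : Obj S} (f : Surj I K) (i : K) : Obj S :=
  haveI : Nonempty {x : I // f x = i} :=
    let ⟨x, hx⟩ := Kind.surjective f.surj i; ⟨⟨x, hx⟩⟩
  ⟨{x : I // f x = i}, Kind.sub I.str _⟩

/-- An element of a fibre. -/
def fibMk {I K : Obj S} (f : Surj I K) (x : I) : fib f (f x) := ⟨x, rfl⟩

/-- The inclusion of a fibre. -/
def fibVal {I K : Obj S} {f : Surj I K} {i : K} (x : fib f i) : I := Subtype.val x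

theorem fibVal_prop {I K : Obj S} {f : Surj I K} {i : K} (x : fib f i) : f (fibVal x) = i :=
  Subtype.property x

theorem fib_ext {I K : Obj S} {f : Surj I K} {i : K} {x y : fib f i} (h : fibVal x = fibVal y) :
    x = y := Subtype.ext h

theorem exists_fibVal {I K : Obj S} (f : Surj I K) (x : I) :
    ∃ (i : K) (y : fib f i), fibVal y = x := ⟨f x, fibMk f x, rfl⟩

/-- An isomorphism, as an admissible surjection. -/
def OIso.toSurj {I K : Obj S} (e : OIso I K) : Surj I K :=
  ⟨e, Kind.surj_of_emb e.toEquiv.bijective e.emb⟩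

def Surj.comp {I K L : Obj S} (f : Surj I K) (g : Surj K L) : Surj I L :=
  ⟨fun x => g (f x), Kind.surj_comp g.surj f.surj⟩

/-- Precomposition with an isomorphism. -/
def Surj.pre {I J K : Obj S} (e : OIso I J) (f : Surj J K) : Surj I K := e.toSurj.comp f

/-- For `f : I → K` and `g : K → L`, the restriction `(g ∘ f)⁻¹(l) → g⁻¹(l)` of `f`. -/
def Surj.res {I K L : Obj S} (f : Surj I K) (g : Surj K L) (l : L) :
    Surj (fib (f.comp g) l) (fib g l) :=
  ⟨fun x => ⟨f x.1, x.2⟩, Kind.surj_restrict g.surj f.surj l⟩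

/-- An isomorphism between fibres from an isomorphism `e` between the ambient sets. -/
def fibIso {I J K K' : Obj S} (e : OIso I J) (f : Surj I K) (f' : Surj J K') (i : K) (i' : K')
    (h : ∀ x, f x = i ↔ f' (e x) = i') : OIso (fib f i) (fib f' i') :=
  ⟨e.toEquiv.subtypeEquiv h,
    Kind.emb_cancel (g := Subtype.val) (Kind.emb_val J.str _)
      (Kind.emb_comp (f := Subtype.val) (g := e.toEquiv) e.emb (Kind.emb_val I.str _))⟩

/-- The fibre over `i` of the restriction of `f` is the fibre of `f` over `i`. -/
def resIso {I K L : Obj S} (f : Surj I K) (g : Surj K L) (l : L) (i : fib g l) :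
    OIso (fib (f.res g l) i) (fib f (fibVal i)) :=
  ⟨{ toFun := fun x => ⟨x.1.1, congrArg Subtype.val x.2⟩
     invFun := fun x => ⟨⟨x.1, by show g (f x.1) = l; rw [x.2]; exact i.2⟩, Subtype.ext x.2⟩
     left_inv := fun _ => rfl
     right_inv := fun _ => rfl },
    Kind.emb_cancel (g := Subtype.val) (Kind.emb_val I.str _)
      (Kind.emb_comp (f := Subtype.val) (g := Subtype.val) (Kind.emb_val I.str _)
        (Kind.emb_val (Kind.sub I.str _) _))⟩


variable {k : Type u} [Field k]

/-- A collection: a contravariant functor from the nonempty finite sets with a structure of kind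
`S` and their isomorphisms to vector spaces. -/
abbrev Coll (k : Type u) [Field k] (S : Type → Type) [Kind S] := (Obj S)ᵒᵖ ⥤ ModuleCat.{u} k

/-- The value of a collection. -/
abbrev Coll.ev (P : Coll k S) (I : Obj S) : Type u := P.obj (op I)

/-- The action of an isomorphism `I → J` on a collection. -/
def act (P : Coll k S) {I J : Obj S} (e : OIso I J) : P.ev J →ₗ[k] P.ev I :=
  (P.map (Quiver.Hom.op (show I ⟶ J from e))).hom

@[simp] theorem act_refl (P : Coll k S) {I : Obj S} (x : P.ev I) : act P (OIso.refl I) x = x := by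
  have := P.map_id (op I)
  exact congrArg (fun t => t.hom x) this

theorem act_act (P : Coll k S) {I J K : Obj S} (e : OIso I J) (e' : OIso J K) (x : P.ev K) :
    act P e (act P e' x) = act P (e.trans e') x := by
  have := P.map_comp (Quiver.Hom.op (show J ⟶ K from e')) (Quiver.Hom.op (show I ⟶ J from e))
  exact (congrArg (fun t => t.hom x) this).symm

theorem act_congr (P : Coll k S) {I J : Obj S} {e e' : OIso I J} (h : ∀ x, e x = e' x)
    (x : P.ev J) : act P e x = act P e' x := by rw [OIso.ext' h]

theorem act_eq_self (P : Coll k S) {I : Obj S} (e : OIso I I) (h : ∀ x, e x = x) (x : P.ev I) :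
    act P e x = x := by
  rw [show e = OIso.refl I from OIso.ext' h, act_refl]

/-- The components of a morphism of collections. -/
def app {P Q : Coll k S} (θ : P ⟶ Q) (I : Obj S) : P.ev I →ₗ[k] Q.ev I := (θ.app (op I)).hom

theorem app_act {P Q : Coll k S} (θ : P ⟶ Q) {I J : Obj S} (e : OIso I J) (x : P.ev J) :
    app θ I (act P e x) = act Q e (app θ J x) := by
  have := θ.naturality (Quiver.Hom.op (show I ⟶ J from e))
  exact congrArg (fun t => t.hom x) this

@[simp] theorem app_id (P : Coll k S) (I : Obj S) (x : P.ev I) : app (𝟙 P) I x = x := rfl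
@[simp] theorem app_comp {P Q R : Coll k S} (θ : P ⟶ Q) (φ : Q ⟶ R) (I : Obj S) (x : P.ev I) :
    app (θ ≫ φ) I x = app φ I (app θ I x) := rfl

theorem coll_hom_ext {P Q : Coll k S} {θ φ : P ⟶ Q} (h : ∀ I, app θ I = app φ I) : θ = φ := by
  ext I x
  exact congrArg (fun t => t x) (h I.unop)

/-- Construct a collection. -/
def Coll.make (obj : Obj S → ModuleCat.{u} k) (map : ∀ {I J : Obj S}, OIso I J → obj J →ₗ[k] obj I)
    (map_refl : ∀ I, map (OIso.refl I) = LinearMap.id)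
    (map_trans : ∀ {I J K : Obj S} (e : OIso I J) (e' : OIso J K),
      map (e.trans e') = map e ∘ₗ map e') : Coll k S where
  obj I := obj I.unop
  map e := ModuleCat.ofHom (map e.unop)
  map_id I := by ext x; exact congrArg (fun t => t x) (map_refl I.unop)
  map_comp e e' := by ext x; exact congrArg (fun t => t x) (map_trans e'.unop e.unop)

/-- Construct a morphism of collections. -/
def homMake {P Q : Coll k S} (φ : ∀ I, P.ev I →ₗ[k] Q.ev I)
    (h : ∀ {I J : Obj S} (e : OIso I J) x, φ I (act P e x) = act Q e (φ J x)) : P ⟶ Q where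
  app I := ModuleCat.ofHom (φ I.unop)
  naturality I J e := by ext x; exact h e.unop x

@[simp] theorem app_homMake {P Q : Coll k S} (φ : ∀ I, P.ev I →ₗ[k] Q.ev I)
    (h : ∀ {I J : Obj S} (e : OIso I J) x, φ I (act P e x) = act Q e (φ J x)) (I : Obj S) :
    app (homMake φ h) I = φ I := rfl

/-- A morphism of collections is an isomorphism if all components are bijective. -/
noncomputable def isoMake {P Q : Coll k S} (θ : P ⟶ Q) (h : ∀ I, Function.Bijective (app θ I)) :
    P ≅ Q :=
  NatIso.ofComponents
    (fun I => (LinearEquiv.ofBijective (app θ I.unop) (h I.unop)).toModuleIso)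
    (fun e => θ.naturality e)

@[simp] theorem isoMake_hom {P Q : Coll k S} (θ : P ⟶ Q) (h : ∀ I, Function.Bijective (app θ I)) :
    (isoMake θ h).hom = θ := rfl

/-- Identical fibres of `f` and of `e ∘ f`. -/
def postIso {I K K' : Obj S} (f : Surj I K) (f' : Surj I K') (e : OIso K K')
    (h : ∀ x, e (f x) = f' x) (i : K) : OIso (fib f i) (fib f' (e i)) :=
  fibIso (OIso.refl I) f f' i (e i) fun x => by
    rw [OIso.refl_apply, ← h x]; exact e.injective.eq_iff.symm

/-- A fibre of `f ∘ ε` and the corresponding fibre of `f`. -/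
def preIso {I J K : Obj S} (ε : OIso I J) (f : Surj J K) (i : K) :
    OIso (fib (f.pre ε) i) (fib f i) := fibIso ε (f.pre ε) f i i fun _ => Iff.rfl

/-- Families of maps `P(K) ⊗ ⨂_{i ∈ K} Q(f⁻¹(i)) → M`, one for every admissible surjection
`f : I → K`, invariant under isomorphisms of the set `K`. -/
structure Fam (P Q : Coll k S) (I : Obj S) (M : Type u) [AddCommGroup M] [Module k M] where
  toFun : ∀ {K : Obj S} (f : Surj I K),
    P.ev K →ₗ[k] MultilinearMap k (fun i : K => Q.ev (fib f i)) M
  rel : ∀ {K K' : Obj S} (f : Surj I K) (f' : Surj I K') (e : OIso K K')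
    (h : ∀ x, e (f x) = f' x) (p : P.ev K') (q : ∀ i : K', Q.ev (fib f' i)),
    toFun f' p q = toFun f (act P e p) (fun i => act Q (postIso f f' e h i) (q (e i)))

/-- A composition of collections: it assigns to `P`, `Q` and `I` a vector space with a universal
family of maps from the spaces `P(K) ⊗ ⨂_{i ∈ K} Q(f⁻¹(i))`. The symmetric and the shuffle
composition are the two instances of this, constructed below by their explicit formulas. -/
class CompModel (k : Type u) [Field k] (S : Type → Type) [Kind S] where
  T : Coll k S → Coll k S → Obj S → ModuleCat.{u} k
  gen : ∀ (P Q : Coll k S) (I : Obj S), Fam P Q I (T P Q I)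
  lift : ∀ {P Q : Coll k S} {I : Obj S} {M : Type u} [AddCommGroup M] [Module k M],
    Fam P Q I M → T P Q I →ₗ[k] M
  lift_gen : ∀ {P Q : Coll k S} {I : Obj S} {M : Type u} [AddCommGroup M] [Module k M]
    (F : Fam P Q I M) {K : Obj S} (f : Surj I K) (p : P.ev K) (q : ∀ i : K, Q.ev (fib f i)),
    lift F ((gen P Q I).toFun f p q) = F.toFun f p q
  hom_ext : ∀ {P Q : Coll k S} {I : Obj S} {M : Type u} [AddCommGroup M] [Module k M]
    {φ ψ : T P Q I →ₗ[k] M}, (∀ {K : Obj S} (f : Surj I K) (p : P.ev K)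
      (q : ∀ i : K, Q.ev (fib f i)), φ ((gen P Q I).toFun f p q) = ψ ((gen P Q I).toFun f p q)) →
    φ = ψ

section generic

variable [CompModel k S]

open CompModel

/-- The element `p ⊗ ⨂_i q_i` in the summand of `f`. -/
def tensT {P Q : Coll k S} {I K : Obj S} (f : Surj I K) (p : P.ev K)
    (q : ∀ i : K, Q.ev (fib f i)) : T P Q I := (gen P Q I).toFun f p q

theorem tensT_congr {P Q : Coll k S} {I K K' : Obj S} {f : Surj I K} {f' : Surj I K'}
    {p : P.ev K} {p' : P.ev K'} {q : ∀ i : K, Q.ev (fib f i)} {q' : ∀ i : K', Q.ev (fib f' i)}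
    (e : OIso K K') (h : ∀ x, e (f x) = f' x) (hp : act P e p' = p)
    (hq : ∀ i (η : OIso (fib f i) (fib f' (e i))), (∀ x, fibVal (η x) = fibVal x) →
      act Q η (q' (e i)) = q i) :
    tensT f' p' q' = tensT f p q := by
  rw [tensT, (gen P Q I).rel f f' e h, hp, tensT]
  exact congrArg _ (funext fun i => hq i _ fun _ => rfl)

/-- The case of equal surjections. -/
theorem tensT_congr' {P Q : Coll k S} {I K : Obj S} {f f' : Surj I K}
    {p p' : P.ev K} {q : ∀ i : K, Q.ev (fib f i)} {q' : ∀ i : K, Q.ev (fib f' i)}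
    (h : ∀ x, f x = f' x) (hp : p' = p)
    (hq : ∀ i (η : OIso (fib f i) (fib f' i)), (∀ x, fibVal (η x) = fibVal x) → act Q η (q' i) = q i) :
    tensT f' p' q' = tensT f p q :=
  tensT_congr (OIso.refl K) h (by rw [act_refl, hp]) hq

/-- The family `p ⊗ ⨂ q_i ↦ a(p) ⊗ ⨂ b_i(q_i)`. -/
def famMap {P Q P' Q' : Coll k S} {I J : Obj S} (θ : P ⟶ P') (φ : Q ⟶ Q') (ε : OIso I J) :
    Fam P Q J (T P' Q' I) where
  toFun f := MultilinearMap.compLinearMapₗ (fun i => act Q' (preIso ε f i) ∘ₗ app φ _) ∘ₗ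
    (gen P' Q' I).toFun (f.pre ε) ∘ₗ app θ _
  rel {K K'} f f' e h p q := by
    refine tensT_congr e (fun x => h _) (app_act θ e p).symm fun i η hη => ?_
    simp only [LinearMap.comp_apply, app_act, act_act]
    exact act_congr _ (fun x => Subtype.ext (congrArg ε (hη x))) _

/-- The action of an isomorphism on a composition, together with the action of morphisms. -/
def compMap {P Q P' Q' : Coll k S} {I J : Obj S} (θ : P ⟶ P') (φ : Q ⟶ Q') (ε : OIso I J) :
    T P Q J →ₗ[k] T P' Q' I := lift (famMap θ φ ε)

theorem compMap_tensT {P Q P' Q' : Coll k S} {I J K : Obj S} (θ : P ⟶ P') (φ : Q ⟶ Q')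
    (ε : OIso I J) (f : Surj J K) (p : P.ev K) (q : ∀ i : K, Q.ev (fib f i)) :
    compMap θ φ ε (tensT f p q) =
      tensT (f.pre ε) (app θ _ p) (fun i => act Q' (preIso ε f i) (app φ _ (q i))) :=
  lift_gen _ _ _ _

theorem T_hom_ext {P Q : Coll k S} {I : Obj S} {M : Type u} [AddCommGroup M] [Module k M]
    {φ ψ : T P Q I →ₗ[k] M} (h : ∀ {K : Obj S} (f : Surj I K) (p : P.ev K)
      (q : ∀ i : K, Q.ev (fib f i)), φ (tensT f p q) = ψ (tensT f p q)) : φ = ψ := hom_ext h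

theorem compMap_comp {P Q P' Q' P'' Q'' : Coll k S} {I J L : Obj S} (θ : P ⟶ P') (φ : Q ⟶ Q')
    (θ' : P' ⟶ P'') (φ' : Q' ⟶ Q'') (ε : OIso I J) (ε' : OIso J L) :
    compMap (θ ≫ θ') (φ ≫ φ') (ε.trans ε') = compMap θ' φ' ε ∘ₗ compMap θ φ ε' := by
  refine T_hom_ext fun f p q => ?_
  rw [LinearMap.comp_apply, compMap_tensT, compMap_tensT, compMap_tensT]
  refine tensT_congr' (fun _ => rfl) rfl fun i η hη => ?_
  simp only [app_comp, app_act, act_act]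
  exact act_congr _ (fun x => Subtype.ext (congrArg (fun y => ε' (ε y)) (hη x))) _

theorem compMap_id {P Q : Coll k S} {I : Obj S} :
    compMap (𝟙 P) (𝟙 Q) (OIso.refl I) = LinearMap.id := by
  refine T_hom_ext fun f p q => ?_
  rw [LinearMap.id_apply, compMap_tensT]
  refine tensT_congr' (fun _ => rfl) rfl fun i η hη => ?_
  rw [act_act]
  exact act_eq_self _ _ (fun x => fib_ext (hη x)) _

/-- The composition `P ∘ Q` as a collection. -/
def comp (P Q : Coll k S) : Coll k S :=
  Coll.make (T P Q) (fun ε => compMap (𝟙 P) (𝟙 Q) ε) (fun _ => compMap_id)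
    (fun e e' => compMap_comp (𝟙 P) (𝟙 Q) (𝟙 P) (𝟙 Q) e e')

/-- The element `p ⊗ ⨂_i q_i` in the summand of `f`. -/
def tens {P Q : Coll k S} {I K : Obj S} (f : Surj I K) (p : P.ev K)
    (q : ∀ i : K, Q.ev (fib f i)) : (comp P Q).ev I := tensT f p q

theorem tens_congr {P Q : Coll k S} {I K K' : Obj S} {f : Surj I K} {f' : Surj I K'}
    {p : P.ev K} {p' : P.ev K'} {q : ∀ i : K, Q.ev (fib f i)} {q' : ∀ i : K', Q.ev (fib f' i)}
    (e : OIso K K') (h : ∀ x, e (f x) = f' x) (hp : act P e p' = p)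
    (hq : ∀ i (η : OIso (fib f i) (fib f' (e i))), (∀ x, fibVal (η x) = fibVal x) →
      act Q η (q' (e i)) = q i) :
    tens f' p' q' = tens f p q := tensT_congr e h hp hq

/-- The case of equal surjections. -/
theorem tens_congr' {P Q : Coll k S} {I K : Obj S} {f f' : Surj I K}
    {p p' : P.ev K} {q : ∀ i : K, Q.ev (fib f i)} {q' : ∀ i : K, Q.ev (fib f' i)}
    (h : ∀ x, f x = f' x) (hp : p' = p)
    (hq : ∀ i (η : OIso (fib f i) (fib f' i)), (∀ x, fibVal (η x) = fibVal x) →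
      act Q η (q' i) = q i) :
    tens f' p' q' = tens f p q := tensT_congr' h hp hq

/-- The linear map given by a family. -/
def compLift {P Q : Coll k S} {I : Obj S} {M : Type u} [AddCommGroup M] [Module k M]
    (F : Fam P Q I M) : (comp P Q).ev I →ₗ[k] M := lift F

theorem compLift_tens {P Q : Coll k S} {I : Obj S} {M : Type u} [AddCommGroup M] [Module k M]
    (F : Fam P Q I M) {K : Obj S} (f : Surj I K) (p : P.ev K) (q : ∀ i : K, Q.ev (fib f i)) :
    compLift F (tens f p q) = F.toFun f p q := lift_gen F f p q

theorem comp_ext {P Q : Coll k S} {I : Obj S} {M : Type u} [AddCommGroup M] [Module k M]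
    {φ ψ : (comp P Q).ev I →ₗ[k] M} (h : ∀ {K : Obj S} (f : Surj I K) (p : P.ev K)
      (q : ∀ i : K, Q.ev (fib f i)), φ (tens f p q) = ψ (tens f p q)) : φ = ψ := T_hom_ext h

theorem tens_add_left {P Q : Coll k S} {I K : Obj S} (f : Surj I K) (p p' : P.ev K)
    (q : ∀ i : K, Q.ev (fib f i)) : tens f (p + p') q = tens f p q + tens f p' q :=
  congrArg (fun t => t q) (((gen P Q I).toFun f).map_add p p')

theorem tens_smul_left {P Q : Coll k S} {I K : Obj S} (f : Surj I K) (c : k) (p : P.ev K)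
    (q : ∀ i : K, Q.ev (fib f i)) : tens f (c • p) q = c • tens f p q :=
  congrArg (fun t => t q) (((gen P Q I).toFun f).map_smul c p)

/-- `tens` as a multilinear map in the remaining tensor factors. -/
def tensRight {P : Coll k S} (Q : Coll k S) {I K : Obj S} (f : Surj I K) (p : P.ev K) :
    MultilinearMap k (fun i : K => Q.ev (fib f i)) ((comp P Q).ev I) := (gen P Q I).toFun f p

theorem tensRight_apply {P Q : Coll k S} {I K : Obj S} (f : Surj I K) (p : P.ev K)
    (q : ∀ i : K, Q.ev (fib f i)) : tensRight Q f p q = tens f p q := rfl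

theorem tens_update_add {P Q : Coll k S} {I K : Obj S} [DecidableEq K] (f : Surj I K) (p : P.ev K)
    (q : ∀ i : K, Q.ev (fib f i)) (i : K) (x y : Q.ev (fib f i)) :
    tens f p (Function.update q i (x + y)) =
      tens f p (Function.update q i x) + tens f p (Function.update q i y) :=
  (tensRight Q f p).map_update_add q i x y

theorem tens_update_smul {P Q : Coll k S} {I K : Obj S} [DecidableEq K] (f : Surj I K) (p : P.ev K)
    (q : ∀ i : K, Q.ev (fib f i)) (i : K) (c : k) (x : Q.ev (fib f i)) :
    tens f p (Function.update q i (c • x)) = c • tens f p (Function.update q i x) :=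
  (tensRight Q f p).map_update_smul q i c x

theorem act_tens {P Q : Coll k S} {I J K : Obj S} (ε : OIso I J) (f : Surj J K) (p : P.ev K)
    (q : ∀ i : K, Q.ev (fib f i)) :
    act (comp P Q) ε (tens f p q) = tens (f.pre ε) p (fun i => act Q (preIso ε f i) (q i)) :=
  compMap_tensT _ _ _ _ _ _

/-- The composition of two morphisms. -/
def compHom {P Q P' Q' : Coll k S} (θ : P ⟶ P') (φ : Q ⟶ Q') : comp P Q ⟶ comp P' Q' :=
  homMake (fun I => compMap θ φ (OIso.refl I)) fun {I J} e x => by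
    have h1 := compMap_comp (𝟙 P) (𝟙 Q) θ φ (OIso.refl I) e
    have h2 := compMap_comp θ φ (𝟙 P') (𝟙 Q') e (OIso.refl J)
    exact congrArg (fun t => t x) (h1.symm.trans h2)

theorem compHom_tens {P Q P' Q' : Coll k S} (θ : P ⟶ P') (φ : Q ⟶ Q') {I K : Obj S} (f : Surj I K)
    (p : P.ev K) (q : ∀ i : K, Q.ev (fib f i)) :
    app (compHom θ φ) I (tens f p q) = tens f (app θ _ p) (fun i => app φ _ (q i)) := by
  refine (compMap_tensT _ _ _ _ _ _).trans (tensT_congr' (fun _ => rfl) rfl fun i η hη => ?_)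
  rw [act_act]
  exact act_eq_self _ _ (fun x => fib_ext (hη x)) _

theorem comp_hom_ext {P Q R : Coll k S} {θ φ : comp P Q ⟶ R} (h : ∀ {I K : Obj S} (f : Surj I K)
    (p : P.ev K) (q : ∀ i : K, Q.ev (fib f i)), app θ I (tens f p q) = app φ I (tens f p q)) :
    θ = φ := coll_hom_ext fun I => comp_ext fun f p q => h f p q

/-- `tens` as a linear map in the first tensor factor. -/
def tensLeft (P : Coll k S) {Q : Coll k S} {I K : Obj S} (f : Surj I K)
    (q : ∀ i : K, Q.ev (fib f i)) : P.ev K →ₗ[k] (comp P Q).ev I where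
  toFun p := tens f p q
  map_add' a b := by exact tens_add_left f a b q
  map_smul' c a := by exact tens_smul_left f c a q

theorem nested_ext {P Q R : Coll k S} {I : Obj S} {M : Type u} [AddCommGroup M] [Module k M]
    {φ ψ : (comp (comp P Q) R).ev I →ₗ[k] M}
    (h : ∀ {K L : Obj S} (f : Surj I K) (g : Surj K L) (p : P.ev L) (q : ∀ i : L, Q.ev (fib g i))
      (r : ∀ i : K, R.ev (fib f i)),
      φ (tens f (tens g p q) r) = ψ (tens f (tens g p q) r)) :
    φ = ψ := by
  refine comp_ext fun {K} f x r => ?_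
  have := comp_ext (P := P) (Q := Q) (I := K)
    (φ := φ ∘ₗ tensLeft (comp P Q) f r) (ψ := ψ ∘ₗ tensLeft (comp P Q) f r)
    (fun g p q => h f g p q r)
  exact congrArg (fun t => t x) this

theorem nested_ext₃ {P Q R W : Coll k S} {I : Obj S} {M : Type u} [AddCommGroup M] [Module k M]
    {φ ψ : (comp (comp (comp P Q) R) W).ev I →ₗ[k] M}
    (h : ∀ {J K L : Obj S} (d : Surj I J) (f : Surj J K) (g : Surj K L) (p : P.ev L)
      (q : ∀ i : L, Q.ev (fib g i)) (r : ∀ i : K, R.ev (fib f i)) (w : ∀ i : J, W.ev (fib d i)),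
      φ (tens d (tens f (tens g p q) r) w) =
        ψ (tens d (tens f (tens g p q) r) w)) :
    φ = ψ := by
  refine comp_ext fun {J} d x w => ?_
  have := nested_ext
    (φ := φ ∘ₗ tensLeft (comp (comp P Q) R) d w) (ψ := ψ ∘ₗ tensLeft (comp (comp P Q) R) d w)
    (fun f g p q r => h d f g p q r w)
  exact congrArg (fun t => t x) this

end generic

section generic

variable [CompModel k S]

open CompModel

/-- The value of the associator on `(p ⊗ ⨂ q_l) ⊗ ⨂ r_i`. -/
def assocTerm {P Q R : Coll k S} {I K L : Obj S} (f : Surj I K) (g : Surj K L) (p : P.ev L)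
    (q : ∀ l : L, Q.ev (fib g l)) (r : ∀ i : K, R.ev (fib f i)) : (comp P (comp Q R)).ev I :=
  tens (f.comp g) p
    (fun l => tens (f.res g l) (q l) (fun i => act R (resIso f g l i) (r (fibVal i))))

theorem assoc_update_r {Q R : Coll k S} {I K L : Obj S} [DecidableEq K] [DecidableEq L]
    (f : Surj I K) (g : Surj K L) [∀ l, DecidableEq (fib g l)]
    (q : ∀ l : L, Q.ev (fib g l)) (r : ∀ i : K, R.ev (fib f i)) {l₀ : L} (i₀ : fib g l₀)
    (v : R.ev (fib f (fibVal i₀))) :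
    (fun l => tens (f.res g l) (q l)
      (fun i => act R (resIso f g l i) (Function.update r (fibVal i₀) v (fibVal i)))) =
    Function.update
      (fun l => tens (f.res g l) (q l) (fun i => act R (resIso f g l i) (r (fibVal i)))) l₀
      (tens (f.res g l₀) (q l₀)
        (Function.update (fun i => act R (resIso f g l₀ i) (r (fibVal i))) i₀
          (act R (resIso f g l₀ i₀) v))) := by
  funext l
  by_cases hl : l = l₀
  · subst hl
    rw [Function.update_self]
    congr 1
    funext i
    by_cases hi : i = i₀
    · subst hi
      rw [Function.update_self, Function.update_self]
    · rw [Function.update_of_ne hi, Function.update_of_ne fun h => hi (fib_ext h)]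
  · rw [Function.update_of_ne hl]
    congr 1
    funext i
    rw [Function.update_of_ne]
    intro h
    exact hl ((fibVal_prop i).symm.trans ((congrArg g h).trans (fibVal_prop i₀)))

theorem assoc_update_q {Q R : Coll k S} {I K L : Obj S} [DecidableEq L]
    (f : Surj I K) (g : Surj K L)
    (q : ∀ l : L, Q.ev (fib g l)) (r : ∀ i : K, R.ev (fib f i)) (l₀ : L) (v : Q.ev (fib g l₀)) :
    (fun l => tens (f.res g l) (Function.update q l₀ v l)
      (fun i => act R (resIso f g l i) (r (fibVal i)))) =
    Function.update
      (fun l => tens (f.res g l) (q l) (fun i => act R (resIso f g l i) (r (fibVal i)))) l₀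
      (tens (f.res g l₀) v (fun i => act R (resIso f g l₀ i) (r (fibVal i)))) := by
  funext l
  by_cases hl : l = l₀
  · subst hl
    rw [Function.update_self, Function.update_self]
  · rw [Function.update_of_ne hl, Function.update_of_ne hl]

open Classical in
/-- `assocTerm` as a multilinear map in `r`. -/
def assocR {P Q : Coll k S} (R : Coll k S) {I K L : Obj S} (f : Surj I K) (g : Surj K L)
    (p : P.ev L) (q : ∀ l : L, Q.ev (fib g l)) :
    MultilinearMap k (fun i : K => R.ev (fib f i)) ((comp P (comp Q R)).ev I) :=
  MultilinearMap.mk' (fun r => assocTerm f g p q r)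
    (fun r i x y => by
      obtain ⟨l, i, rfl⟩ := exists_fibVal g i
      simp only [assocTerm, assoc_update_r, map_add]
      rw [tens_update_add]
      exact tens_update_add _ _ _ _ _ _)
    (fun r i c x => by
      obtain ⟨l, i, rfl⟩ := exists_fibVal g i
      simp only [assocTerm, assoc_update_r, map_smul]
      rw [tens_update_smul]
      exact tens_update_smul _ _ _ _ _ _)

open Classical in
/-- `assocTerm` as a multilinear map in `q`. -/
def assocQ {P : Coll k S} (Q R : Coll k S) {I K L : Obj S} (f : Surj I K) (g : Surj K L)
    (p : P.ev L) : MultilinearMap k (fun l : L => Q.ev (fib g l))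
      (MultilinearMap k (fun i : K => R.ev (fib f i)) ((comp P (comp Q R)).ev I)) :=
  MultilinearMap.mk' (fun q => assocR R f g p q)
    (fun q i x y => MultilinearMap.ext fun r => by
      change assocTerm (P := P) f g p _ r = assocTerm f g p _ r + assocTerm f g p _ r
      simp only [assocTerm, assoc_update_q, tens_add_left]
      exact tens_update_add _ _ _ _ _ _)
    (fun q i c x => MultilinearMap.ext fun r => by
      change assocTerm (P := P) f g p _ r = c • assocTerm f g p _ r
      simp only [assocTerm, assoc_update_q, tens_smul_left]
      exact tens_update_smul _ _ _ _ _ _)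

/-- `assocTerm` as a linear map in `p`. -/
def assocP (P Q R : Coll k S) {I K L : Obj S} (f : Surj I K) (g : Surj K L) :
    P.ev L →ₗ[k] MultilinearMap k (fun l : L => Q.ev (fib g l))
      (MultilinearMap k (fun i : K => R.ev (fib f i)) ((comp P (comp Q R)).ev I)) where
  toFun p := assocQ Q R f g p
  map_add' _ _ := MultilinearMap.ext fun _ => MultilinearMap.ext fun _ => tens_add_left _ _ _ _
  map_smul' _ _ := MultilinearMap.ext fun _ => MultilinearMap.ext fun _ => tens_smul_left _ _ _ _

/-- Invariance of `assocTerm` under isomorphisms of `K` and `L` and compatibility with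
isomorphisms of `I`. -/
theorem assocTerm_congr {P Q R : Coll k S} {I K L K' L' : Obj S}
    {f : Surj I K} {g : Surj K L} {p : P.ev L} {q : ∀ l : L, Q.ev (fib g l)}
    {r : ∀ i : K, R.ev (fib f i)} {f' : Surj I K'} {g' : Surj K' L'} {p' : P.ev L'}
    {q' : ∀ l : L', Q.ev (fib g' l)} {r' : ∀ i : K', R.ev (fib f' i)}
    (e : OIso K K') (e' : OIso L L') (hf : ∀ x, e (f x) = f' x) (hg : ∀ y, e' (g y) = g' (e y))
    (hp : act P e' p' = p)
    (hq : ∀ l (η : OIso (fib g l) (fib g' (e' l))), (∀ y, fibVal (η y) = e (fibVal y)) →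
      act Q η (q' (e' l)) = q l)
    (hr : ∀ i (η : OIso (fib f i) (fib f' (e i))), (∀ x, fibVal (η x) = fibVal x) →
      act R η (r' (e i)) = r i) :
    assocTerm f' g' p' q' r' = assocTerm f g p q r := by
  refine tens_congr e' (fun x => (hg _).trans (congrArg g' (hf x))) hp
    fun l η hη => ?_
  rw [act_tens]
  have hiff : ∀ y, g y = l ↔ g' (e y) = e' l := fun y => by
    rw [← hg y]; exact e'.injective.eq_iff.symm
  refine tens_congr (fibIso e g g' l (e' l) hiff) (fun x => fib_ext ?_) (hq l _ fun _ => rfl)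
    fun i θ hθ => ?_
  · exact (hf (fibVal x)).trans (congrArg f' (hη x).symm)
  · rw [act_act, act_act, ← hr (fibVal i) (fibIso (OIso.refl I) f f' (fibVal i) (e (fibVal i)) fun x => by
      rw [OIso.refl_apply, ← hf x]; exact e.injective.eq_iff.symm) fun _ => rfl, act_act]
    refine act_congr _ (fun x => Subtype.ext ?_) _
    show fibVal (η (fibVal (θ x))) = _
    exact (hη _).trans (congrArg fibVal (hθ x))

/-- The family defining the associator, for a fixed first surjection. -/
def assocFam (P Q R : Coll k S) {I K : Obj S} (f : Surj I K) :
    Fam P Q K (MultilinearMap k (fun i : K => R.ev (fib f i)) ((comp P (comp Q R)).ev I)) where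
  toFun g := assocP P Q R f g
  rel g g' e h p q := MultilinearMap.ext fun r =>
    assocTerm_congr (OIso.refl K) e (fun _ => rfl) h rfl
      (fun l η hη => act_congr _ (fun y => fib_ext (hη y)) _)
      (fun i η hη => act_eq_self _ _ (fun y => fib_ext (hη y)) _)

theorem lift_assocFam {P Q R : Coll k S} {I K L : Obj S} (f : Surj I K) (g : Surj K L) (p : P.ev L)
    (q : ∀ l : L, Q.ev (fib g l)) (r : ∀ i : K, R.ev (fib f i)) :
    compLift (assocFam P Q R f) (tens g p q) r = assocTerm f g p q r :=
  congrArg (fun t => t r) (compLift_tens (assocFam P Q R f) g p q)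

/-- The family defining the associator. -/
def assocFam₂ (P Q R : Coll k S) (I : Obj S) : Fam (comp P Q) R I ((comp P (comp Q R)).ev I) where
  toFun f := compLift (assocFam P Q R f)
  rel {K K'} f f' e h x r := by
    let A : (comp P Q).ev K' →ₗ[k] (comp P (comp Q R)).ev I :=
      { toFun := fun x => compLift (assocFam P Q R f') x r
        map_add' := fun a b => by rw [map_add]; rfl
        map_smul' := fun c a => by rw [map_smul]; rfl }
    let r' := fun i => act R (postIso f f' e h i) (r (e i))
    let B : (comp P Q).ev K →ₗ[k] (comp P (comp Q R)).ev I :=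
      { toFun := fun x => compLift (assocFam P Q R f) x r'
        map_add' := fun a b => by rw [map_add]; rfl
        map_smul' := fun c a => by rw [map_smul]; rfl }
    have : A = B ∘ₗ act (comp P Q) e := comp_ext fun {L} g p q => by
      show compLift (assocFam P Q R f') (tens g p q) r =
        compLift (assocFam P Q R f) (act (comp P Q) e (tens g p q)) r'
      rw [act_tens, lift_assocFam, lift_assocFam]
      exact assocTerm_congr e (OIso.refl L) h (fun _ => rfl) (act_refl _ _)
        (fun l η hη => act_congr _ (fun y => fib_ext (hη y)) _)
        (fun i η hη => act_congr _ (fun y => fib_ext (hη y)) _)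
    exact congrArg (fun t => t x) this

/-- The components of the associator `(P ∘ Q) ∘ R → P ∘ (Q ∘ R)`. -/
def assocApp (P Q R : Coll k S) (I : Obj S) :
    (comp (comp P Q) R).ev I →ₗ[k] (comp P (comp Q R)).ev I := compLift (assocFam₂ P Q R I)

theorem assocApp_tens {P Q R : Coll k S} {I K L : Obj S} (f : Surj I K) (g : Surj K L) (p : P.ev L)
    (q : ∀ l : L, Q.ev (fib g l)) (r : ∀ i : K, R.ev (fib f i)) :
    assocApp P Q R I (tens f (tens g p q) r) = assocTerm f g p q r :=
  (compLift_tens (assocFam₂ P Q R I) f (tens g p q) r).trans (lift_assocFam f g p q r)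

end generic

theorem act_dep {Q : Coll k S} {I K X : Obj S} {f : Surj I K} (q : ∀ i : K, Q.ev (fib f i))
    {i j : K} (hij : i = j) (η : OIso X (fib f i)) (θ : OIso X (fib f j))
    (h : ∀ x, fibVal (η x) = fibVal (θ x)) : act Q η (q i) = act Q θ (q j) := by
  subst hij
  exact act_congr _ (fun x => fib_ext (h x)) _

section generic

variable [CompModel k S]

open CompModel

/-- The associator `(P ∘ Q) ∘ R → P ∘ (Q ∘ R)`. -/
def assocHom (P Q R : Coll k S) : comp (comp P Q) R ⟶ comp P (comp Q R) :=
  homMake (assocApp P Q R) fun {I J} ε x => by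
    have : assocApp P Q R I ∘ₗ act (comp (comp P Q) R) ε =
        act (comp P (comp Q R)) ε ∘ₗ assocApp P Q R J := nested_ext fun {K L} f g p q r => by
      rw [LinearMap.comp_apply, LinearMap.comp_apply, act_tens, assocApp_tens, assocApp_tens]
      refine Eq.trans ?_ (act_tens ε (f.comp g) p _).symm
      refine tens_congr' (fun _ => rfl) rfl fun l η hη => ?_
      rw [act_tens, act_tens]
      refine tens_congr' (fun x => fib_ext ?_) rfl fun i θ hθ => ?_
      · exact congrArg (fun y => f (ε y)) (hη x).symm
      · simp only [act_act]
        refine act_congr _ (fun x => Subtype.ext ?_) _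
        exact congrArg ε ((hη _).trans (congrArg fibVal (hθ x)))
    exact congrArg (fun t => t x) this

theorem assocHom_tens {P Q R : Coll k S} {I K L : Obj S} (f : Surj I K) (g : Surj K L) (p : P.ev L)
    (q : ∀ l : L, Q.ev (fib g l)) (r : ∀ i : K, R.ev (fib f i)) :
    app (assocHom P Q R) I (tens f (tens g p q) r) =
      tens (f.comp g) p
        (fun l => tens (f.res g l) (q l) (fun i => act R (resIso f g l i) (r (fibVal i)))) :=
  assocApp_tens f g p q r

theorem assoc_naturality {P Q R P' Q' R' : Coll k S} (θ : P ⟶ P') (φ : Q ⟶ Q') (ψ : R ⟶ R') :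
    compHom (compHom θ φ) ψ ≫ assocHom P' Q' R' = assocHom P Q R ≫ compHom θ (compHom φ ψ) := by
  refine coll_hom_ext fun I => nested_ext fun f g p q r => ?_
  show app (assocHom _ _ _) I (app (compHom (compHom θ φ) ψ) I _) =
    app (compHom θ (compHom φ ψ)) I (app (assocHom _ _ _) I _)
  rw [assocHom_tens, compHom_tens, compHom_tens, compHom_tens, assocHom_tens]
  congr 1
  funext l
  rw [compHom_tens]
  congr 1
  funext i
  rw [app_act]

theorem assoc_pentagon (P Q R W : Coll k S) :
    compHom (assocHom P Q R) (𝟙 W) ≫ assocHom P (comp Q R) W ≫ compHom (𝟙 P) (assocHom Q R W) =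
      assocHom (comp P Q) R W ≫ assocHom P Q (comp R W) := by
  refine coll_hom_ext fun I => nested_ext₃ fun {J K L} d f g p q r w => ?_
  show app (compHom (𝟙 P) (assocHom Q R W)) I (app (assocHom P (comp Q R) W) I
    (app (compHom (assocHom P Q R) (𝟙 W)) I _)) =
    app (assocHom P Q (comp R W)) I (app (assocHom (comp P Q) R W) I _)
  rw [compHom_tens, assocHom_tens, assocHom_tens, assocHom_tens, compHom_tens, assocHom_tens]
  refine tens_congr' (fun _ => rfl) rfl fun l η hη => ?_
  rw [assocHom_tens, act_tens]
  refine tens_congr' (fun x => fib_ext (congrArg (fun y => f (d y)) (hη x).symm)) rfl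
    fun i θ hθ => ?_
  rw [act_tens, act_tens, act_tens]
  refine (tens_congr (resIso f g l i) (fun x => ?_) rfl fun j ζ hζ => ?_).symm
  · exact fib_ext (congrArg d ((hη _).trans (congrArg fibVal (hθ x))))
  · simp only [act_act]
    refine act_congr _ (fun x => Subtype.ext ?_) _
    exact (congrArg (fun y => fibVal (fibVal y)) (hζ x)).trans
      ((hη _).trans (congrArg fibVal (hθ _))).symm

end generic

/-- The value of the unit collection: the field for a one-element set, zero for a larger set. -/
def unitMod (k : Type u) [Field k] (A : Type) : Submodule k k where
  carrier := {c | Nontrivial A → c = 0}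
  add_mem' ha hb h := by rw [ha h, hb h, add_zero]
  zero_mem' _ := rfl
  smul_mem' c a ha h := by rw [ha h, smul_zero]

/-- The unit collection. -/
def unit (k : Type u) [Field k] (S : Type → Type) [Kind S] : Coll k S :=
  Coll.make (fun I => ModuleCat.of k (unitMod k I))
    (fun {I J} e => Submodule.inclusion fun c hc h => hc e.toEquiv.symm.nontrivial)
    (fun _ => rfl) (fun _ _ => rfl)

/-- An element of the unit collection, as a scalar. -/
def unitVal (I : Obj S) : (unit k S).ev I →ₗ[k] k := (unitMod k I).subtype

theorem unitVal_act {I J : Obj S} (e : OIso I J) (c : (unit k S).ev J) :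
    unitVal I (act (unit k S) e c) = unitVal J c := rfl

theorem unitVal_injective (I : Obj S) : Function.Injective (unitVal (k := k) I) :=
  Subtype.val_injective

theorem unit_eq_zero {I : Obj S} (h : ¬ Subsingleton I) (c : (unit k S).ev I) : c = 0 :=
  unitVal_injective I (c.2 (not_subsingleton_iff_nontrivial.1 h))

/-- The generator of the unit collection. -/
def unitOne (I : Obj S) [h : Subsingleton I] : (unit k S).ev I :=
  ⟨1, fun h' => absurd h (not_subsingleton_iff_nontrivial.2 h')⟩

/-- If `f` is constant, its fibre is the whole set. -/
def fullIso {I K : Obj S} (f : Surj I K) (i : K) (h : ∀ x, f x = i) : OIso I (fib f i) :=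
  ⟨(Equiv.subtypeUnivEquiv h).symm,
    Kind.emb_cancel (g := Subtype.val) (Kind.emb_val I.str _) (Kind.emb_id _)⟩

/-- An injective admissible surjection is an isomorphism. -/
def isoOf {I K : Obj S} (f : Surj I K) (h : Function.Injective f) : OIso I K :=
  ⟨Equiv.ofBijective f ⟨h, Kind.surjective f.surj⟩, Kind.emb_of_surj h f.surj⟩

/-- `c ↦ (∏ c_i) p` for an injective `f`, zero otherwise. -/
def rightMulti {P : Coll k S} {I K : Obj S} (f : Surj I K) (x : P.ev I) :
    MultilinearMap k (fun i : K => (unit k S).ev (fib f i)) (P.ev I) :=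
  haveI := Fintype.ofFinite K
  (MultilinearMap.mkPiRing k K x).compLinearMap fun i => unitVal (fib f i)

theorem rightMulti_apply {P : Coll k S} {I K : Obj S} [Fintype K] (f : Surj I K) (x : P.ev I)
    (c : ∀ i : K, (unit k S).ev (fib f i)) :
    rightMulti f x c = (∏ i, unitVal (fib f i) (c i)) • x := by
  rw [rightMulti, Subsingleton.elim (Fintype.ofFinite K)]
  rfl

theorem exists_unit_zero {I K : Obj S} (f : Surj I K) (h : ¬ Function.Injective f) :
    ∃ i : K, ∀ c : (unit k S).ev (fib f i), c = 0 := by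
  simp only [Function.Injective, not_forall] at h
  obtain ⟨a, b, hab, hne⟩ := h
  refine ⟨f b, fun c => unit_eq_zero (fun hs => hne ?_) c⟩
  exact congrArg fibVal (Subsingleton.elim (α := fib f (f b)) ⟨a, hab⟩ ⟨b, rfl⟩)

section generic

variable [CompModel k S]

open CompModel

theorem tens_eq_zero_left {P Q : Coll k S} {I K : Obj S} (f : Surj I K) {p : P.ev K} (hp : p = 0)
    (q : ∀ i : K, Q.ev (fib f i)) : tens f p q = 0 := by
  subst hp
  exact (tensLeft P f q).map_zero

theorem tens_eq_zero {P Q : Coll k S} {I K : Obj S} (f : Surj I K) (p : P.ev K)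
    (q : ∀ i : K, Q.ev (fib f i)) (i : K) (h : q i = 0) : tens f p q = 0 :=
  (tensRight Q f p).map_coord_zero i h

theorem tens_smul {P Q : Coll k S} {I K : Obj S} [Fintype K] (f : Surj I K) (p : P.ev K)
    (c : K → k) (q : ∀ i : K, Q.ev (fib f i)) :
    tens f p (fun i => c i • q i) = (∏ i, c i) • tens f p q :=
  (tensRight Q f p).map_smul_univ c q

open Classical in
/-- The map `q ↦ q(i₀)` as a multilinear map, over a one-point index set. -/
def evalMulti (Q : Coll k S) {I K : Obj S} (f : Surj I K) [Subsingleton K] (i : K)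
    (h : ∀ x, f x = i) : MultilinearMap k (fun i : K => Q.ev (fib f i)) (Q.ev I) :=
  MultilinearMap.mk' (fun q => act Q (fullIso f i h) (q i))
    (fun q j x y => by
      obtain rfl := Subsingleton.elim i j
      simp only [Function.update_self, map_add])
    (fun q j c x => by
      obtain rfl := Subsingleton.elim i j
      simp only [Function.update_self, map_smul])

open Classical in
/-- The family defining the left unitor: `c ⊗ q ↦ c q` on the summand of a one-point set. -/
def leftFam (Q : Coll k S) (I : Obj S) : Fam (unit k S) Q I (Q.ev I) where
  toFun {K} f :=
    if h : Subsingleton K then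
      (unitVal K).smulRight (evalMulti Q f (Classical.arbitrary K) fun _ => Subsingleton.elim _ _)
    else 0
  rel {K K'} f f' e h c q := by
    by_cases hK : Subsingleton K
    · have hK' : Subsingleton K' := e.toEquiv.symm.subsingleton
      rw [dif_pos hK, dif_pos hK']
      show unitVal K' c • act Q _ (q _) = unitVal K' c • act Q _ (act Q _ (q _))
      rw [act_act]
      congr 1
      exact act_dep q (Subsingleton.elim _ _) _ _ fun _ => rfl
    · have hK' : ¬ Subsingleton K' := fun h => hK e.toEquiv.subsingleton
      rw [dif_neg hK, dif_neg hK']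
      rfl

/-- The left unitor. -/
def leftHom (Q : Coll k S) : comp (unit k S) Q ⟶ Q :=
  homMake (fun I => compLift (leftFam Q I)) fun {I J} ε x => by
    have : compLift (leftFam Q I) ∘ₗ act (comp (unit k S) Q) ε =
        act Q ε ∘ₗ compLift (leftFam Q J) := comp_ext fun {K} f c q => by
      rw [LinearMap.comp_apply, LinearMap.comp_apply, act_tens, compLift_tens, compLift_tens]
      by_cases hK : Subsingleton K
      · simp only [leftFam, dif_pos hK]
        show unitVal K c • act Q _ (act Q _ (q _)) = act Q ε (unitVal K c • act Q _ (q _))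
        rw [map_smul, act_act, act_act]
        congr 1
      · simp only [leftFam, dif_neg hK]
        exact (map_zero _).symm
    exact congrArg (fun t => t x) this

theorem leftHom_tens {Q : Coll k S} {I K : Obj S} (f : Surj I K) (c : (unit k S).ev K)
    (q : ∀ i : K, Q.ev (fib f i)) (i : K) (h : ∀ x, f x = i) :
    app (leftHom Q) I (tens f c q) = unitVal K c • act Q (fullIso f i h) (q i) := by
  have hK : Subsingleton K := ⟨fun a b => by
    obtain ⟨x, rfl⟩ := Kind.surjective f.surj a
    obtain ⟨y, rfl⟩ := Kind.surjective f.surj b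
    rw [h x, h y]⟩
  refine (compLift_tens _ _ _ _).trans ?_
  simp only [leftFam, dif_pos hK]
  obtain rfl := Subsingleton.elim (Classical.arbitrary K) i
  rfl

open Classical in
/-- The family defining the right unitor: `p ⊗ ⨂ c_i ↦ (∏ c_i) p` on the summands of
isomorphisms. -/
def rightFam (P : Coll k S) (I : Obj S) : Fam P (unit k S) I (P.ev I) where
  toFun {K} f :=
    if h : Function.Injective f then
      { toFun := fun p => rightMulti f (act P (isoOf f h) p)
        map_add' := fun a b => MultilinearMap.ext fun c => by
          have := Fintype.ofFinite K
          rw [add_apply, rightMulti_apply, rightMulti_apply, rightMulti_apply,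
            map_add, smul_add]
        map_smul' := fun a b => MultilinearMap.ext fun c => by
          have := Fintype.ofFinite K
          rw [smul_apply, rightMulti_apply, rightMulti_apply, map_smul,
            smul_comm]
          rfl }
    else 0
  rel {K K'} f f' e h p c := by
    have hff : Function.Injective f ↔ Function.Injective f' := by
      have : (f' : I → K') = e ∘ f := funext fun x => (h x).symm
      rw [this, e.injective.of_comp_iff]
    by_cases hf : Function.Injective f
    · have := Fintype.ofFinite K
      have := Fintype.ofFinite K'
      rw [dif_pos hf, dif_pos (hff.1 hf)]
      show rightMulti f' _ c = rightMulti f _ _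
      rw [rightMulti_apply, rightMulti_apply, act_act]
      congr 1
      · exact (Fintype.prod_equiv e.toEquiv _ _ fun i => rfl).symm
      · exact act_congr _ (fun x => (h x).symm) _
    · rw [dif_neg hf, dif_neg fun h => hf (hff.2 h)]
      rfl

/-- The right unitor. -/
def rightHom (P : Coll k S) : comp P (unit k S) ⟶ P :=
  homMake (fun I => compLift (rightFam P I)) fun {I J} ε x => by
    have : compLift (rightFam P I) ∘ₗ act (comp P (unit k S)) ε =
        act P ε ∘ₗ compLift (rightFam P J) := comp_ext fun {K} f p c => by
      rw [LinearMap.comp_apply, LinearMap.comp_apply, act_tens, compLift_tens, compLift_tens]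
      have hff : Function.Injective f ↔ Function.Injective (f.pre ε) :=
        (Function.Injective.of_comp_iff' f ε.toEquiv.bijective).symm
      by_cases hf : Function.Injective f
      · have := Fintype.ofFinite K
        simp only [rightFam, dif_pos hf, dif_pos (hff.1 hf)]
        show rightMulti _ _ _ = act P ε (rightMulti _ _ _)
        rw [rightMulti_apply, rightMulti_apply, map_smul, act_act]
        congr 1
        exact act_congr P (e := isoOf (f.pre ε) (hff.1 hf)) (e' := ε.trans (isoOf f hf)) (fun _ => rfl) p
      · simp only [rightFam, dif_neg hf, dif_neg fun h => hf (hff.2 h)]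
        exact (map_zero _).symm
    exact congrArg (fun t => t x) this

theorem rightHom_tens {P : Coll k S} {I K : Obj S} [Fintype K] (f : Surj I K) (p : P.ev K)
    (c : ∀ i : K, (unit k S).ev (fib f i)) (h : Function.Injective f) :
    app (rightHom P) I (tens f p c) =
      (∏ i, unitVal (fib f i) (c i)) • act P (isoOf f h) p := by
  refine (compLift_tens _ _ _ _).trans ?_
  simp only [rightFam, dif_pos h]
  exact rightMulti_apply _ _ _

theorem left_naturality {P Q : Coll k S} (θ : P ⟶ Q) :
    compHom (𝟙 (unit k S)) θ ≫ leftHom Q = leftHom P ≫ θ := by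
  refine comp_hom_ext fun {I K} f c q => ?_
  rw [app_comp, app_comp, compHom_tens]
  by_cases hK : Subsingleton K
  · rw [leftHom_tens f _ _ (Classical.arbitrary K) fun _ => Subsingleton.elim _ _,
      leftHom_tens f _ _ (Classical.arbitrary K) fun _ => Subsingleton.elim _ _, map_smul, app_act]
    rfl
  · rw [tens_eq_zero_left f (unit_eq_zero hK _), tens_eq_zero_left f (unit_eq_zero hK _)]
    simp

theorem right_naturality {P Q : Coll k S} (θ : P ⟶ Q) :
    compHom θ (𝟙 (unit k S)) ≫ rightHom Q = rightHom P ≫ θ := by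
  refine comp_hom_ext fun {I K} f p c => ?_
  rw [app_comp, app_comp, compHom_tens]
  by_cases hf : Function.Injective f
  · have := Fintype.ofFinite K
    rw [rightHom_tens f _ _ hf, rightHom_tens f _ _ hf, map_smul, app_act]
    rfl
  · obtain ⟨i, hi⟩ := exists_unit_zero (k := k) f hf
    rw [tens_eq_zero f _ _ i (hi _), tens_eq_zero f _ _ i (hi _)]
    simp

theorem comp_triangle (P Q : Coll k S) :
    assocHom P (unit k S) Q ≫ compHom (𝟙 P) (leftHom Q) = compHom (rightHom P) (𝟙 Q) := by
  refine coll_hom_ext fun I => nested_ext fun {K L} f g p c q => ?_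
  show app (compHom (𝟙 P) (leftHom Q)) I (app (assocHom P (unit k S) Q) I _) = _
  rw [assocHom_tens, compHom_tens, compHom_tens]
  by_cases hg : Function.Injective g
  · have := Fintype.ofFinite L
    rw [rightHom_tens g _ _ hg, tens_smul_left]
    have hc : ∀ l (y : fib g l) x, f.res g l x = y := fun l y x =>
      fib_ext (hg ((fibVal_prop _).trans (fibVal_prop y).symm))
    have : (fun l => app (leftHom Q) (fib (f.comp g) l) (tens (f.res g l) (c l)
        fun i => act Q (resIso f g l i) (q (fibVal i)))) = fun l => unitVal _ (c l) •
          act Q (fullIso (f.res g l) (Classical.arbitrary (fib g l)) (hc l _))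
          (act Q (resIso f g l _) (q (fibVal (Classical.arbitrary (fib g l))))) :=
      funext fun l => leftHom_tens _ _ _ _ _
    rw [this, tens_smul]
    congr 1
    refine tens_congr (isoOf g hg) (fun _ => rfl) rfl fun i η hη => ?_
    rw [act_act, act_act]
    exact act_dep q (hg (fibVal_prop _)) _ (OIso.refl _) hη |>.trans (act_refl _ _)
  · obtain ⟨i, hi⟩ := exists_unit_zero (k := k) g hg
    rw [tens_eq_zero g _ _ i (hi _), map_zero, tens_eq_zero_left f rfl]
    refine tens_eq_zero _ _ _ i ?_
    rw [tens_eq_zero_left _ (hi _), map_zero]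

end generic

/-- A one-point set with structure. -/
def ptObj (I : Obj S) : Obj S :=
  ⟨{x : I // x = Classical.arbitrary I}, Kind.sub I.str _⟩

instance (I : Obj S) : Subsingleton (ptObj I) :=
  inferInstanceAs (Subsingleton {x : I // x = Classical.arbitrary I})

/-- The unique map to a one-point set. -/
def toPt (I K : Obj S) [Subsingleton K] : Surj I K :=
  ⟨fun _ => Classical.arbitrary K,
    Kind.surj_point fun y => ⟨Classical.arbitrary I, Subsingleton.elim _ _⟩⟩

theorem fib_subsingleton {I K : Obj S} {f : Surj I K} (hf : Function.Injective f) (i : K) :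
    Subsingleton (fib f i) :=
  ⟨fun x y => fib_ext (hf ((fibVal_prop x).trans (fibVal_prop y).symm))⟩

section generic

variable [CompModel k S]

open CompModel

open Classical in
theorem left_bijective (Q : Coll k S) (I : Obj S) : Function.Bijective (app (leftHom Q) I) := by
  let a : ptObj I := Classical.arbitrary _
  have ha : ∀ x, toPt I (ptObj I) x = a := fun _ => Subsingleton.elim _ _
  let ι : Q.ev I → ∀ i : ptObj I, Q.ev (fib (toPt I (ptObj I)) i) := fun q i =>
    act Q (fullIso (toPt I (ptObj I)) i fun _ => Subsingleton.elim _ _).symm q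
  have hι : ∀ q q' : Q.ev I, ι q = Function.update (ι q') a (ι q a) := fun q q' => by
    funext i
    obtain rfl := Subsingleton.elim a i
    rw [Function.update_self]
  let inv : Q.ev I →ₗ[k] (comp (unit k S) Q).ev I :=
    { toFun := fun q => tens (toPt I (ptObj I)) (unitOne (ptObj I)) (ι q)
      map_add' := fun q q' => by
        rw [hι (q + q') 0, hι q 0, hι q' 0, ← tens_update_add]
        simp only [ι, map_add]
      map_smul' := fun c q => by
        rw [hι (c • q) 0, hι q 0, RingHom.id_apply, ← tens_update_smul]
        simp only [ι, map_smul] }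
  have h1 : ∀ x, inv (app (leftHom Q) I x) = x := fun x => by
    have : inv ∘ₗ app (leftHom Q) I = LinearMap.id := comp_ext fun {K} f c q => by
      rw [LinearMap.comp_apply, LinearMap.id_apply]
      by_cases hK : Subsingleton K
      · rw [leftHom_tens f _ _ (Classical.arbitrary K) fun _ => Subsingleton.elim _ _, map_smul]
        show _ • tens (toPt I (ptObj I)) (unitOne (ptObj I)) _ = _
        rw [← tens_smul_left]
        refine tens_congr (isoOf (toPt K (ptObj I)) fun _ _ _ => Subsingleton.elim _ _)
          (fun _ => Subsingleton.elim _ _) ?_ fun i η hη => ?_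
        · apply unitVal_injective
          rw [unitVal_act, map_smul]
          exact mul_one _
        · simp only [ι, act_act]
          refine (act_dep q (Subsingleton.elim _ _) _ (OIso.refl _) fun x => ?_).trans (act_refl _ _)
          exact hη x
      · rw [tens_eq_zero_left f (unit_eq_zero hK _), map_zero, map_zero]
    exact congrArg (fun t => t x) this
  refine ⟨Function.LeftInverse.injective h1, fun q => ⟨inv q, ?_⟩⟩
  refine (leftHom_tens _ _ _ a ha).trans ?_
  simp only [ι]
  rw [act_act, act_eq_self _ _ fun x => OIso.apply_symm _ x]
  exact one_smul k q

theorem right_bijective (P : Coll k S) (I : Obj S) : Function.Bijective (app (rightHom P) I) := by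
  let s : Surj I I := (OIso.refl I).toSurj
  have hs : Function.Injective s := fun _ _ h => h
  have := fib_subsingleton hs
  have : Fintype I := Fintype.ofFinite I
  let inv : P.ev I →ₗ[k] (comp P (unit k S)).ev I := tensLeft P s fun i => unitOne (fib s i)
  have h1 : ∀ x, inv (app (rightHom P) I x) = x := fun x => by
    have : inv ∘ₗ app (rightHom P) I = LinearMap.id := comp_ext fun {K} f p c => by
      rw [LinearMap.comp_apply, LinearMap.id_apply]
      by_cases hf : Function.Injective f
      · have : Fintype K := Fintype.ofFinite K
        have := fib_subsingleton hf
        have hc : c = fun i => unitVal (fib f i) (c i) • unitOne (fib f i) := funext fun i =>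
          unitVal_injective _ (by rw [map_smul]; exact (mul_one _).symm)
        rw [rightHom_tens f _ _ hf, map_smul]
        conv_rhs => rw [hc]
        rw [tens_smul]
        congr 1
        exact (tens_congr (isoOf f hf) (fun _ => rfl) rfl fun i η hη => rfl).symm
      · obtain ⟨i, hi⟩ := exists_unit_zero (k := k) f hf
        rw [tens_eq_zero f _ _ i (hi _), map_zero, map_zero]
    exact congrArg (fun t => t x) this
  refine ⟨Function.LeftInverse.injective h1, fun p => ⟨inv p, ?_⟩⟩
  refine (rightHom_tens s p _ hs).trans ?_
  rw [act_eq_self _ _ fun _ => rfl, show (∏ i, unitVal (k := k) (fib s i) (unitOne (fib s i))) = 1 from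
    Finset.prod_eq_one fun _ _ => rfl, one_smul]

theorem compHom_id (P Q : Coll k S) : compHom (𝟙 P) (𝟙 Q) = 𝟙 (comp P Q) :=
  comp_hom_ext fun f p q => compHom_tens _ _ f p q

theorem compHom_comp {P Q P' Q' P'' Q'' : Coll k S} (θ : P ⟶ P') (φ : Q ⟶ Q')
    (θ' : P' ⟶ P'') (φ' : Q' ⟶ Q'') :
    compHom θ φ ≫ compHom θ' φ' = compHom (θ ≫ θ') (φ ≫ φ') :=
  comp_hom_ext fun f p q => by
    rw [app_comp, compHom_tens, compHom_tens, compHom_tens]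
    rfl

/-- The associators of a composition are isomorphisms. -/
class AssocBijective (k : Type u) [Field k] (S : Type → Type) [Kind S] [CompModel k S] : Prop where
  bijective : ∀ (P Q R : Coll k S) (I : Obj S), Function.Bijective (app (assocHom P Q R) I)

/-- The monoidal structure on collections given by a composition. -/
instance [AssocBijective k S] : MonoidalCategory (Coll k S) :=
  letI : MonoidalCategoryStruct (Coll k S) :=
    { tensorObj := comp
      tensorUnit := unit k S
      tensorHom := compHom
      whiskerLeft := fun P _ _ φ => compHom (𝟙 P) φ
      whiskerRight := fun θ Q => compHom θ (𝟙 Q)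
      associator := fun P Q R => isoMake (assocHom P Q R) (AssocBijective.bijective P Q R)
      leftUnitor := fun Q => isoMake (leftHom Q) (left_bijective Q)
      rightUnitor := fun P => isoMake (rightHom P) (right_bijective P) }
  MonoidalCategory.ofTensorHom
    (id_tensorHom_id := compHom_id)
    (id_tensorHom := fun _ _ _ _ => rfl)
    (tensorHom_id := fun _ _ => rfl)
    (tensorHom_comp_tensorHom := fun _ _ _ _ => compHom_comp _ _ _ _)
    (associator_naturality := fun _ _ _ => assoc_naturality _ _ _)
    (leftUnitor_naturality := fun _ => left_naturality _)
    (rightUnitor_naturality := fun _ => right_naturality _)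
    (pentagon := fun P Q R W => assoc_pentagon P Q R W)
    (triangle := fun P Q => comp_triangle P Q)

end generic

open scoped DirectSum TensorProduct

/-- A kind of structure together with a standard structure on every set `[n]`, `n ≥ 1`, such that
every nonempty finite set with structure is isomorphic to a standard one. -/
class StdKind (S : Type → Type) extends Kind S where
  std : ∀ n : ℕ, S (Fin (n + 1))
  exists_iso : ∀ {A : Type} [Finite A] [Nonempty A] (s : S A),
    ∃ (n : ℕ) (e : A ≃ Fin (n + 1)), emb s (std n) e

instance : StdKind NoStr where
  std _ := ()
  exists_iso {A} _ _ _ := by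
    obtain ⟨n, ⟨e⟩⟩ := Finite.exists_equiv_fin A
    cases n with
    | zero => exact (e (Classical.arbitrary A)).elim0
    | succ n => exact ⟨n, e, trivial⟩

instance : StdKind LinearOrder where
  std _ := inferInstance
  exists_iso {A} _ _ s := by
    have : Fintype A := Fintype.ofFinite A
    have h : Fintype.card A = (Fintype.card A - 1) + 1 := by
      have := Fintype.card_pos (α := A)
      omega
    exact ⟨_, (Fintype.orderIsoFinOfCardEq A h).symm.toEquiv,
      fun a b => (Fintype.orderIsoFinOfCardEq A h).symm.le_iff_le⟩

/-- The set `[n]`, for `n ≥ 1` (written as `n + 1` with `n ≥ 0`). -/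
def std (S : Type → Type) [StdKind S] (n : ℕ) : Obj S := ⟨Fin (n + 1), StdKind.std n⟩

section presentation

variable {S : Type → Type} [StdKind S]

/-- `⨁_n P([n]) ⊗ (⨁_{f : I → [n]} ⨂_i Q(f⁻¹(i)))`, with `f` running over the admissible
surjections. -/
abbrev preComp (P Q : Coll k S) (I : Obj S) : Type u :=
  ⨁ n : ℕ, P.ev (std S n) ⊗[k]
    (⨁ f : Surj I (std S n), PiTensorProduct k fun i : std S n => Q.ev (fib f i))

open Classical in
/-- The element `p ⊗ ⨂ q_i` in the summand of `n` and `f`. -/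
def preTens {P Q : Coll k S} {I : Obj S} {n : ℕ} (f : Surj I (std S n)) (p : P.ev (std S n))
    (q : ∀ i : std S n, Q.ev (fib f i)) : preComp P Q I :=
  DirectSum.lof k ℕ (fun n : ℕ => P.ev (std S n) ⊗[k]
    (⨁ f : Surj I (std S n), PiTensorProduct k fun i : std S n => Q.ev (fib f i))) n
    (p ⊗ₜ[k] DirectSum.lof k (Surj I (std S n))
      (fun f => PiTensorProduct k fun i : std S n => Q.ev (fib f i)) f (PiTensorProduct.tprod k q))

/-- The relations `p·σ ⊗ x = p ⊗ σ·x` for automorphisms `σ` of `[n]`. -/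
def automRel (P Q : Coll k S) (I : Obj S) : Submodule k (preComp P Q I) :=
  Submodule.span k {z | ∃ (n : ℕ) (σ : OIso (std S n) (std S n)) (f f' : Surj I (std S n))
    (h : ∀ x, σ (f x) = f' x) (p : P.ev (std S n)) (q : ∀ i : std S n, Q.ev (fib f' i)),
    z = preTens f (act P σ p) (fun i => act Q (postIso f f' σ h i) (q (σ i))) - preTens f' p q}

theorem preTens_add_left {P Q : Coll k S} {I : Obj S} {n : ℕ} (f : Surj I (std S n))
    (p p' : P.ev (std S n)) (q : ∀ i : std S n, Q.ev (fib f i)) :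
    preTens f (p + p') q = preTens f p q + preTens f p' q := by
  rw [preTens, TensorProduct.add_tmul, map_add]; rfl

theorem preTens_smul_left {P Q : Coll k S} {I : Obj S} {n : ℕ} (f : Surj I (std S n))
    (c : k) (p : P.ev (std S n)) (q : ∀ i : std S n, Q.ev (fib f i)) :
    preTens f (c • p) q = c • preTens f p q := by
  rw [preTens, ← TensorProduct.smul_tmul', map_smul]; rfl

theorem preTens_update_add {P Q : Coll k S} {I : Obj S} {n : ℕ} [DecidableEq (std S n)]
    (f : Surj I (std S n)) (p : P.ev (std S n)) (q : ∀ i : std S n, Q.ev (fib f i))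
    (i : std S n) (x y : Q.ev (fib f i)) :
    preTens f p (Function.update q i (x + y)) =
      preTens f p (Function.update q i x) + preTens f p (Function.update q i y) := by
  rw [preTens, MultilinearMap.map_update_add, map_add, TensorProduct.tmul_add, map_add]; rfl

theorem preTens_update_smul {P Q : Coll k S} {I : Obj S} {n : ℕ} [DecidableEq (std S n)]
    (f : Surj I (std S n)) (p : P.ev (std S n)) (q : ∀ i : std S n, Q.ev (fib f i))
    (i : std S n) (c : k) (x : Q.ev (fib f i)) :
    preTens f p (Function.update q i (c • x)) = c • preTens f p (Function.update q i x) := by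
  rw [preTens, MultilinearMap.map_update_smul, map_smul, TensorProduct.tmul_smul, map_smul]; rfl

theorem pre_ext {P Q : Coll k S} {I : Obj S} {M : Type u} [AddCommGroup M] [Module k M]
    {φ ψ : preComp P Q I →ₗ[k] M} (h : ∀ {n : ℕ} (f : Surj I (std S n)) (p : P.ev (std S n))
      (q : ∀ i : std S n, Q.ev (fib f i)), φ (preTens f p q) = ψ (preTens f p q)) : φ = ψ := by
  classical
  refine DirectSum.linearMap_ext k fun n => TensorProduct.ext <| LinearMap.ext fun p =>
    DirectSum.linearMap_ext k fun f => PiTensorProduct.ext <| MultilinearMap.ext fun q => ?_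
  exact h f p q

open Classical in
/-- The linear map given by a family. -/
def preLift {P Q : Coll k S} {I : Obj S} {M : Type u} [AddCommGroup M] [Module k M]
    (F : Fam P Q I M) : preComp P Q I →ₗ[k] M :=
  DirectSum.toModule k ℕ M fun n => TensorProduct.lift
    { toFun := fun p => DirectSum.toModule k (Surj I (std S n)) M fun f =>
        PiTensorProduct.lift (F.toFun f p)
      map_add' := fun p p' => DirectSum.linearMap_ext k fun f => by
        ext q; simp
      map_smul' := fun c p => DirectSum.linearMap_ext k fun f => by
        ext q; simp }

theorem preLift_preTens {P Q : Coll k S} {I : Obj S} {M : Type u} [AddCommGroup M] [Module k M]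
    (F : Fam P Q I M) {n : ℕ} (f : Surj I (std S n)) (p : P.ev (std S n))
    (q : ∀ i : std S n, Q.ev (fib f i)) : preLift F (preTens f p q) = F.toFun f p q := by
  classical
  simp [preLift, preTens]

/-- Postcomposition with an isomorphism. -/
def Surj.post {I K L : Obj S} (f : Surj I K) (e : OIso K L) : Surj I L := f.comp e.toSurj

/-- A fibre of `e ∘ f`. -/
def postIso' {I K L : Obj S} (f : Surj I K) (e : OIso K L) (j : L) :
    OIso (fib (f.post e) j) (fib f (e.symm j)) :=
  fibIso (OIso.refl I) (f.post e) f j (e.symm j) fun x =>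
    (Equiv.eq_symm_apply e.toEquiv (x := j) (y := f x)).symm

/-- The element `p ⊗ ⨂ q_i` for a surjection to an arbitrary `K`, transported along `K ≅ [n]`. -/
def transTens {P Q : Coll k S} {I K : Obj S} {n : ℕ} (e : OIso K (std S n)) (f : Surj I K)
    (p : P.ev K) (q : ∀ i : K, Q.ev (fib f i)) : preComp P Q I :=
  preTens (f.post e) (act P e.symm p) (fun j => act Q (postIso' f e j) (q (e.symm j)))

theorem preTens_congr {P Q : Coll k S} {I : Obj S} {n : ℕ} {f f' : Surj I (std S n)}
    {p p' : P.ev (std S n)} {q : ∀ i : std S n, Q.ev (fib f i)}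
    {q' : ∀ i : std S n, Q.ev (fib f' i)} (h : ∀ x, f x = f' x) (hp : p' = p)
    (hq : ∀ i (η : OIso (fib f i) (fib f' i)), (∀ x, fibVal (η x) = fibVal x) →
      act Q η (q' i) = q i) : preTens f' p' q' = preTens f p q := by
  obtain rfl := Surj.ext' h
  subst hp
  congr 1
  funext i
  rw [← hq i (OIso.refl _) fun _ => rfl, act_refl]

theorem transTens_update {P Q : Coll k S} {I K : Obj S} {n : ℕ} [DecidableEq K]
    [DecidableEq (std S n)] (e : OIso K (std S n)) (f : Surj I K) (p : P.ev K)
    (q : ∀ i : K, Q.ev (fib f i)) (i : K) (x : Q.ev (fib f i)) :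
    transTens e f p (Function.update q i x) =
      preTens (f.post e) (act P e.symm p) (Function.update
        (fun j => act Q (postIso' f e j) (q (e.symm j))) (e i)
        (act Q (postIso f (f.post e) e (fun _ => rfl) i).symm x)) := by
  rw [transTens]
  congr 1
  funext j
  obtain ⟨i', rfl⟩ := e.toEquiv.surjective j
  by_cases hi : i' = i
  · subst hi
    rw [Function.update_self]
    refine (act_dep _ (e.symm_apply i') _ (postIso f (f.post e) e (fun _ => rfl) i').symm
      fun x => rfl).trans ?_
    rw [Function.update_self]
  · rw [Function.update_of_ne fun h => hi (e.injective h), Function.update_of_ne]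
    exact fun h => hi ((e.symm_apply i').symm.trans h)

theorem transTens_sub_mem {P Q : Coll k S} {I K : Obj S} {n m : ℕ} (e : OIso K (std S n))
    (e' : OIso K (std S m)) (f : Surj I K) (p : P.ev K) (q : ∀ i : K, Q.ev (fib f i)) :
    transTens e f p q - transTens e' f p q ∈ automRel P Q I := by
  obtain rfl : n = m := by
    have h1 : Nat.card K = n + 1 := (Nat.card_congr e.toEquiv).trans (Nat.card_fin _)
    have h2 : Nat.card K = m + 1 := (Nat.card_congr e'.toEquiv).trans (Nat.card_fin _)
    omega
  refine Submodule.subset_span ⟨n, e.symm.trans e', f.post e, f.post e',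
    fun x => congrArg e' (e.symm_apply (f x)), act P e'.symm p,
    fun j => act Q (postIso' f e' j) (q (e'.symm j)), ?_⟩
  congr 1
  refine preTens_congr (fun _ => rfl) ?_ fun i η hη => ?_
  · rw [act_act]
    exact act_congr _ (fun x => (e'.symm_apply _).symm) _
  · rw [act_act, act_act]
    exact act_dep q (e'.symm_apply _).symm _ _ fun x => hη x

/-- A composition presented as a quotient of `preComp` by the relations `automRel`. -/
structure Presentation (P Q : Coll k S) (I : Obj S) where
  M : ModuleCat.{u} k
  π : preComp P Q I →ₗ[k] M
  surj : Function.Surjective π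
  ker : LinearMap.ker π = automRel P Q I

variable (pres : ∀ (P Q : Coll k S) (I : Obj S), Presentation P Q I)

open Classical in
/-- The universal family. -/
def presGen (P Q : Coll k S) (I : Obj S) : Fam P Q I (pres P Q I).M where
  toFun {K} f :=
    let h := StdKind.exists_iso K.str
    let e : OIso K (std S h.choose) := ⟨h.choose_spec.choose, h.choose_spec.choose_spec⟩
    { toFun := fun p => MultilinearMap.mk' (fun q => (pres P Q I).π (transTens e f p q))
        (fun q i x y => by
          rw [transTens_update, transTens_update, transTens_update, map_add, preTens_update_add,
            map_add])
        (fun q i c x => by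
          rw [transTens_update, transTens_update, map_smul, preTens_update_smul, map_smul])
      map_add' := fun p p' => MultilinearMap.ext fun q => by
        show (pres P Q I).π (transTens e f (p + p') q) = (pres P Q I).π (transTens e f p q) +
          (pres P Q I).π (transTens e f p' q)
        rw [transTens, map_add, preTens_add_left, map_add]; rfl
      map_smul' := fun c p => MultilinearMap.ext fun q => by
        show (pres P Q I).π (transTens e f (c • p) q) = c • (pres P Q I).π (transTens e f p q)
        rw [transTens, map_smul, preTens_smul_left, map_smul]; rfl }
  rel {K K'} f f' e h p q := by
    refine sub_eq_zero.1 ?_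
    refine (map_sub (pres P Q I).π _ _).symm.trans ?_
    rw [← LinearMap.mem_ker, (pres P Q I).ker]
    have key : ∀ {n m : ℕ} (a : OIso K' (std S n)) (b : OIso K (std S m)),
        transTens a f' p q - transTens b f (act P e p)
          (fun i => act Q (postIso f f' e h i) (q (e i))) ∈ automRel P Q I := fun a b => by
      have hEq : transTens a f' p q = transTens (e.trans a) f (act P e p)
          (fun i => act Q (postIso f f' e h i) (q (e i))) := by
        refine preTens_congr (fun x => congrArg a (h x)) ?_ fun i η hη => ?_
        · rw [act_act]
          exact act_congr P (fun x => (e.apply_symm _).symm) p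
        · rw [act_act, act_act]
          exact act_dep q (e.apply_symm _).symm _ _ fun x => hη x
      rw [hEq]
      exact transTens_sub_mem _ _ _ _ _
    exact key _ _

theorem pres_transTens {P Q : Coll k S} {I K : Obj S} {n : ℕ} (e : OIso K (std S n))
    (f : Surj I K) (p : P.ev K) (q : ∀ i : K, Q.ev (fib f i)) :
    (presGen pres P Q I).toFun f p q = (pres P Q I).π (transTens e f p q) := by
  refine sub_eq_zero.1 ?_
  refine (map_sub (pres P Q I).π _ _).symm.trans ?_
  rw [← LinearMap.mem_ker, (pres P Q I).ker]
  exact transTens_sub_mem _ _ _ _ _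

theorem pres_preTens {P Q : Coll k S} {I : Obj S} {n : ℕ} (f : Surj I (std S n))
    (p : P.ev (std S n)) (q : ∀ i : std S n, Q.ev (fib f i)) :
    (presGen pres P Q I).toFun f p q = (pres P Q I).π (preTens f p q) := by
  rw [pres_transTens pres (OIso.refl _)]
  congr 1
  refine preTens_congr (fun _ => rfl) (act_eq_self _ _ (fun _ => rfl) _) fun i η hη => ?_
  rw [act_act]
  exact act_eq_self _ _ (fun x => fib_ext (hη x)) _

theorem automRel_le_ker {P Q : Coll k S} {I : Obj S} {M : Type u} [AddCommGroup M] [Module k M]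
    (F : Fam P Q I M) : automRel P Q I ≤ LinearMap.ker (preLift F) := by
  refine Submodule.span_le.2 ?_
  rintro _ ⟨n, σ, f, f', h, p, q, rfl⟩
  rw [SetLike.mem_coe, LinearMap.mem_ker, map_sub, preLift_preTens, preLift_preTens,
    F.rel f f' σ h, sub_self]

/-- A composition from a presentation. -/
@[reducible] def modelOfPres : CompModel k S where
  T P Q I := (pres P Q I).M
  gen := presGen pres
  lift {P Q I M} _ _ F := preLift F ∘ₗ
    ((pres P Q I).π.exists_rightInverse_of_surjective
      (LinearMap.range_eq_top.2 (pres P Q I).surj)).choose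
  lift_gen {P Q I M} _ _ F {K} f p q := by
    have hs := ((pres P Q I).π.exists_rightInverse_of_surjective
      (LinearMap.range_eq_top.2 (pres P Q I).surj)).choose_spec
    set s := ((pres P Q I).π.exists_rightInverse_of_surjective
      (LinearMap.range_eq_top.2 (pres P Q I).surj)).choose
    obtain ⟨n, e, he⟩ := StdKind.exists_iso K.str
    let a : OIso K (std S n) := ⟨e, he⟩
    rw [pres_transTens pres a]
    have h1 : s ((pres P Q I).π (transTens a f p q)) - transTens a f p q ∈ automRel P Q I := by
      rw [← (pres P Q I).ker, LinearMap.mem_ker, map_sub, sub_eq_zero]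
      exact congrArg (fun t => t ((pres P Q I).π (transTens a f p q))) hs
    have h2 := automRel_le_ker F h1
    rw [LinearMap.mem_ker, map_sub, sub_eq_zero] at h2
    rw [LinearMap.comp_apply, h2, transTens, preLift_preTens,
      F.rel f (f.post a) a (fun _ => rfl), act_act, act_eq_self _ _ fun x => a.symm_apply x]
    congr 1
    funext i
    rw [act_act]
    exact (act_dep q (a.symm_apply i) _ (OIso.refl _) fun _ => rfl).trans (act_refl _ _)
  hom_ext {P Q I M} _ _ φ ψ h := by
    have : φ ∘ₗ (pres P Q I).π = ψ ∘ₗ (pres P Q I).π := pre_ext fun f p q => by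
      have := h f p q
      rw [pres_preTens] at this
      exact this
    refine LinearMap.ext fun x => ?_
    obtain ⟨y, rfl⟩ := (pres P Q I).surj x
    exact congrArg (fun t => t y) this

end presentation

/-- The category of nonempty finite ordered sets. -/
abbrev OrdSet := Obj LinearOrder

/-- The category of nonempty finite sets. -/
abbrev FinSet := Obj NoStr

/-- Nonsymmetric collections. -/
abbrev NSColl (k : Type u) [Field k] := Coll k LinearOrder

/-- Symmetric collections. -/
abbrev SymColl (k : Type u) [Field k] := Coll k NoStr

theorem ordered_aut (n : ℕ) (σ : OIso (std LinearOrder n) (std LinearOrder n)) (i) : σ i = i := by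
  let e : Fin (n + 1) ≃o Fin (n + 1) := ⟨σ.toEquiv, fun {a b} => σ.emb a b⟩
  have : e = OrderIso.refl _ := Subsingleton.elim _ _
  exact congrArg (fun t : Fin (n + 1) ≃o Fin (n + 1) => t i) this

/-- The shuffle composition: `⨁_n P([n]) ⊗ (⨁_f ⨂_i Q(f⁻¹(i)))`, with `f : I → [n]` running over
the shuffling surjections. -/
def shufflePres (P Q : NSColl k) (I : OrdSet) : Presentation P Q I where
  M := ModuleCat.of k (preComp P Q I)
  π := LinearMap.id
  surj := Function.surjective_id
  ker := by
    rw [LinearMap.ker_id, eq_comm, eq_bot_iff]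
    refine Submodule.span_le.2 ?_
    rintro _ ⟨n, σ, f, f', h, p, q, rfl⟩
    refine sub_eq_zero.2 ?_
    obtain rfl : σ = OIso.refl _ := OIso.ext' (ordered_aut n σ)
    refine (preTens_congr h (act_refl P p).symm fun i η hη => ?_).symm
    exact act_congr _ (fun x => fib_ext (hη x)) _

instance : CompModel k LinearOrder := modelOfPres shufflePres

/-- The symmetric composition: `⨁_n P([n]) ⊗_{k S_n} (⨁_f ⨂_i Q(f⁻¹(i)))`, with `f : I → [n]`
running over all surjections. -/
def symPres (P Q : SymColl k) (I : FinSet) : Presentation P Q I where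
  M := ModuleCat.of k (preComp P Q I ⧸ automRel P Q I)
  π := (automRel P Q I).mkQ
  surj := Submodule.mkQ_surjective _
  ker := Submodule.ker_mkQ _

instance : CompModel k NoStr := modelOfPres symPres

/-- The functor from ordered sets to sets. -/
def forgetOrd : OrdSet ⥤ FinSet where
  obj I := ⟨I.carrier, ()⟩
  map {I J} e := ⟨OIso.toEquiv (I := I) (J := J) e, trivial⟩

/-- A shuffling surjection, as a surjection. -/
def Surj.forget {I K : OrdSet} (f : Surj I K) : Surj (forgetOrd.obj I) (forgetOrd.obj K) :=
  ⟨f.toFun, Kind.surjective f.surj⟩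

/-- The forgetful functor from symmetric to nonsymmetric collections, `P^f(I) = P(I^f)`. -/
def forgetColl (k : Type u) [Field k] : SymColl k ⥤ NSColl k :=
  (Functor.whiskeringLeft _ _ _).obj forgetOrd.op

/-- Subcollections. -/
@[ext] structure Subcollection (P : Coll k S) where
  carrier : ∀ I : Obj S, Submodule k (P.ev I)
  act_mem : ∀ {I J : Obj S} (e : OIso I J) {x : P.ev J}, x ∈ carrier J → act P e x ∈ carrier I

/-- The restriction of a symmetric subcollection to ordered sets. -/
def Subcollection.forget {P : SymColl k} (R : Subcollection P) :
    Subcollection ((forgetColl k).obj P) where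
  carrier I := R.carrier (forgetOrd.obj I)
  act_mem e _ hx := R.act_mem (forgetOrd.map e) hx

/-- The image of a subcollection under a morphism of collections. -/
def Subcollection.map {P Q : Coll k S} (θ : P ⟶ Q) (R : Subcollection P) : Subcollection Q where
  carrier I := (R.carrier I).map (app θ I)
  act_mem {I J} e _ := by
    rintro ⟨x, hx, rfl⟩
    exact ⟨act P e x, R.act_mem e hx, app_act θ e x⟩

section operads

variable [CompModel k S] [AssocBijective k S]

/-- Operads: monoids in the monoidal category of collections. -/
abbrev Operad (k : Type u) [Field k] (S : Type → Type) [Kind S] [CompModel k S]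
    [AssocBijective k S] := Mon (Coll k S)

/-- The composition map of an operad. -/
def Operad.mul (O : Operad k S) : comp O.X O.X ⟶ O.X := MonObj.mul

/-- A subcollection of an operad is a (two-sided) ideal if a composition of elements of the operad
belongs to it as soon as one of the composed elements does. -/
def IsIdeal (O : Operad k S) (J : Subcollection O.X) : Prop :=
  ∀ {I K : Obj S} (f : Surj I K) (p : O.X.ev K) (q : ∀ i : K, O.X.ev (fib f i)),
    (p ∈ J.carrier K ∨ ∃ i, q i ∈ J.carrier (fib f i)) →
      app (Operad.mul O) I (tens f p q) ∈ J.carrier I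

/-- The ideal generated by a subcollection. -/
def idealSpan (O : Operad k S) (R : Subcollection O.X) : Subcollection O.X where
  carrier I := ⨅ J : {J : Subcollection O.X // IsIdeal O J ∧ ∀ I, R.carrier I ≤ J.carrier I},
    J.1.carrier I
  act_mem e x hx := by
    rw [Submodule.mem_iInf] at *
    exact fun J => J.1.act_mem e (hx J)

theorem idealSpan_isIdeal (O : Operad k S) (R : Subcollection O.X) : IsIdeal O (idealSpan O R) := by
  intro I K f p q h
  refine (Submodule.mem_iInf _).2 fun J => J.2.1 f p q ?_
  rcases h with h | ⟨i, h⟩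
  · exact .inl ((Submodule.mem_iInf _).1 h J)
  · exact .inr ⟨i, (Submodule.mem_iInf _).1 h J⟩

/-- `ι : V → F` exhibits the operad `F` as the free operad generated by the collection `V`. -/
def IsFree {V : Coll k S} (F : Operad k S) (ι : V ⟶ F.X) : Prop :=
  ∀ (A : Operad k S) (φ : V ⟶ A.X), ∃! ψ : F ⟶ A, ι ≫ ψ.hom = φ

end operads
end ShuffleOperad

end

open ShuffleOperad

/-! The key fact: for an ordered set `I` and a surjection `f` from its underlying set onto a bare
set `K`, exactly one order on `K` makes `f` shuffling, namely the order by least elements of the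
fibres. In the symmetric composition, surjections that differ by a renumbering of `K` are
identified, so every element `p ⊗_f (q_i)` has one shuffling representative. This makes the
comparison of the two compositions bijective (`forgetMu_bijective`). The coherence conditions then
hold because the associator and unit formulas never look at the orders.

Associativity is treated for both compositions at once. The class `ImageKind` isolates what is
needed of the structure: the target of a surjection inherits a unique structure, and the second
factor of an admissible composite is admissible. To invert the associator on `p ⊗_f (x_l)` with `x_l
= q_l ⊗ (r_i)`, the middle sets of the `x_l` are glued into their disjoint union, a quotient of `I`
lying over the target of `f` (`exists_glues`); the result does not depend on choices
(`Glues.unique`). Elements of `Q ∘ R` are only sums of such `x_l`, so the construction is extended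
to a multilinear map by `exists_multilinear_of_generators`.

The restriction functor has a right adjoint: coinduction sends `A` to the product of the values of
`A` over all linear orders on a set. A strong monoidal left adjoint preserves free monoids
(`existsUnique_mapMon`), so the restriction of a free symmetric operad on `V` is free on the
restriction of `V`. The isomorphism `e` and its uniqueness are then those of free objects.

Free operads are constructed in the style of the adjoint functor theorem. Inside the product of all
operads `A` equipped with a morphism `V ⟶ A`, take the part generated by `V` and the units. The
product is too large for the universe, but the generated part is small. The projections are jointly
monic, so the operad axioms are inherited from the factors, and each projection is the required
extension.

For ideals, restriction sends symmetric ideals to shuffle ideals. Conversely, for a shuffle ideal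
`J`, the elements lying in `J` for every order form a symmetric ideal (`IsIdeal.allOrders`). Since a
symmetric subcollection contained in `J` lies in it for every order, the two generated ideals agree
(`forget_idealSpan`). -/

noncomputable section

namespace ShuffleOperad

section

/-! ### Multilinear maps prescribed on spanning families. -/

section multilinear

open Module

/-- A function on tuples of generators which is linear in every coordinate extends to a
multilinear map. -/
theorem exists_multilinear_of_generators {k : Type*} [Field k] {ι : Type*} [Finite ι]
    [DecidableEq ι] {T X : ι → Type*} [∀ i, AddCommGroup (T i)] [∀ i, Module k (T i)]
    {M : Type*} [AddCommGroup M] [Module k M] (γ : ∀ i, X i → T i)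
    (hγ : ∀ i, Submodule.span k (Set.range (γ i)) = ⊤) (G : (∀ i, X i) → M)
    (hG : ∀ x i, ∃ N : T i →ₗ[k] M, ∀ y, N (γ i y) = G (Function.update x i y)) :
    ∃ B : MultilinearMap k T M, ∀ x, B (fun i => γ i (x i)) = G x := by
  -- Over a field each factor has a basis made of generators; `c` records a generator for each basis
  -- vector. The map `B` below is forced by its values on these.
  have hb : ∀ i, ∃ (s : Set (T i)) (b : Basis s k (T i)) (c : s → X i), ∀ p, b p = γ i (c p) := by
    intro i
    obtain ⟨s, hs, hspan, hli⟩ := exists_linearIndependent k (Set.range (γ i))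
    have hc : ∀ p : s, ∃ x, γ i x = p := fun p => hs p.2
    choose c hc using hc
    refine ⟨s, Basis.mk hli ?_, c, fun p => ?_⟩
    · rw [Subtype.range_coe, hspan, hγ]
    · rw [Basis.mk_apply, hc]
  choose s b c hbc using hb
  let B : MultilinearMap k T M := ((Basis.piTensorProduct b).constr k
    (fun p => G fun i => c i (p i))).compMultilinearMap (PiTensorProduct.tprod k)
  have hB : ∀ p : ∀ i, s i, B (fun i => b i (p i)) = G fun i => c i (p i) := fun p => by
    have := (Basis.piTensorProduct b).constr_basis k (fun p => G fun i => c i (p i)) p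
    rwa [Basis.piTensorProduct_apply] at this
  -- Induction on the set `t` of coordinates where an arbitrary generator is allowed; all others
  -- carry chosen basis generators.
  have key : ∀ t : Finset ι, ∀ x : ∀ i, X i, (∀ i ∉ t, ∃ p, x i = c i p) →
      B (fun i => γ i (x i)) = G x := by
    intro t
    induction t using Finset.induction_on with
    | empty =>
      intro x hx
      choose p hp using fun i => hx i (Finset.notMem_empty i)
      obtain rfl : x = fun i => c i (p i) := funext hp
      simp_rw [← hbc]
      exact hB p
    | insert a t _ ih =>
      intro x hx
      obtain ⟨N, hN⟩ := hG x a
      have hupd : ∀ y, (fun i => γ i (Function.update x a y i)) =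
          Function.update (fun i => γ i (x i)) a (γ a y) := fun y => by
        funext i
        by_cases hi : i = a
        · subst hi; simp
        · simp [hi]
      -- In the coordinate `a`, both `B` and `G` are given by linear maps, so it suffices to compare
      -- them on the basis, where the induction hypothesis applies.
      have hlin : B.toLinearMap (fun i => γ i (x i)) a = N := (b a).ext fun p => by
        rw [hbc, hN, MultilinearMap.toLinearMap_apply, ← hupd]
        refine ih _ fun i hi => ?_
        by_cases hia : i = a
        · subst hia; exact ⟨p, Function.update_self _ _ _⟩
        · rw [Function.update_of_ne hia]
          exact hx i (by simp [hia, hi])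
      have h1 := hN (x a)
      rw [← hlin, MultilinearMap.toLinearMap_apply, Function.update_eq_self,
        Function.update_eq_self] at h1
      exact h1
  have := Fintype.ofFinite ι
  exact ⟨B, fun x => key Finset.univ x fun i hi => absurd (Finset.mem_univ i) hi⟩

end multilinear

/-! ### Structures inherited by the targets of surjections. -/

/-- A kind of structure for which the target of a surjection inherits a unique structure. -/
class ImageKind (S : Type → Type) [Kind S] : Prop where
  exists_surj : ∀ {A B : Type} [Finite A] (s : S A) (f : A → B), f.Surjective →
    ∃ t : S B, Kind.surj s t f
  emb_of_comp : ∀ {A B C : Type} [Finite A] {s : S A} {t : S B} {r : S C} {f : A → B} {g : B → C},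
    g.Bijective → Kind.surj s t f → Kind.surj s r (g ∘ f) → Kind.emb t r g
  surj_of_comp : ∀ {A B C : Type} [Finite A] {s : S A} {t : S B} {r : S C} {f : A → B} {g : B → C},
    Kind.surj s t f → Kind.surj s r (g ∘ f) → Kind.surj t r g

instance : ImageKind NoStr where
  exists_surj _ _ h := ⟨(), h⟩
  emb_of_comp _ _ _ := trivial
  surj_of_comp _ h := Function.Surjective.of_comp h

/-- The order on the target of a surjection by the least elements of the fibres. -/
theorem exists_shuffling {A B : Type} [Finite A] (s : LinearOrder A) (f : A → B)
    (hf : f.Surjective) : ∃ t : LinearOrder B, IsShuffling s t f := by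
  have h : ∀ b, ∃ a, f a = b ∧ ∀ x, f x = b → a ≤ x := fun b => by
    obtain ⟨a, ha⟩ := hf b
    obtain ⟨m, hm, hm'⟩ := Set.exists_min_image (f ⁻¹' {b}) id (Set.toFinite _) ⟨a, ha⟩
    exact ⟨m, hm, fun x hx => hm' x hx⟩
  choose σ hσ hmin using h
  have hinj : σ.Injective := fun a b hab => by rw [← hσ a, hab, hσ]
  refine ⟨LinearOrder.lift' σ hinj, (isShuffling_iff _ _ _).2 ⟨hf, fun i y hy => ?_⟩⟩
  exact ⟨σ i, hσ i, lt_of_lt_of_le (show σ i < σ (f y) from hy) (hmin _ _ rfl)⟩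

/-- Let `m` be the least element over `y`. If `i < g y`, shuffling of `g ∘ f` gives `x < m` with `g
(f x) = i`. Then `f x < y`: if `f x = y`, minimality of `m` fails, and if `y < f x`, shuffling of
`f` gives an element over `y` below `x`, hence below `m`. -/
theorem IsShuffling.of_comp {A B C : Type} [Finite A] {s : LinearOrder A} {t : LinearOrder B}
    {r : LinearOrder C} {f : A → B} {g : B → C} (hf : IsShuffling s t f)
    (hgf : IsShuffling s r (g ∘ f)) : IsShuffling t r g := by
  have : Finite B := Finite.of_surjective f hf.1
  rw [isShuffling_iff]
  refine ⟨hgf.1.of_comp, fun i y hy => ?_⟩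
  by_contra hcon
  push Not at hcon
  obtain ⟨a, ha⟩ := hf.1 y
  obtain ⟨m, hm, hm'⟩ := Set.exists_min_image (f ⁻¹' {y}) id (Set.toFinite _) ⟨a, ha⟩
  obtain ⟨x, hx, hxm⟩ := ((isShuffling_iff _ _ _).1 hgf).2 i m
    (by rw [Function.comp_apply, show f m = y from hm]; exact hy)
  have hle := hcon (f x) hx
  rcases hle.lt_or_eq with h | h
  · obtain ⟨x', hx', hlt⟩ := ((isShuffling_iff _ _ _).1 hf).2 y x h
    exact lt_irrefl _ ((hlt.trans hxm).trans_le (hm' x' hx'))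
  · exact lt_irrefl _ (hxm.trans_le (hm' x h.symm))

instance : ImageKind LinearOrder where
  exists_surj s f hf := exists_shuffling s f hf
  emb_of_comp {A B C _ s t r f g} hg hf hgf := by
    have : Finite B := Finite.of_surjective f hf.1
    exact Kind.emb_of_surj hg.1 (IsShuffling.of_comp hf hgf)
  surj_of_comp hf hgf := hf.of_comp hgf

variable {S : Type → Type} [Kind S]

section image

variable [ImageKind S]

/-- The isomorphism between two images of the same map. -/
def imageIso {I K K' : Obj S} (f : Surj I K) (f' : Surj I K') (e : K ≃ K')
    (h : ∀ x, e (f x) = f' x) : OIso K K' :=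
  ⟨e, ImageKind.emb_of_comp e.bijective f.surj
    (by rw [show e ∘ f.toFun = f'.toFun from funext h]; exact f'.surj)⟩

/-- Equal kernels give a bijection of the targets, and it preserves the structures because these are
determined by the structure of `I`. -/
theorem exists_imageIso {I K K' : Obj S} (f : Surj I K) (f' : Surj I K')
    (h : ∀ x y, f x = f y ↔ f' x = f' y) : ∃ e : OIso K K', ∀ x, e (f x) = f' x := by
  choose s hs using Kind.surjective f.surj
  have h1 : ∀ x, f' (s (f x)) = f' x := fun x => (h _ _).1 (hs _)
  have hb : Function.Bijective fun y => f' (s y) := by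
    refine ⟨fun a b hab => ?_, fun z => ?_⟩
    · rw [← hs a, ← hs b]; exact (h _ _).2 hab
    · obtain ⟨x, rfl⟩ := Kind.surjective f'.surj z
      exact ⟨f x, h1 x⟩
  exact ⟨imageIso f f' (Equiv.ofBijective _ hb) h1, h1⟩

/-- The target of a surjection, with its induced structure. -/
def imageObj (I : Obj S) {B : Type} (f : I → B) (hf : f.Surjective) : Obj S :=
  haveI := Finite.of_surjective f hf
  haveI : Nonempty B := ⟨f (Classical.arbitrary I)⟩
  ⟨B, (ImageKind.exists_surj I.str f hf).choose⟩

def toImage (I : Obj S) {B : Type} (f : I → B) (hf : f.Surjective) : Surj I (imageObj I f hf) :=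
  ⟨f, (ImageKind.exists_surj I.str f hf).choose_spec⟩

/-- The second factor of a factorization. -/
def Surj.factor {I K L : Obj S} (h : Surj I K) (f : Surj I L) (π : K → L)
    (hπ : ∀ x, π (h x) = f x) : Surj K L :=
  ⟨π, ImageKind.surj_of_comp h.surj
    (by rw [show π ∘ h.toFun = f.toFun from funext hπ]; exact f.surj)⟩

end image

/-- Two embedded objects with the same image are isomorphic. -/
theorem exists_iso_of_range {I X Y : Obj S} (a : X → I) (b : Y → I) (ha : Kind.emb X.str I.str a)
    (hb : Kind.emb Y.str I.str b) (hai : a.Injective) (hbi : b.Injective)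
    (h : Set.range a = Set.range b) : ∃ e : OIso X Y, ∀ x, b (e x) = a x := by
  let e : X ≃ Y := (Equiv.ofInjective a hai).trans ((Equiv.setCongr h).trans
    (Equiv.ofInjective b hbi).symm)
  have he : ∀ x, b (e x) = a x := fun x => by
    have := Equiv.apply_ofInjective_symm hbi (Equiv.setCongr h (Equiv.ofInjective a hai x))
    exact this
  exact ⟨⟨e, Kind.emb_cancel hb (by rw [show b ∘ e = a from funext he]; exact ha)⟩, he⟩

theorem fibVal_emb {I K : Obj S} (f : Surj I K) (i : K) :
    Kind.emb (fib f i).str I.str fibVal := Kind.emb_val _ _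

theorem fibVal_injective {I K : Obj S} (f : Surj I K) (i : K) :
    Function.Injective (fibVal : fib f i → I) := fun _ _ => fib_ext

/-- A point of a fibre. -/
def fibOf {I K : Obj S} (f : Surj I K) {i : K} (x : I) (h : f x = i) : fib f i := ⟨x, h⟩

theorem mem_range_fibVal {I K : Obj S} (f : Surj I K) (i : K) (x : I) :
    x ∈ Set.range (fibVal : fib f i → I) ↔ f x = i :=
  ⟨by rintro ⟨y, rfl⟩; exact fibVal_prop y, fun h => ⟨⟨x, h⟩, rfl⟩⟩

end

/-! ### Generators of a composition and their gluing. -/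

section

variable {S : Type → Type} [Kind S] {k : Type u} [Field k]

/-- The data `q ⊗_g (r_i)` of a generator of `(Q ∘ R)(J)`. -/
structure Generator (Q R : Coll k S) (J : Obj S) where
  K : Obj S
  g : Surj J K
  q : Q.ev K
  r : ∀ i : K, R.ev (fib g i)

namespace Generator

variable {Q R : Coll k S}

/-- The pullback along an isomorphism. -/
def pull {J J' : Obj S} (ζ : OIso J J') (X : Generator Q R J') : Generator Q R J where
  K := X.K
  g := X.g.pre ζ
  q := X.q
  r i := act R (preIso ζ X.g i) (X.r i)

/-- Two generators correspond to each other under an isomorphism. -/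
def Related {J J' : Obj S} (ζ : OIso J J') (X : Generator Q R J) (X' : Generator Q R J') : Prop :=
  ∃ κ : OIso X.K X'.K, (∀ a, κ (X.g a) = X'.g (ζ a)) ∧ act Q κ X'.q = X.q ∧
    ∀ i (η : OIso (fib X.g i) (fib X'.g (κ i))), (∀ a, fibVal (η a) = ζ (fibVal a)) →
      act R η (X'.r (κ i)) = X.r i

theorem related_pull {J J' : Obj S} (ζ : OIso J J') (X : Generator Q R J') :
    Related ζ (X.pull ζ) X :=
  ⟨OIso.refl _, fun _ => rfl, act_refl _ _, fun _ _ hη => act_congr _ (fun x => fib_ext (hη x)) _⟩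

theorem related_refl {J : Obj S} (ζ : OIso J J) (hζ : ∀ x, ζ x = x) (X : Generator Q R J) :
    Related ζ X X :=
  ⟨OIso.refl _, fun a => congrArg X.g (hζ a).symm, act_refl _ _,
    fun _ _ hη => act_eq_self _ _ (fun x => fib_ext ((hη x).trans (hζ _))) _⟩

/-- The element of the composition. -/
def toTens [CompModel k S] {J : Obj S} (X : Generator Q R J) : (comp Q R).ev J := tens X.g X.q X.r

theorem act_toTens [CompModel k S] {J J' : Obj S} (ζ : OIso J J') (X : Generator Q R J') :
    act (comp Q R) ζ X.toTens = (X.pull ζ).toTens := act_tens _ _ _ _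

/-- The quotient map by the span kills all generators, so it vanishes by the uniqueness part of the
universal property. -/
theorem span_toTens [CompModel k S] (Q R : Coll k S) (J : Obj S) :
    Submodule.span k (Set.range (toTens : Generator Q R J → (comp Q R).ev J)) = ⊤ := by
  rw [← (Submodule.span k _).ker_mkQ, LinearMap.ker_eq_top]
  refine comp_ext fun {K} g q r => ?_
  rw [LinearMap.zero_apply, Submodule.mkQ_apply, Submodule.Quotient.mk_eq_zero]
  exact Submodule.subset_span ⟨⟨K, g, q, r⟩, rfl⟩

variable {I L M : Obj S}

/-- The generator `X` is given, up to isomorphism, by the restriction of `h` to a fibre of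
`π ∘ h`, with the decorations `q` and `r`. -/
def Local {f : Surj I L} {l : L} (X : Generator Q R (fib f l)) (h : Surj I M) (π : Surj M L)
    (q : Q.ev (fib π l)) (r : ∀ m : fib π l, R.ev (fib h (fibVal m))) : Prop :=
  ∃ e : OIso (fib π l) X.K,
    (∀ (a : fib f l) (y : fib π l), fibVal y = h (fibVal a) → e y = X.g a) ∧ act Q e X.q = q ∧
    ∀ m, ∃ η : OIso (fib h (fibVal m)) (fib X.g (e m)),
      (∀ a, fibVal (fibVal (η a)) = fibVal a) ∧ act R η (X.r (e m)) = r m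

/-- The generators `X_l` on the fibres of `f` glue to a chain of surjections with decorations. -/
structure Glues (f : Surj I L) (X : ∀ l, Generator Q R (fib f l)) (h : Surj I M) (π : Surj M L)
    (q : ∀ l, Q.ev (fib π l)) (r : ∀ m, R.ev (fib h m)) : Prop where
  comp_apply : ∀ a, π (h a) = f a
  loc : ∀ l, (X l).Local h π (q l) (fun m => r (fibVal m))

/-- On a fibre of `f`, the kernel of the glued surjection is dictated by the generator. This is what
makes the glued middle set unique up to isomorphism. -/
theorem Local.kernel {f : Surj I L} {l : L} {X : Generator Q R (fib f l)} {h : Surj I M}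
    {π : Surj M L} {q : Q.ev (fib π l)} {r : ∀ m : fib π l, R.ev (fib h (fibVal m))}
    (H : X.Local h π q r) (hc : ∀ a, π (h a) = f a) (a b : fib f l) :
    h (fibVal a) = h (fibVal b) ↔ X.g a = X.g b := by
  obtain ⟨e, he, -, -⟩ := H
  have hy : ∀ a : fib f l, e (fibOf π (h (fibVal a)) ((hc _).trans (fibVal_prop a))) = X.g a :=
    fun a => he a _ rfl
  rw [← hy a, ← hy b, e.injective.eq_iff]
  exact ⟨fun h => fib_ext h, fun h => congrArg fibVal h⟩

/-- Equality of kernels identifies the fibre of `π` with the middle set of `X`, and the fibres of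
`h` with those of `X.g`; the decorations are transported along these isomorphisms. -/
theorem exists_local [ImageKind S] {f : Surj I L} {l : L} (X : Generator Q R (fib f l))
    (h : Surj I M) (π : Surj M L) (hc : ∀ a, π (h a) = f a)
    (hk : ∀ a b : fib f l, h (fibVal a) = h (fibVal b) ↔ X.g a = X.g b) :
    ∃ q r, X.Local h π q r := by
  obtain rfl : h.comp π = f := Surj.ext' hc
  obtain ⟨e, he⟩ := exists_imageIso (h.res π l) X.g
    fun x y => Iff.trans ⟨fun h => congrArg fibVal h, fun h => fib_ext h⟩ (hk x y)
  have hη : ∀ m, ∃ η : OIso (fib h (fibVal m)) (fib X.g (e m)),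
      ∀ a, fibVal (fibVal (η a)) = fibVal a := fun m => by
    refine exists_iso_of_range fibVal (fun a => fibVal (fibVal a)) (fibVal_emb _ _)
      (Kind.emb_comp (fibVal_emb _ _) (fibVal_emb _ _)) (fibVal_injective _ _)
      ((fibVal_injective _ _).comp (fibVal_injective _ _)) ?_
    ext x
    rw [mem_range_fibVal]
    constructor
    · intro hx
      refine ⟨fibOf _ (fibOf (h.comp π) x ((congrArg π hx).trans (fibVal_prop m))) ?_, rfl⟩
      rw [← he]
      exact congrArg e (fib_ext hx)
    · rintro ⟨y, rfl⟩
      have := fibVal_prop y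
      rw [← he] at this
      exact congrArg fibVal (e.injective this)
  choose η hη using hη
  exact ⟨act Q e X.q, fun m => act R (η m) (X.r (e m)), e,
    fun a y hy => (congrArg e (fib_ext hy)).trans (he a), rfl, fun m => ⟨η m, hη m, rfl⟩⟩

/-- The middle set is the disjoint union of the middle sets of the generators, with the structure
induced from `I`. The projection to `L` is then admissible because its composite with `h` is `f`. -/
theorem exists_glues [ImageKind S] (f : Surj I L) (X : ∀ l, Generator Q R (fib f l)) :
    ∃ (M : Obj S) (h : Surj I M) (π : Surj M L) (q : _) (r : _), Glues f X h π q r := by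
  let φ : I → Σ l, (X l).K := fun a => ⟨f a, (X (f a)).g (fibMk f a)⟩
  have hφ : ∀ l (a : fib f l), φ (fibVal a) = ⟨l, (X l).g a⟩ := by
    rintro l ⟨a, rfl⟩; rfl
  have hs : φ.Surjective := by
    rintro ⟨l, i⟩
    obtain ⟨a, rfl⟩ := Kind.surjective (X l).g.surj i
    exact ⟨fibVal a, hφ l a⟩
  let h := toImage I φ hs
  let π : Surj (imageObj I φ hs) L := h.factor f Sigma.fst fun _ => rfl
  have hloc : ∀ l, ∃ q r, (X l).Local h π q r := fun l => by
    refine exists_local (X l) h π (fun _ => rfl) fun a b => ?_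
    show φ _ = φ _ ↔ _
    rw [hφ, hφ]
    simp
  choose q r hloc using hloc
  -- The decorations `r l` are indexed by points of the fibre over `l`; a point `m` of the middle
  -- set is viewed in the fibre over its own image `π m`.
  refine ⟨_, h, π, q, fun m => r (π m) (fibMk π m), fun _ => rfl, fun l => ?_⟩
  have : r l = fun m => r (π (fibVal m)) (fibMk π (fibVal m)) := by
    funext m
    obtain ⟨m, rfl⟩ := m
    rfl
  rw [← this]
  exact hloc l

/-- Two gluings of corresponding families of generators have surjections from `I` with the same
kernel. Their middle sets are therefore isomorphic, and the decorations match under this isomorphism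
since each is pulled back from the generators. This gives independence of the chosen gluing and
invariance under isomorphisms of `L`. -/
theorem Glues.unique [ImageKind S] [CompModel k S] {P : Coll k S} {L' M' : Obj S} {f : Surj I L}
    {X : ∀ l, Generator Q R (fib f l)} {h : Surj I M} {π : Surj M L} {q : ∀ l, Q.ev (fib π l)}
    {r : ∀ m, R.ev (fib h m)} {f' : Surj I L'} {X' : ∀ l, Generator Q R (fib f' l)}
    {h' : Surj I M'} {π' : Surj M' L'} {q' : ∀ l, Q.ev (fib π' l)} {r' : ∀ m, R.ev (fib h' m)}
    (H : Glues f X h π q r) (H' : Glues f' X' h' π' q' r') (ε : OIso L L')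
    (hε : ∀ x, ε (f x) = f' x)
    (hX : ∀ l (ζ : OIso (fib f l) (fib f' (ε l))), (∀ a, fibVal (ζ a) = fibVal a) →
      Related ζ (X l) (X' (ε l))) (p : P.ev L') :
    tens h' (tens π' p q') r' = tens h (tens π (act P ε p) q) r := by
  have hXl : ∀ l, Related (postIso f f' ε hε l) (X l) (X' (ε l)) := fun l => hX l _ fun _ => rfl
  -- Either equality forces `x` and `y` into a common fibre of `f`, where `Local.kernel` applies to
  -- both gluings.
  have hker : ∀ x y, h x = h y ↔ h' x = h' y := fun x y => by
    have hf : f y = f x ↔ f' y = f' x := by rw [← hε, ← hε, ε.injective.eq_iff]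
    have key : ∀ (l : L) (a b : fib f l), h (fibVal a) = h (fibVal b) ↔
        h' (fibVal a) = h' (fibVal b) := fun l a b => by
      obtain ⟨κ, hκ, -⟩ := hXl l
      rw [(H.loc l).kernel H.comp_apply, ← κ.injective.eq_iff, hκ, hκ,
        ← (H'.loc (ε l)).kernel H'.comp_apply]
      rfl
    constructor
    · intro hxy
      have e : f y = f x := by rw [← H.comp_apply, ← H.comp_apply, hxy]
      exact (key (f x) (fibMk f x) (fibOf f y e)).1 hxy
    · intro hxy
      have e : f y = f x := hf.2 (by rw [← H'.comp_apply, ← H'.comp_apply, hxy])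
      exact (key (f x) (fibMk f x) (fibOf f y e)).2 hxy
  obtain ⟨E, hE⟩ := exists_imageIso h h' hker
  have hπ : ∀ m, ε (π m) = π' (E m) := fun m => by
    obtain ⟨x, rfl⟩ := Kind.surjective h.surj m
    rw [H.comp_apply, hε, hE, H'.comp_apply]
  -- The outer tensors are compared along `E`, the inner ones along `ε`; what remains is to match
  -- the decorations, each through its generator.
  refine tens_congr E hE ?_ fun i η hη => ?_
  · rw [act_tens]
    refine tens_congr ε hπ rfl fun l η hη => ?_
    obtain ⟨e, he, hq, -⟩ := H.loc l
    obtain ⟨e', he', hq', -⟩ := H'.loc (ε l)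
    obtain ⟨κ, hκ, hκq, -⟩ := hXl l
    rw [act_act, ← hq, ← hq', ← hκq, act_act, act_act]
    refine act_congr _ (fun y => ?_) _
    obtain ⟨x, hx⟩ := Kind.surjective h.surj (fibVal y)
    have hfx : f x = l := by rw [← H.comp_apply, hx, fibVal_prop]
    let a : fib f l := fibOf f x hfx
    refine (he' (postIso f f' ε hε l a) _ ?_).trans ?_
    · refine (congrArg E (hη y)).trans ?_
      rw [← hx, hE]
      rfl
    · rw [← hκ a]
      exact congrArg κ (he a y hx.symm).symm
  · obtain ⟨e, he, -, hr⟩ := H.loc (π i)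
    obtain ⟨e', he', -, hr'⟩ := H'.loc (ε (π i))
    obtain ⟨κ, hκ, -, hκr⟩ := hXl (π i)
    obtain ⟨η₁, hη₁, h₁⟩ := hr (fibMk π i)
    obtain ⟨η₂, hη₂, h₂⟩ := hr' (fibOf π' (E i) (hπ i).symm)
    obtain ⟨x, hx⟩ := Kind.surjective h.surj i
    let a : fib f (π i) := fibOf f x (by rw [← H.comp_apply, hx])
    -- A point `x` over `i` locates `i` inside the middle sets of both generators, so the two
    -- positions correspond under `κ`.
    have hea : e (fibMk π i) = (X (π i)).g a := he a _ hx.symm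
    have hea' : e' (fibOf π' (E i) (hπ i).symm) = κ (e (fibMk π i)) := by
      rw [hea, hκ]
      refine he' _ _ ?_
      show E i = h' x
      rw [← hE, hx]
    change _ = r i at h₁
    change _ = r' (E i) at h₂
    let θ : OIso (fib (X (π i)).g (e (fibMk π i))) (fib (X' (ε (π i))).g (κ (e (fibMk π i)))) :=
      fibIso (postIso f f' ε hε (π i)) _ _ _ _ fun z => by
        rw [← hκ, κ.injective.eq_iff]
    rw [← h₁, ← hκr _ θ fun _ => rfl, act_act]
    refine (congrArg (act R η) h₂).symm.trans ((act_act _ _ _ _).trans ?_)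
    refine act_dep _ hea' _ _ fun z => fib_ext ?_
    exact (hη₂ _).trans ((hη z).trans (hη₁ z).symm)

section update

-- The shape `h`, `π` of a gluing and the isomorphism `e` do not involve the decoration `w`. So `w`
-- enters the glued data in one coordinate only, and linearly.
open Classical in
theorem Glues.update_q {f : Surj I L} {X : ∀ l, Generator Q R (fib f l)} {l₀ : L} {K : Obj S}
    {g : Surj (fib f l₀) K} {v : Q.ev K} {s : ∀ i : K, R.ev (fib g i)} {h : Surj I M}
    {π : Surj M L} {q : ∀ l, Q.ev (fib π l)} {r : ∀ m, R.ev (fib h m)}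
    (H : Glues f (Function.update X l₀ ⟨K, g, v, s⟩) h π q r) :
    ∃ e : OIso (fib π l₀) K, ∀ w, Glues f (Function.update X l₀ ⟨K, g, w, s⟩) h π
      (Function.update q l₀ (act Q e w)) r := by
  have H₀ := H.loc l₀
  rw [Function.update_self] at H₀
  obtain ⟨e, he, -, hr⟩ := H₀
  refine ⟨e, fun w => ⟨H.comp_apply, fun l => ?_⟩⟩
  by_cases hl : l = l₀
  · subst hl
    rw [Function.update_self, Function.update_self]
    exact ⟨e, he, rfl, hr⟩
  · have := H.loc l
    rw [Function.update_of_ne hl] at this ⊢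
    rwa [Function.update_of_ne hl]

-- The counterpart for the decorations on the first surjection: the point `m` and the isomorphism
-- `η` do not depend on `w`.
open Classical in
theorem Glues.update_r {f : Surj I L} {X : ∀ l, Generator Q R (fib f l)} {l₀ : L} {K : Obj S}
    {g : Surj (fib f l₀) K} {v : Q.ev K} {s : ∀ i : K, R.ev (fib g i)} {h : Surj I M}
    {π : Surj M L} {q : ∀ l, Q.ev (fib π l)} {r : ∀ m, R.ev (fib h m)}
    (H : Glues f (Function.update X l₀ ⟨K, g, v, s⟩) h π q r) (i : K) :
    ∃ (m : M) (η : OIso (fib h m) (fib g i)), ∀ w,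
      Glues f (Function.update X l₀ ⟨K, g, v, Function.update s i w⟩) h π q
        (Function.update r m (act R η w)) := by
  have H₀ := H.loc l₀
  rw [Function.update_self] at H₀
  obtain ⟨e, he, hq, hr⟩ := H₀
  obtain ⟨y₀, rfl⟩ := e.toEquiv.surjective i
  obtain ⟨η, hη, -⟩ := hr y₀
  refine ⟨fibVal y₀, η, fun w => ⟨H.comp_apply, fun l => ?_⟩⟩
  by_cases hl : l = l₀
  · subst hl
    rw [Function.update_self]
    refine ⟨e, he, hq, fun y => ?_⟩
    by_cases hy : y = y₀
    · subst hy
      refine ⟨η, hη, Eq.trans ?_ (Function.update_self (fibVal y) (act R η w) r).symm⟩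
      exact congrArg (act R η) (Function.update_self (e y) w s)
    · obtain ⟨η', hη', h'⟩ := hr y
      refine ⟨η', hη', Eq.trans ?_
        (h'.trans (Function.update_of_ne (fun h => hy (fib_ext h)) _ _).symm)⟩
      exact congrArg (act R η') (Function.update_of_ne (fun h => hy (e.injective h)) _ _)
  · have := H.loc l
    rw [Function.update_of_ne hl] at this ⊢
    -- The modified coordinate lies over `l₀`, so the data over any other `l` are untouched.
    have hne : ∀ m : fib π l, fibVal m ≠ fibVal y₀ := fun m hm =>
      hl ((fibVal_prop m).symm.trans ((congrArg π hm).trans (fibVal_prop y₀)))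
    simpa only [Function.update_of_ne (hne _)] using this

end update

end Generator

theorem multilinear_ext [CompModel k S] {Q R : Coll k S} {I L : Obj S} {f : Surj I L} {N : Type*} [AddCommGroup N] [Module k N]
    {φ ψ : MultilinearMap k (fun l : L => (comp Q R).ev (fib f l)) N}
    (h : ∀ X : ∀ l, Generator Q R (fib f l),
      φ (fun l => (X l).toTens) = ψ (fun l => (X l).toTens)) : φ = ψ :=
  MultilinearMap.ext_of_span_eq_top (R := k) (ι := L)
    (M := fun l : L => (comp Q R).ev (fib f l)) (γ := fun l => Generator Q R (fib f l))
    (g := fun l X => Generator.toTens (J := fib f l) X) (fun _ => Generator.span_toTens _ _ _) h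

/-! ### The inverse of the associator. -/

section assoc

variable [CompModel k S] [ImageKind S] {P Q R : Coll k S} {I L : Obj S}

open Generator

/-- The value of the inverse of the associator on generators. -/
def glued (f : Surj I L) (p : P.ev L) (X : ∀ l, Generator Q R (fib f l)) :
    (comp (comp P Q) R).ev I :=
  let H := exists_glues f X
  tens H.choose_spec.choose (tens H.choose_spec.choose_spec.choose p
    H.choose_spec.choose_spec.choose_spec.choose)
    H.choose_spec.choose_spec.choose_spec.choose_spec.choose

/-- This compares the gluing chosen in `glued` with any gluing of a related family; it is the only
place where the choice is opened. -/
theorem glued_eq_of_related {L' M : Obj S} {f : Surj I L} {X : ∀ l, Generator Q R (fib f l)}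
    {h : Surj I M} {π : Surj M L} {q : ∀ l, Q.ev (fib π l)} {r : ∀ m, R.ev (fib h m)}
    (H : Glues f X h π q r) {f' : Surj I L'} {X' : ∀ l, Generator Q R (fib f' l)} (ε : OIso L L')
    (hε : ∀ x, ε (f x) = f' x)
    (hX : ∀ l (ζ : OIso (fib f l) (fib f' (ε l))), (∀ a, fibVal (ζ a) = fibVal a) →
      Related ζ (X l) (X' (ε l))) (p : P.ev L') :
    glued f' p X' = tens h (tens π (act P ε p) q) r :=
  H.unique (exists_glues f' X').choose_spec.choose_spec.choose_spec.choose_spec.choose_spec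
    ε hε hX p

theorem glued_eq {M : Obj S} {f : Surj I L} {X : ∀ l, Generator Q R (fib f l)}
    {h : Surj I M} {π : Surj M L} {q : ∀ l, Q.ev (fib π l)} {r : ∀ m, R.ev (fib h m)}
    (H : Glues f X h π q r) (p : P.ev L) : glued f p X = tens h (tens π p q) r := by
  rw [glued_eq_of_related H (OIso.refl L) (fun _ => rfl)
    (fun l ζ hζ => related_refl ζ (fun x => fib_ext (hζ x)) _), act_refl]

/-- This yields the invariance conditions of both `gluedFam` and `assocInvFam`. -/
theorem glued_congr {L' : Obj S} {f : Surj I L} {X : ∀ l, Generator Q R (fib f l)}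
    {f' : Surj I L'} {X' : ∀ l, Generator Q R (fib f' l)} (ε : OIso L L')
    (hε : ∀ x, ε (f x) = f' x)
    (hX : ∀ l (ζ : OIso (fib f l) (fib f' (ε l))), (∀ a, fibVal (ζ a) = fibVal a) →
      Related ζ (X l) (X' (ε l))) (p : P.ev L') :
    glued f' p X' = glued f (act P ε p) X := by
  obtain ⟨M, h, π, q, r, H⟩ := exists_glues f X
  rw [glued_eq H, glued_eq_of_related H ε hε hX]

open Classical in
/-- The dependence of `glued` on one of the generators. -/
def gluedFam (f : Surj I L) (p : P.ev L) (X : ∀ l, Generator Q R (fib f l)) (l₀ : L) :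
    Fam Q R (fib f l₀) ((comp (comp P Q) R).ev I) where
  toFun {K} g :=
    { toFun := fun v => MultilinearMap.mk'
        (fun s => glued f p (Function.update X l₀ ⟨K, g, v, s⟩))
        (fun s i x y => by
          obtain ⟨M, h, π, q, r, H⟩ := exists_glues f (Function.update X l₀ ⟨K, g, v, s⟩)
          obtain ⟨m, η, hη⟩ := H.update_r i
          rw [glued_eq (hη _), glued_eq (hη _), glued_eq (hη _), map_add, tens_update_add])
        (fun s i c x => by
          obtain ⟨M, h, π, q, r, H⟩ := exists_glues f (Function.update X l₀ ⟨K, g, v, s⟩)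
          obtain ⟨m, η, hη⟩ := H.update_r i
          rw [glued_eq (hη _), glued_eq (hη _), map_smul, tens_update_smul])
      map_add' := fun v w => MultilinearMap.ext fun s => by
        obtain ⟨M, h, π, q, r, H⟩ := exists_glues f (Function.update X l₀ ⟨K, g, v, s⟩)
        obtain ⟨e, he⟩ := H.update_q
        show glued f p _ = glued f p _ + glued f p _
        rw [glued_eq (he _), glued_eq (he _), glued_eq (he _), map_add, tens_update_add,
          tens_add_left]
      map_smul' := fun c v => MultilinearMap.ext fun s => by
        obtain ⟨M, h, π, q, r, H⟩ := exists_glues f (Function.update X l₀ ⟨K, g, v, s⟩)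
        obtain ⟨e, he⟩ := H.update_q
        show glued f p _ = c • glued f p _
        rw [glued_eq (he _), glued_eq (he _), map_smul, tens_update_smul, tens_smul_left] }
  rel {K K'} g g' e h v s := by
    show glued f p _ = glued f p _
    rw [glued_congr (OIso.refl L) (fun _ => rfl) (fun l ζ hζ => ?_), act_refl]
    obtain rfl : ζ = OIso.refl _ := OIso.ext' fun x => fib_ext (hζ x)
    by_cases hl : l = l₀
    · subst hl
      show Related _ (Function.update X l _ l) (Function.update X l _ l)
      rw [Function.update_self, Function.update_self]
      exact ⟨e, h, rfl, fun i η hη => act_congr _ (fun x => fib_ext (hη x)) _⟩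
    · show Related _ (Function.update X l₀ _ l) (Function.update X l₀ _ l)
      rw [Function.update_of_ne hl, Function.update_of_ne hl]
      exact related_refl _ (fun _ => rfl) _

/-- Linearity in each single coordinate comes from the universal property of `Q ∘ R`, applied to
`gluedFam`; `exists_multilinear_of_generators` combines the coordinates. -/
theorem exists_gluedMulti (f : Surj I L) (p : P.ev L) :
    ∃ B : MultilinearMap k (fun l : L => (comp Q R).ev (fib f l)) ((comp (comp P Q) R).ev I),
      ∀ X : ∀ l, Generator Q R (fib f l), B (fun l => (X l).toTens) = glued f p X := by
  classical
  refine exists_multilinear_of_generators (fun l => toTens) (fun l => span_toTens _ _ _)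
    (glued f p) fun X l => ⟨compLift (gluedFam f p X l), fun Y => ?_⟩
  rw [toTens, compLift_tens]
  show glued f p _ = _
  congr!

/-- The extension of `glued` to a multilinear map. -/
def gluedMulti (Q R : Coll k S) (f : Surj I L) (p : P.ev L) :
    MultilinearMap k (fun l : L => (comp Q R).ev (fib f l)) ((comp (comp P Q) R).ev I) :=
  (exists_gluedMulti f p).choose

theorem gluedMulti_toTens (f : Surj I L) (p : P.ev L) (X : ∀ l, Generator Q R (fib f l)) :
    gluedMulti Q R f p (fun l => (X l).toTens) = glued f p X :=
  (exists_gluedMulti f p).choose_spec X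

open Classical in
/-- The family defining the inverse of the associator. -/
def assocInvFam (P Q R : Coll k S) (I : Obj S) :
    Fam P (comp Q R) I ((comp (comp P Q) R).ev I) where
  toFun f :=
    { toFun := gluedMulti Q R f
      map_add' := fun p p' => multilinear_ext fun X => by
        obtain ⟨M, h, π, q, r, H⟩ := exists_glues f X
        rw [add_apply, gluedMulti_toTens, gluedMulti_toTens, gluedMulti_toTens,
          glued_eq H, glued_eq H, glued_eq H, tens_add_left, tens_add_left]
      map_smul' := fun c p => multilinear_ext fun X => by
        obtain ⟨M, h, π, q, r, H⟩ := exists_glues f X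
        rw [smul_apply, gluedMulti_toTens, gluedMulti_toTens,
          glued_eq H, glued_eq H, tens_smul_left, tens_smul_left]
        rfl }
  rel {L L'} f f' ε hε p x := by
    have hupd : ∀ (x : ∀ l : L', (comp Q R).ev (fib f' l)) (l₀ : L)
        (v : (comp Q R).ev (fib f' (ε l₀))),
        (fun l => act (comp Q R) (postIso f f' ε hε l) (Function.update x (ε l₀) v (ε l))) =
          Function.update (fun l => act (comp Q R) (postIso f f' ε hε l) (x (ε l))) l₀
            (act (comp Q R) (postIso f f' ε hε l₀) v) := fun x l₀ v => by
      funext l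
      by_cases hl : l = l₀
      · subst hl; rw [Function.update_self, Function.update_self]
      · rw [Function.update_of_ne hl, Function.update_of_ne fun h => hl (ε.injective h)]
    -- The transported side of the relation is itself multilinear in `x`, so both sides need only be
    -- compared on tuples of generators.
    let ψ : MultilinearMap k (fun l : L' => (comp Q R).ev (fib f' l))
        ((comp (comp P Q) R).ev I) := MultilinearMap.mk'
      (fun x => gluedMulti Q R f (act P ε p)
        fun l => act (comp Q R) (postIso f f' ε hε l) (x (ε l)))
      (fun x l v w => by
        obtain ⟨l, rfl⟩ := ε.toEquiv.surjective l
        erw [hupd, hupd, hupd, map_add, MultilinearMap.map_update_add])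
      (fun x l c v => by
        obtain ⟨l, rfl⟩ := ε.toEquiv.surjective l
        erw [hupd, hupd, map_smul, MultilinearMap.map_update_smul])
    have : gluedMulti Q R f' p = ψ := multilinear_ext fun X => by
      rw [gluedMulti_toTens]
      show _ = gluedMulti Q R f (act P ε p)
        fun l => act (comp Q R) (postIso f f' ε hε l) (X (ε l)).toTens
      simp_rw [act_toTens]
      rw [gluedMulti_toTens]
      refine glued_congr ε hε (fun l ζ hζ => ?_) p
      obtain rfl : ζ = postIso f f' ε hε l := OIso.ext' fun a => fib_ext (hζ a)
      exact related_pull _ _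
    exact congrArg (fun t => t x) this

/-- The components of the inverse of the associator. -/
def assocInv (P Q R : Coll k S) (I : Obj S) :
    (comp P (comp Q R)).ev I →ₗ[k] (comp (comp P Q) R).ev I := compLift (assocInvFam P Q R I)

theorem assocInv_tens (f : Surj I L) (p : P.ev L) (X : ∀ l, Generator Q R (fib f l)) :
    assocInv P Q R I (tens f p fun l => (X l).toTens) = glued f p X :=
  (compLift_tens _ _ _ _).trans (gluedMulti_toTens f p X)

/-- In one direction, the generators produced by the associator are glued by the original chain `f`,
`g`. In the other, restricting a gluing to the fibres of `f` returns the generators, by `Glues.loc`.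
-/
instance : AssocBijective k S where
  bijective P Q R I := by
    have h1 : assocInv P Q R I ∘ₗ app (assocHom P Q R) I = LinearMap.id :=
      nested_ext fun {K L} f g p q r => by
        rw [LinearMap.comp_apply, assocHom_tens, LinearMap.id_apply]
        refine (assocInv_tens (f.comp g) p fun l => ⟨_, f.res g l, q l, _⟩).trans (glued_eq ?_ p)
        refine ⟨fun _ => rfl, fun l => ⟨OIso.refl _, fun a y hy => fib_ext hy, act_refl _ _,
          fun m => ⟨(resIso f g l m).symm, fun _ => rfl, ?_⟩⟩⟩
        exact (act_act _ _ _ _).trans (act_eq_self _ _ (fun _ => OIso.apply_symm _ _) _)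
    have h2 : app (assocHom P Q R) I ∘ₗ assocInv P Q R I = LinearMap.id :=
      comp_ext fun {L} f p x => by
        have : (app (assocHom P Q R) I ∘ₗ assocInv P Q R I).compMultilinearMap
            (tensRight (comp Q R) f p) = tensRight (comp Q R) f p := multilinear_ext fun X => by
          show app (assocHom P Q R) I (assocInv P Q R I (tens f p fun l => (X l).toTens)) =
            tens f p fun l => (X l).toTens
          obtain ⟨M, h, π, q, r, H⟩ := exists_glues f X
          rw [assocInv_tens, glued_eq H, assocHom_tens]
          refine (tens_congr' (fun x => (H.comp_apply x)) rfl fun l η hη => ?_).symm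
          obtain ⟨e, he, hq, hr⟩ := H.loc l
          rw [toTens, act_tens]
          refine tens_congr e (fun x => ?_) hq fun m θ hθ => ?_
          · exact he (η x) _ (congrArg h (hη x).symm)
          · obtain ⟨η', hη', h'⟩ := hr m
            refine (act_act _ _ _ _).trans (Eq.trans ?_ (congrArg (act R _) h'))
            rw [act_act]
            refine act_congr _ (fun x => fib_ext (fib_ext ?_)) _
            exact ((hη _).trans (congrArg fibVal (hθ x))).trans (hη' (resIso h π l m x)).symm
        exact congrArg (fun t => t x) this
    exact ⟨Function.LeftInverse.injective fun x => congrArg (fun t => t x) h1,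
      Function.RightInverse.surjective fun x => congrArg (fun t => t x) h2⟩

end assoc

end

/-! ### The forgetful functor is strong monoidal. -/

section

variable {k : Type u} [Field k]

section monoidal

open MonoidalCategory

variable {S : Type → Type} [Kind S] [CompModel k S] [AssocBijective k S]

/-- The composition takes precedence over the pointwise tensor product. -/
instance : MonoidalCategoryStruct (Coll k S) :=
  MonoidalCategory.toMonoidalCategoryStruct (C := Coll k S)

theorem associator_hom (P Q R : Coll k S) : (α_ P Q R).hom = assocHom P Q R := isoMake_hom _ _

theorem leftUnitor_hom (P : Coll k S) : (λ_ P).hom = leftHom P := isoMake_hom _ _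

theorem rightUnitor_hom (P : Coll k S) : (ρ_ P).hom = rightHom P := isoMake_hom _ _

end monoidal

/-- The linear structure underlying an isomorphism of ordered sets is forgotten. -/
def OIso.forget {I J : OrdSet} (e : OIso I J) : OIso (forgetOrd.obj I) (forgetOrd.obj J) :=
  ⟨e.toEquiv, trivial⟩

/-- A morphism to the restriction of a symmetric collection, from its components. -/
def toForget {A : NSColl k} {X : SymColl k} (φ : ∀ I, A.ev I →ₗ[k] X.ev (forgetOrd.obj I))
    (h : ∀ {I J : OrdSet} (e : OIso I J) x, φ I (act A e x) = act X e.forget (φ J x)) :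
    A ⟶ (forgetColl k).obj X := homMake φ h

theorem toForget_square {A A' B B' : NSColl k} {X Z : SymColl k}
    {φ : ∀ I, A'.ev I →ₗ[k] X.ev (forgetOrd.obj I)}
    {hφ : ∀ {I J : OrdSet} (e : OIso I J) x, φ I (act A' e x) = act X e.forget (φ J x)}
    {ψ : ∀ I, B'.ev I →ₗ[k] Z.ev (forgetOrd.obj I)}
    {hψ : ∀ {I J : OrdSet} (e : OIso I J) x, ψ I (act B' e x) = act Z e.forget (ψ J x)}
    {a : A ⟶ A'} {θ : X ⟶ Z} {b : A ⟶ B} {c : B ⟶ B'}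
    (h : ∀ I, app θ (forgetOrd.obj I) ∘ₗ φ I ∘ₗ app a I = ψ I ∘ₗ app c I ∘ₗ app b I) :
    a ≫ toForget φ hφ ≫ (forgetColl k).map θ = b ≫ c ≫ toForget ψ hψ :=
  coll_hom_ext h

/-- The ordered set with a given underlying set which makes a given surjection shuffling. -/
def orderedImage (I : OrdSet) {K : FinSet} (f : Surj (forgetOrd.obj I) K) : OrdSet :=
  imageObj I f.toFun f.surj

/-- A surjection, as a shuffling surjection. -/
def toOrdered (I : OrdSet) {K : FinSet} (f : Surj (forgetOrd.obj I) K) :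
    Surj I (orderedImage I f) := toImage I f.toFun f.surj

/-- The family `p ⊗_f (q_i) ↦ p ⊗_{f^f} (q_i)`. -/
def forgetFam (P Q : SymColl k) (I : OrdSet) :
    Fam ((forgetColl k).obj P) ((forgetColl k).obj Q) I ((comp P Q).ev (forgetOrd.obj I)) where
  toFun f := (CompModel.gen P Q (forgetOrd.obj I)).toFun f.forget
  rel f f' e h p q := (CompModel.gen P Q (forgetOrd.obj I)).rel f.forget f'.forget e.forget h p q

/-- The family `p ⊗_f (q_i) ↦ p ⊗_{f'} (q_i)`, with `f'` the shuffling surjection given by `f`. -/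
def orderFam (P Q : SymColl k) (I : OrdSet) : Fam P Q (forgetOrd.obj I)
    ((comp ((forgetColl k).obj P) ((forgetColl k).obj Q)).ev I) where
  toFun f := (CompModel.gen ((forgetColl k).obj P) ((forgetColl k).obj Q) I).toFun (toOrdered I f)
  rel f f' e h p q :=
    (CompModel.gen ((forgetColl k).obj P) ((forgetColl k).obj Q) I).rel (toOrdered I f)
      (toOrdered I f') (imageIso (toOrdered I f) (toOrdered I f') e.toEquiv h) h p q

/-- The components of the comparison of the two compositions. -/
def forgetMuApp (P Q : SymColl k) (I : OrdSet) :
    (comp ((forgetColl k).obj P) ((forgetColl k).obj Q)).ev I →ₗ[k]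
      (comp P Q).ev (forgetOrd.obj I) := compLift (forgetFam P Q I)

theorem forgetMuApp_tens {P Q : SymColl k} {I K : OrdSet} (f : Surj I K)
    (p : ((forgetColl k).obj P).ev K) (q : ∀ i : K, ((forgetColl k).obj Q).ev (fib f i)) :
    forgetMuApp P Q I (tens f p q) = tens (P := P) (Q := Q) f.forget p q :=
  compLift_tens (forgetFam P Q I) f p q

theorem forgetMuApp_act (P Q : SymColl k) {I J : OrdSet} (ε : OIso I J)
    (x : (comp ((forgetColl k).obj P) ((forgetColl k).obj Q)).ev J) :
    forgetMuApp P Q I (act _ ε x) = act (comp P Q) ε.forget (forgetMuApp P Q J x) := by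
  have : forgetMuApp P Q I ∘ₗ act (comp _ _) ε =
      act (comp P Q) ε.forget ∘ₗ forgetMuApp P Q J := comp_ext fun {K} f p q => by
    rw [LinearMap.comp_apply, LinearMap.comp_apply, act_tens, forgetMuApp_tens,
      forgetMuApp_tens]
    exact (act_tens ε.forget f.forget p q).symm
  exact congrArg (fun t => t x) this

/-- The comparison of the shuffle composition with the symmetric composition. -/
def forgetMu (P Q : SymColl k) :
    comp ((forgetColl k).obj P) ((forgetColl k).obj Q) ⟶ (forgetColl k).obj (comp P Q) :=
  toForget (fun I => forgetMuApp P Q I) (forgetMuApp_act P Q)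

theorem forgetMu_tens {P Q : SymColl k} {I K : OrdSet} (f : Surj I K)
    (p : ((forgetColl k).obj P).ev K) (q : ∀ i : K, ((forgetColl k).obj Q).ev (fib f i)) :
    app (forgetMu P Q) I (tens f p q) = tens (P := P) (Q := Q) f.forget p q :=
  forgetMuApp_tens f p q

/-- The inverse equips the target of each surjection with the order by least elements of fibres. If
the surjection was already shuffling, uniqueness of that order makes the identity an isomorphism
between the old and the new target. -/
theorem forgetMu_bijective (P Q : SymColl k) (I : OrdSet) :
    Function.Bijective (app (forgetMu P Q) I) := by
  let inv : (comp P Q).ev (forgetOrd.obj I) →ₗ[k] _ := compLift (orderFam P Q I)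
  have hinv : ∀ {K : FinSet} (f : Surj (forgetOrd.obj I) K) (p : P.ev K)
      (q : ∀ i : K, Q.ev (fib f i)), inv (tens f p q) =
        tens (P := (forgetColl k).obj P) (Q := (forgetColl k).obj Q) (toOrdered I f) p q :=
    fun f p q => compLift_tens (orderFam P Q I) f p q
  have h1 : (show (comp ((forgetColl k).obj P) ((forgetColl k).obj Q)).ev I →ₗ[k] _ from
      inv ∘ₗ app (forgetMu P Q) I) = LinearMap.id := comp_ext fun {K} f p q => by
    refine (congrArg inv (forgetMu_tens f p q)).trans ((hinv f.forget p q).trans ?_)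
    -- The given order on `K` and the induced one both make `f` shuffling, hence the identity map is
    -- an isomorphism between them.
    refine tens_congr (imageIso f (toOrdered I f.forget) (Equiv.refl _) fun _ => rfl)
      (fun _ => rfl) (act_eq_self P _ (fun _ => rfl) p) fun i η hη => ?_
    exact act_eq_self Q (OIso.forget η) (fun x => fib_ext (hη x)) (q i)
  have h2 : ∀ x, app (forgetMu P Q) I (inv x) = x := fun x => by
    have : (show (comp P Q).ev (forgetOrd.obj I) →ₗ[k] (comp P Q).ev (forgetOrd.obj I) from
        app (forgetMu P Q) I ∘ₗ inv) = LinearMap.id := comp_ext fun {K} f p q => by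
      show app (forgetMu P Q) I (inv (tens f p q)) = _
      rw [hinv]
      exact forgetMu_tens (toOrdered I f) p q
    exact congrArg (fun t => t x) this
  exact ⟨Function.LeftInverse.injective (g := inv) fun x => congrArg (fun t => t x) h1,
    Function.RightInverse.surjective h2⟩

/-- The comparison of the units. -/
def forgetEps (k : Type u) [Field k] :
    unit k LinearOrder ⟶ (forgetColl k).obj (unit k NoStr) :=
  homMake (fun I => (LinearMap.id : (unit k LinearOrder).ev I →ₗ[k] (unit k LinearOrder).ev I))
    fun _ _ => rfl

theorem forgetEps_bijective (I : OrdSet) : Function.Bijective (app (forgetEps k) I) :=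
  Function.bijective_id

theorem unitVal_forgetEps (I : OrdSet) (c : (unit k LinearOrder).ev I) :
    unitVal (forgetOrd.obj I) (app (forgetEps k) I c) = unitVal I c := rfl

theorem forgetMu_natural {P Q P' Q' : SymColl k} (θ : P ⟶ P') (φ : Q ⟶ Q') :
    compHom ((forgetColl k).map θ) ((forgetColl k).map φ) ≫ forgetMu P' Q' =
      forgetMu P Q ≫ (forgetColl k).map (compHom θ φ) :=
  comp_hom_ext fun {I K} f p q => by
    rw [app_comp, app_comp, compHom_tens, forgetMu_tens, forgetMu_tens]
    exact (compHom_tens θ φ f.forget p q).symm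

/-- Composites, restrictions to fibres and the isomorphisms between fibres have the same underlying
maps with and without orders, so both routes give the same nested tensor. -/
theorem forgetMu_assoc_tens {P Q R : SymColl k} {I K L : OrdSet} (f : Surj I K) (g : Surj K L)
    (p : ((forgetColl k).obj P).ev L) (q : ∀ l : L, ((forgetColl k).obj Q).ev (fib g l))
    (r : ∀ i : K, ((forgetColl k).obj R).ev (fib f i)) :
    app (assocHom P Q R) (forgetOrd.obj I) (forgetMuApp (comp P Q) R I
      (tens (P := (forgetColl k).obj (comp P Q)) f (forgetMuApp P Q K (tens g p q)) r)) =
      forgetMuApp P (comp Q R) I (tens (Q := (forgetColl k).obj (comp Q R)) (f.comp g) p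
        fun l => forgetMuApp Q R (fib (f.comp g) l) (tens (f.res g l) (q l)
          fun i => act ((forgetColl k).obj R) (resIso f g l i) (r (fibVal i)))) := by
  have e₁ := forgetMuApp_tens g p q
  have e₂ := forgetMuApp_tens (P := comp P Q) f (tens (P := P) (Q := Q) g.forget p q) r
  have e₃ := forgetMuApp_tens (Q := comp Q R) (f.comp g) p
    fun l => forgetMuApp Q R (fib (f.comp g) l) (tens (f.res g l) (q l)
      fun i => act ((forgetColl k).obj R) (resIso f g l i) (r (fibVal i)))
  rw [e₁, e₂, e₃]
  refine (assocHom_tens f.forget g.forget p q r).trans ?_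
  refine tens_congr' (P := P) (Q := comp Q R) (fun _ => rfl) rfl fun l η hη => ?_
  refine (act_eq_self (comp Q R) η (fun x => fib_ext (hη x)) _).trans ?_
  exact (forgetMuApp_tens (f.res g l) (q l) _).symm

theorem forgetMu_assoc (P Q R : SymColl k) :
    compHom (forgetMu P Q) (𝟙 _) ≫ forgetMu (comp P Q) R ≫ (forgetColl k).map (assocHom P Q R) =
      assocHom _ _ _ ≫ compHom (𝟙 _) (forgetMu Q R) ≫ forgetMu P (comp Q R) :=
  toForget_square (hφ := forgetMuApp_act (comp P Q) R) (hψ := forgetMuApp_act P (comp Q R)) fun I => nested_ext fun {K L} f g p q r => by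
    simp only [LinearMap.comp_apply]
    have e₁ := compHom_tens (forgetMu P Q) (𝟙 ((forgetColl k).obj R)) f (tens g p q) r
    have e₂ := assocHom_tens f g p q r
    have e₃ := compHom_tens (𝟙 ((forgetColl k).obj P)) (forgetMu Q R) (f.comp g) p fun l =>
      tens (f.res g l) (q l) fun i => act _ (resIso f g l i) (r (fibVal i))
    rw [e₁, e₂, e₃]
    exact forgetMu_assoc_tens f g p q r

theorem forget_left_unitality (P : SymColl k) :
    compHom (forgetEps k) (𝟙 _) ≫ forgetMu (unit k NoStr) P ≫ (forgetColl k).map (leftHom P) =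
      leftHom _ :=
  comp_hom_ext fun {I K} f c q => by
    show app ((forgetColl k).map (leftHom P)) I (app (forgetMu _ _) I
      (app (compHom (forgetEps k) (𝟙 _)) I _)) = _
    -- Over a larger set the unit collection vanishes and both sides are zero.
    by_cases hK : Subsingleton K
    · rw [compHom_tens, forgetMu_tens,
        leftHom_tens f _ _ (Classical.arbitrary K) fun _ => Subsingleton.elim _ _]
      exact leftHom_tens f.forget _ _ (Classical.arbitrary K) fun _ => hK.elim _ _
    · rw [tens_eq_zero_left f (unit_eq_zero hK _), map_zero, map_zero, map_zero, map_zero]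

theorem forget_right_unitality (P : SymColl k) :
    compHom (𝟙 _) (forgetEps k) ≫ forgetMu P (unit k NoStr) ≫ (forgetColl k).map (rightHom P) =
      rightHom _ :=
  comp_hom_ext fun {I K} f p c => by
    show app ((forgetColl k).map (rightHom P)) I (app (forgetMu _ _) I
      (app (compHom (𝟙 _) (forgetEps k)) I _)) = _
    -- If `f` is not injective, some fibre has more than one element, the unit collection vanishes
    -- there, and both sides are zero.
    by_cases hf : Function.Injective f
    · have := Fintype.ofFinite K
      rw [compHom_tens, forgetMu_tens, rightHom_tens f _ _ hf]
      exact @rightHom_tens _ _ k _ _ P _ _ (show Fintype K from this) f.forget p _ hf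
    · obtain ⟨i, hi⟩ := exists_unit_zero (k := k) f hf
      rw [tens_eq_zero f _ _ i (hi _), map_zero, map_zero, map_zero, map_zero]

instance forgetMonoidal (k : Type u) [Field k] : (forgetColl k).Monoidal :=
  Functor.CoreMonoidal.toMonoidal
    { εIso := isoMake (forgetEps k) forgetEps_bijective
      μIso := fun P Q => isoMake (forgetMu P Q) (forgetMu_bijective P Q)
      μIso_hom_natural_left := fun θ Q => by
        have := forgetMu_natural θ (𝟙 Q)
        rwa [(forgetColl k).map_id] at this
      μIso_hom_natural_right := fun P φ => by
        have := forgetMu_natural (𝟙 P) φ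
        rwa [(forgetColl k).map_id] at this
      associativity := fun P Q R => by
        rw [associator_hom, associator_hom, isoMake_hom, isoMake_hom, isoMake_hom, isoMake_hom]
        exact forgetMu_assoc P Q R
      left_unitality := fun P => by
        rw [leftUnitor_hom, leftUnitor_hom, isoMake_hom, isoMake_hom]
        exact (forget_left_unitality P).symm
      right_unitality := fun P => by
        rw [rightUnitor_hom, rightUnitor_hom, isoMake_hom, isoMake_hom]
        exact (forget_right_unitality P).symm }

end

/-! ### Coinduction, and restriction of free symmetric operads. -/

section

section mon

open MonoidalCategory

/-- A monoidal left adjoint preserves free monoids. -/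
theorem existsUnique_mapMon {C D : Type*} [Category C] [Category D] [MonoidalCategory C]
    [MonoidalCategory D] {L : C ⥤ D} {R : D ⥤ C} (adj : L ⊣ R) [L.Monoidal] {V : C} {F : Mon C}
    {ι : V ⟶ F.X} (h : ∀ (A : Mon C) (φ : V ⟶ A.X), ∃! ψ : F ⟶ A, ι ≫ ψ.hom = φ) (A : Mon D)
    (φ : L.obj V ⟶ A.X) : ∃! ψ : L.mapMon.obj F ⟶ A, L.map ι ≫ ψ.hom = φ := by
  -- The right adjoint of a strong monoidal functor is lax monoidal, so it carries monoids to
  -- monoids and the adjunction lifts to monoids.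
  let := adj.rightAdjointLaxMonoidal
  -- Transposition in the lifted adjunction is transposition of the underlying morphisms.
  have key : ∀ ψ : L.mapMon.obj F ⟶ A,
      (adj.mapMon.homEquiv F A ψ).hom = adj.homEquiv _ _ ψ.hom := fun ψ => by
    refine (congrArg Mon.Hom.hom (adj.mapMon.homEquiv_unit F A ψ)).trans
      (Eq.trans ?_ (adj.homEquiv_unit F.X A.X ψ.hom).symm)
    show (𝟙 _ ≫ adj.unit.app F.X ≫ 𝟙 _) ≫ R.map _ = _
    rw [Category.id_comp, Category.comp_id]
  -- By naturality, extending `φ` along `L.map ι` amounts to extending its transpose along `ι`,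
  -- which is governed by the freeness of `F`.
  have iff : ∀ ψ : L.mapMon.obj F ⟶ A, L.map ι ≫ ψ.hom = φ ↔
      ι ≫ (adj.mapMon.homEquiv F A ψ).hom = adj.homEquiv _ _ φ := fun ψ => by
    rw [key]
    refine (adj.homEquiv V A.X).injective.eq_iff.symm.trans (Eq.congr_left ?_)
    exact adj.homEquiv_naturality_left ι ψ.hom
  obtain ⟨χ, hχ, huniq⟩ := h (R.mapMon.obj A) (adj.homEquiv _ _ φ)
  refine ⟨(adj.mapMon.homEquiv F A).symm χ, (iff _).2 ?_, fun ψ hψ => ?_⟩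
  · rw [Equiv.apply_symm_apply]
    exact hχ
  · rw [Equiv.eq_symm_apply]
    exact huniq _ ((iff _).1 hψ)

end mon

variable {k : Type u} [Field k]

/-- A set with an order. -/
def orderOn (X : FinSet) (s : LinearOrder X.carrier) : OrdSet := ⟨X.carrier, s⟩

/-- The order transported along a bijection. -/
abbrev transportOrder {X Y : FinSet} (e : OIso X Y) (s : LinearOrder X.carrier) :
    LinearOrder Y.carrier :=
  letI := s
  LinearOrder.lift' e.toEquiv.symm e.toEquiv.symm.injective

/-- A bijection, as an isomorphism of ordered sets. -/
def orderedIso {X Y : FinSet} (e : OIso X Y) (s : LinearOrder X.carrier) :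
    OIso (orderOn X s) (orderOn Y (transportOrder e s)) :=
  ⟨e.toEquiv, fun a b => by
    have h : ∀ c, e.toEquiv.symm (e.toEquiv c) = c := e.toEquiv.symm_apply_apply
    exact iff_of_eq (congrArg₂ s.le (h a) (h b))⟩

/-- A bijection from an ordered set determines the order on its target for which it is an
isomorphism, so the two orders coincide. This replaces transport along equalities of orders in the
functoriality of coinduction. -/
theorem act_order_dep {A : NSColl k} {X : FinSet} (y : ∀ s, A.ev (orderOn X s)) {J : OrdSet}
    {s t : LinearOrder X.carrier} (η : OIso J (orderOn X s)) (θ : OIso J (orderOn X t))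
    (h : ∀ x, η x = θ x) : act A η (y s) = act A θ (y t) := by
  have hst : s = t := LinearOrder.ext fun a b => by
    obtain ⟨a, rfl⟩ := η.toEquiv.surjective a
    obtain ⟨b, rfl⟩ := η.toEquiv.surjective b
    have h1 := (η.emb a b).trans (θ.emb a b).symm
    rw [← h, ← h] at h1
    exact h1
  subst hst
  exact act_congr _ h _

/-- The symmetric collection coinduced by a nonsymmetric collection. -/
def coind (A : NSColl k) : SymColl k :=
  Coll.make (fun X => ModuleCat.of k (∀ s : LinearOrder X.carrier, A.ev (orderOn X s)))
    (fun e => LinearMap.pi fun s => act A (orderedIso e s) ∘ₗ LinearMap.proj (transportOrder e s))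
    (fun X => by
      ext y s
      exact (act_order_dep y (orderedIso (OIso.refl X) s) (OIso.refl (orderOn X s))
        fun _ => rfl).trans (act_refl A (y s)))
    (fun e e' => by
      ext y s
      exact (act_order_dep y (orderedIso (e.trans e') s)
        ((orderedIso e s).trans (orderedIso e' (transportOrder e s))) fun _ => rfl).trans
        (act_act A _ _ _).symm)

/-- The component at an order. -/
def coindEval (A : NSColl k) (I : OrdSet) : (coind A).ev (forgetOrd.obj I) →ₗ[k] A.ev I :=
  LinearMap.proj (R := k) (φ := fun s => A.ev (orderOn (forgetOrd.obj I) s)) I.str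

theorem coindEval_act (A : NSColl k) {I J : OrdSet} (e : OIso I J)
    (y : (coind A).ev (forgetOrd.obj J)) :
    coindEval A I (act (coind A) e.forget y) = act A e (coindEval A J y) :=
  act_order_dep (X := forgetOrd.obj J) (s := transportOrder e.forget I.str) (t := J.str) y
    (orderedIso e.forget I.str) e fun _ => rfl

/-- The functor of coinduced collections. -/
def coindFunctor (k : Type u) [Field k] : NSColl k ⥤ SymColl k where
  obj := coind
  map {A B} θ := homMake (fun X => LinearMap.pi fun s =>
    app θ (orderOn X s) ∘ₗ LinearMap.proj (R := k) (φ := fun s => A.ev (orderOn X s)) s)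
    fun e y => funext fun s => app_act θ (orderedIso e s) _
  map_id _ := rfl
  map_comp _ _ := rfl

/-- Coinduction is right adjoint to the forgetful functor. -/
def forgetAdj (k : Type u) [Field k] : forgetColl k ⊣ coindFunctor k :=
  Adjunction.mkOfHomEquiv
    { homEquiv := fun P A =>
        { toFun := fun θ => homMake (fun X => LinearMap.pi fun s => app θ (orderOn X s))
            fun e y => funext fun s => app_act θ (orderedIso e s) y
          invFun := fun ψ => homMake (fun I => coindEval A I ∘ₗ app ψ (forgetOrd.obj I))
            fun e y => (congrArg (coindEval A _) (app_act ψ (OIso.forget e) y)).trans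
              (coindEval_act A e _)
          left_inv := fun _ => rfl
          right_inv := fun _ => rfl }
      homEquiv_naturality_left_symm := fun _ _ => rfl
      homEquiv_naturality_right := fun _ _ => rfl }

/-- Restriction is strong monoidal and left adjoint to coinduction, hence preserves free monoids. -/
theorem IsFree.forget {V : SymColl k} {F : Operad k NoStr} {ι : V ⟶ F.X} (h : IsFree F ι) :
    IsFree ((forgetColl k).mapMon.obj F) ((forgetColl k).map ι) :=
  existsUnique_mapMon (forgetAdj k) h

end

/-! ### Existence of free operads. -/

section

variable {S : Type → Type} [StdKind S] {k : Type u} [Field k] [CompModel k S] [AssocBijective k S]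

/-- The unit of an operad. -/
def Operad.one (O : Operad k S) : unit k S ⟶ O.X := MonObj.one

/-- The composite of elements of an operad. -/
def Operad.compose (O : Operad k S) {I K : Obj S} (f : Surj I K) (p : O.X.ev K)
    (q : ∀ i : K, O.X.ev (fib f i)) : O.X.ev I := app (Operad.mul O) I (tens f p q)

theorem Operad.act_compose (O : Operad k S) {I J K : Obj S} (ε : OIso I J) (f : Surj J K)
    (p : O.X.ev K) (q : ∀ i : K, O.X.ev (fib f i)) :
    act O.X ε (O.compose f p q) =
      O.compose (f.pre ε) p (fun i => act O.X (preIso ε f i) (q i)) := by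
  rw [compose, compose, ← app_act, act_tens]

theorem Operad.one_hom {O O' : Operad k S} (ψ : O ⟶ O') :
    Operad.one O ≫ ψ.hom = Operad.one O' := IsMonHom.one_hom ψ.hom

theorem Operad.mul_hom {O O' : Operad k S} (ψ : O ⟶ O') :
    Operad.mul O ≫ ψ.hom = compHom ψ.hom ψ.hom ≫ Operad.mul O' := IsMonHom.mul_hom ψ.hom

theorem Operad.hom_compose {O O' : Operad k S} (ψ : O ⟶ O') {I K : Obj S} (f : Surj I K)
    (p : O.X.ev K) (q : ∀ i : K, O.X.ev (fib f i)) :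
    app ψ.hom I (O.compose f p q) =
      O'.compose f (app ψ.hom K p) (fun i => app ψ.hom _ (q i)) := by
  rw [compose, compose, ← app_comp, mul_hom, app_comp, compHom_tens]

variable (V : Coll k S)

/-- An operad with a morphism from `V`. -/
abbrev Target := Σ A : Operad k S, V ⟶ A.X

/-- Compatible choices of elements of all operads with a morphism from `V`. -/
abbrev Value (I : Obj S) := ∀ a : Target V, a.1.X.ev I

namespace Value

variable {V}

/-- Componentwise composition. -/
def compose {I K : Obj S} (f : Surj I K) (p : Value V K) (q : ∀ i : K, Value V (fib f i)) :
    Value V I := fun a => a.1.compose f (p a) fun i => q i a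

/-- Componentwise action. -/
def pull {I J : Obj S} (ε : OIso I J) : Value V J →ₗ[k] Value V I :=
  LinearMap.pi fun a => act a.1.X ε ∘ₗ LinearMap.proj a

theorem pull_compose {I J K : Obj S} (ε : OIso I J) (f : Surj J K) (p : Value V K)
    (q : ∀ i : K, Value V (fib f i)) :
    pull ε (compose f p q) = compose (f.pre ε) p fun i => pull (preIso ε f i) (q i) :=
  funext fun a => a.1.act_compose ε f (p a) _

/-- With `L` a standard set, this shows that compositions over the sets `[n]` suffice; without it
they would range over a proper class of index sets. -/
theorem compose_post {I K L : Obj S} (f : Surj I K) (e : OIso K L) (p : Value V K)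
    (q : ∀ i : K, Value V (fib f i)) :
    compose f p q =
      compose (f.post e) (pull e.symm p) fun j => pull (postIso' f e j) (q (e.symm j)) := by
  funext a
  refine congrArg (app (Operad.mul a.1) I) (tens_congr e (fun _ => rfl) ?_ fun i η hη => ?_).symm
  · exact (act_act _ _ _ _).trans (act_eq_self _ _ (fun x => e.symm_apply x) _)
  · refine (act_act _ _ _ _).trans ?_
    exact (act_dep (fun i => q i a) (e.symm_apply i) _ (OIso.refl _) hη).trans (act_refl _ _)

/-- The values of the generators. -/
def gen (I : Obj S) : V.ev I →ₗ[k] Value V I := LinearMap.pi fun a => app a.2 I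

/-- The values of the units. -/
def one (I : Obj S) : (unit k S).ev I →ₗ[k] Value V I := LinearMap.pi fun a => app a.1.one I

theorem pull_gen {I J : Obj S} (ε : OIso I J) (v : V.ev J) :
    pull ε (gen J v) = gen I (act V ε v) := funext fun a => (app_act a.2 ε v).symm

theorem pull_one {I J : Obj S} (ε : OIso I J) (c : (unit k S).ev J) :
    pull ε (one (V := V) J c) = one I (act _ ε c) :=
  funext fun a => (app_act (Operad.one a.1) ε c).symm

/-- The values generated by `V`. -/
inductive Generated : ∀ I : Obj S, Value V I → Prop
  | gen {I} (v : V.ev I) : Generated I (gen I v)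
  | one {I} (c : (unit k S).ev I) : Generated I (one I c)
  | add {I} {x y : Value V I} : Generated I x → Generated I y → Generated I (x + y)
  | smul {I} (c : k) {x : Value V I} : Generated I x → Generated I (c • x)
  | compose {I K} (f : Surj I K) {p : Value V K} {q : ∀ i : K, Value V (fib f i)} :
      Generated K p → (∀ i, Generated (fib f i) (q i)) → Generated I (compose f p q)

theorem Generated.pull {I J : Obj S} (ε : OIso I J) {x : Value V J} (h : Generated J x) :
    Generated I (Value.pull ε x) := by
  induction h generalizing I with
  | gen v => rw [pull_gen]; exact .gen _
  | one c => rw [pull_one]; exact .one _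
  | add _ _ hx hy => rw [map_add]; exact .add (hx ε) (hy ε)
  | smul c _ hx => rw [map_smul]; exact .smul c (hx ε)
  | compose f hp _ _ hq => rw [pull_compose]; exact .compose _ hp fun i => hq i _

/-- The subspace of generated values. -/
def generated (V : Coll k S) (I : Obj S) : Submodule k (Value V I) where
  carrier := {x | Generated I x}
  add_mem' hx hy := .add hx hy
  zero_mem' := by
    have := Generated.gen (0 : V.ev I)
    rwa [map_zero] at this
  smul_mem' c _ hx := .smul c hx

/-- The values generated in a bounded number of steps, by compositions over standard sets. -/
def stage (V : Coll k S) : ℕ → ∀ I : Obj S, Set (Value V I)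
  | 0, _ => ∅
  | d + 1, I => stage V d I ∪ Set.range (gen I) ∪ Set.range (one I) ∪
      Set.range (fun t : stage V d I × stage V d I => t.1.1 + t.2.1) ∪
      Set.range (fun t : k × stage V d I => t.1 • t.2.1) ∪
      Set.range (fun t : Σ (n : ℕ) (f : Surj I (std S n)),
        stage V d (std S n) × ∀ i, stage V d (fib f i) =>
          compose t.2.1 t.2.2.1.1 fun i => (t.2.2.2 i).1)

/-- Each stage is a union of images of small sets. For compositions this holds because only a number
`n`, a surjection onto `[n]` and elements of the previous stage are chosen. -/
theorem stage_small (d : ℕ) (I : Obj S) : Small.{u} (stage V d I) := by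
  induction d generalizing I with
  | zero => exact small_subset (Set.empty_subset (∅ : Set _))
  | succ d ih =>
    have : ∀ I, Small.{u} (stage V d I) := ih
    unfold stage
    infer_instance

theorem stage_mono {d d' : ℕ} (h : d ≤ d') (I : Obj S) : stage V d I ⊆ stage V d' I := by
  induction h with
  | refl => exact subset_rfl
  | step _ ih => exact fun x hx => .inl (.inl (.inl (.inl (.inl (ih hx)))))

/-- Transport does not raise the stage. Hence moving a composition to a standard index set keeps the
bound on its ingredients. -/
theorem stage_pull {d : ℕ} {I J : Obj S} (ε : OIso I J) {x : Value V J} (hx : x ∈ stage V d J) :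
    pull ε x ∈ stage V d I := by
  induction d generalizing I J with
  | zero => exact hx.elim
  | succ d ih =>
    rcases hx with ((((hx | ⟨v, rfl⟩) | ⟨c, rfl⟩) | ⟨t, rfl⟩) | ⟨t, rfl⟩) | ⟨t, rfl⟩
    · exact stage_mono d.le_succ I (ih ε hx)
    · rw [pull_gen]
      exact .inl (.inl (.inl (.inl (.inr ⟨_, rfl⟩))))
    · rw [pull_one]
      exact .inl (.inl (.inl (.inr ⟨_, rfl⟩)))
    · rw [map_add]
      exact .inl (.inl (.inr ⟨(⟨_, ih ε t.1.2⟩, ⟨_, ih ε t.2.2⟩), rfl⟩))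
    · rw [map_smul]
      exact .inl (.inr ⟨(t.1, ⟨_, ih ε t.2.2⟩), rfl⟩)
    · rw [pull_compose]
      exact .inr ⟨⟨t.1, t.2.1.pre ε, t.2.2.1, fun i => ⟨_, ih (preIso ε t.2.1 i) (t.2.2.2 i).2⟩⟩,
        rfl⟩

/-- By induction on the generation of `x`; a composition has finitely many ingredients, so their
stages have a common bound, and one further step suffices after passing to a standard index set. -/
theorem Generated.exists_stage {I : Obj S} {x : Value V I} (h : Generated I x) :
    ∃ d, x ∈ stage V d I := by
  induction h with
  | gen v => exact ⟨1, .inl (.inl (.inl (.inl (.inr ⟨_, rfl⟩))))⟩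
  | one c => exact ⟨1, .inl (.inl (.inl (.inr ⟨_, rfl⟩)))⟩
  | add _ _ hx hy =>
    obtain ⟨d, hd⟩ := hx
    obtain ⟨d', hd'⟩ := hy
    exact ⟨max d d' + 1, .inl (.inl (.inr ⟨(⟨_, stage_mono (le_max_left d d') _ hd⟩,
      ⟨_, stage_mono (le_max_right d d') _ hd'⟩), rfl⟩))⟩
  | smul c _ hx =>
    obtain ⟨d, hd⟩ := hx
    exact ⟨d + 1, .inl (.inr ⟨(c, ⟨_, hd⟩), rfl⟩)⟩
  | @compose I K f p q _ _ hp hq =>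
    obtain ⟨d, hd⟩ := hp
    choose D hD using hq
    obtain ⟨m, hm⟩ := (Set.finite_range D).bddAbove
    obtain ⟨n, e, he⟩ := StdKind.exists_iso K.str
    let e' : OIso K (std S n) := ⟨e, he⟩
    rw [compose_post f e']
    exact ⟨max d m + 1, .inr ⟨⟨n, f.post e',
      ⟨_, stage_pull e'.symm (stage_mono (le_max_left d m) _ hd)⟩,
      fun j => ⟨_, stage_pull (postIso' f e' j) (stage_mono
        ((hm ⟨e'.symm j, rfl⟩).trans (le_max_right d m)) _ (hD (e'.symm j)))⟩⟩, rfl⟩⟩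

/-- The generated values lie in a countable union of small stages, although the product containing
them ranges over all operads. -/
instance (I : Obj S) : Small.{u} (generated V I) := by
  have : ∀ d, Small.{u} (stage V d I) := fun d => stage_small d I
  have : Small.{u} (Set.range fun t : Σ d, stage V d I => t.2.1) := inferInstance
  refine small_subset (t := {x : Value V I | Generated I x})
    (s := Set.range fun t : Σ d, stage V d I => t.2.1) fun x hx => ?_
  obtain ⟨d, hd⟩ := Generated.exists_stage hx
  exact ⟨⟨d, x, hd⟩, rfl⟩

end Value

open Value

/-- The components of the free operad. -/
def freeMod (I : Obj S) : ModuleCat.{u} k := ModuleCat.of k (Shrink.{u} (generated V I))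

/-- The value of an element of the free operad. -/
def freeVal (I : Obj S) : freeMod V I →ₗ[k] Value V I :=
  (generated V I).subtype ∘ₗ (Shrink.linearEquiv k (generated V I)).toLinearMap

theorem freeVal_injective (I : Obj S) : Function.Injective (freeVal V I) :=
  Subtype.val_injective.comp (Shrink.linearEquiv k (generated V I)).injective

theorem freeVal_generated (I : Obj S) (x : freeMod V I) : Generated I (freeVal V I x) :=
  (Shrink.linearEquiv k (generated V I) x).2

variable {V}

/-- A linear map to the free operad from its values. -/
def freeLift {I : Obj S} {M : Type*} [AddCommGroup M] [Module k M] (φ : M →ₗ[k] Value V I)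
    (h : ∀ x, Generated I (φ x)) : M →ₗ[k] freeMod V I :=
  (Shrink.linearEquiv k (generated V I)).symm.toLinearMap ∘ₗ φ.codRestrict _ h

theorem freeVal_freeLift {I : Obj S} {M : Type*} [AddCommGroup M] [Module k M]
    (φ : M →ₗ[k] Value V I) (h : ∀ x, Generated I (φ x)) (x : M) :
    freeVal V I (freeLift φ h x) = φ x :=
  congrArg Subtype.val ((Shrink.linearEquiv k (generated V I)).apply_symm_apply _)

theorem exists_freeVal {I : Obj S} {x : Value V I} (h : Generated I x) :
    ∃ y, freeVal V I y = x :=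
  ⟨(Shrink.linearEquiv k (generated V I)).symm ⟨x, h⟩,
    congrArg Subtype.val ((Shrink.linearEquiv k (generated V I)).apply_symm_apply _)⟩

variable (V)

/-- The action of isomorphisms on the free operad. -/
def freeAct {I J : Obj S} (ε : OIso I J) : freeMod V J →ₗ[k] freeMod V I :=
  freeLift (pull ε ∘ₗ freeVal V J) fun x => (freeVal_generated V J x).pull ε

theorem freeVal_freeAct {I J : Obj S} (ε : OIso I J) (x : freeMod V J) :
    freeVal V I (freeAct V ε x) = pull ε (freeVal V J x) := freeVal_freeLift _ _ _

/-- The underlying collection of the free operad. -/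
def freeColl : Coll k S :=
  Coll.make (freeMod V) (freeAct V)
    (fun I => LinearMap.ext fun x => freeVal_injective V I <| by
      rw [freeVal_freeAct]
      exact funext fun a => act_refl a.1.X _)
    (fun {I J K} e e' => LinearMap.ext fun x => freeVal_injective V I <| by
      rw [LinearMap.comp_apply, freeVal_freeAct, freeVal_freeAct, freeVal_freeAct]
      exact funext fun a => (act_act a.1.X e e' _).symm)

/-- The value of an element of the free operad in a given operad. -/
def freeEval (a : Target V) : freeColl V ⟶ a.1.X :=
  homMake (fun I => LinearMap.proj a ∘ₗ freeVal V I) fun e x =>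
    congrFun (freeVal_freeAct V e x) a

/-- An element of the free operad is its tuple of values. All identities in it are thereby reduced
to identities in actual operads. -/
theorem free_ext {I : Obj S} {x y : (freeColl V).ev I}
    (h : ∀ a, app (freeEval V a) I x = app (freeEval V a) I y) : x = y :=
  freeVal_injective V I (funext h)

theorem free_hom_ext {P : Coll k S} {θ φ : P ⟶ freeColl V}
    (h : ∀ a, θ ≫ freeEval V a = φ ≫ freeEval V a) : θ = φ :=
  coll_hom_ext fun I => LinearMap.ext fun x => free_ext V fun a => by
    rw [← app_comp, h, app_comp]

/-- The generated tuples are closed under composition, so the componentwise composite comes from an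
element of the small model. -/
theorem exists_freeCompose {I K : Obj S} (f : Surj I K) (p : (freeColl V).ev K)
    (q : ∀ i : K, (freeColl V).ev (fib f i)) : ∃ y : (freeColl V).ev I,
    ∀ a, app (freeEval V a) I y = a.1.compose f (app (freeEval V a) K p)
      fun i => app (freeEval V a) _ (q i) := by
  obtain ⟨y, hy⟩ := exists_freeVal (Generated.compose f (freeVal_generated V K p)
    fun i => freeVal_generated V _ (q i))
  exact ⟨y, fun a => congrFun hy a⟩

/-- Composition in the free operad. -/
def freeCompose {I K : Obj S} (f : Surj I K) (p : (freeColl V).ev K)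
    (q : ∀ i : K, (freeColl V).ev (fib f i)) : (freeColl V).ev I :=
  (exists_freeCompose V f p q).choose

theorem freeEval_freeCompose {I K : Obj S} (f : Surj I K) (p : (freeColl V).ev K)
    (q : ∀ i : K, (freeColl V).ev (fib f i)) (a : Target V) :
    app (freeEval V a) I (freeCompose V f p q) = a.1.compose f (app (freeEval V a) K p)
      fun i => app (freeEval V a) _ (q i) := (exists_freeCompose V f p q).choose_spec a

open Classical in
theorem freeEval_update {I K : Obj S} {f : Surj I K} (q : ∀ i : K, (freeColl V).ev (fib f i))
    (i : K) (x : (freeColl V).ev (fib f i)) (a : Target V) :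
    (fun j => app (freeEval V a) _ (Function.update q i x j)) =
      Function.update (fun j => app (freeEval V a) (fib f j) (q j)) i (app (freeEval V a) _ x) :=
  funext fun j => Function.apply_update (fun j => app (freeEval V a) (fib f j)) q i x j

open Classical in
/-- The family defining the composition of the free operad. -/
def freeFam (I : Obj S) : Fam (freeColl V) (freeColl V) I ((freeColl V).ev I) where
  toFun {K} f :=
    { toFun := fun p => MultilinearMap.mk' (fun q => freeCompose V f p q)
        (fun q i x y => free_ext V fun a => by
          simp only [map_add, freeEval_freeCompose, freeEval_update, Operad.compose,
            tens_update_add])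
        (fun q i c x => free_ext V fun a => by
          simp only [map_smul, freeEval_freeCompose, freeEval_update, Operad.compose,
            tens_update_smul])
      map_add' := fun p p' => MultilinearMap.ext fun q => free_ext V fun a => by
        show app (freeEval V a) I (freeCompose V f (p + p') q) =
          app (freeEval V a) I (freeCompose V f p q + freeCompose V f p' q)
        simp only [map_add, freeEval_freeCompose, Operad.compose, tens_add_left]
      map_smul' := fun c p => MultilinearMap.ext fun q => free_ext V fun a => by
        show app (freeEval V a) I (freeCompose V f (c • p) q) =
          app (freeEval V a) I (c • freeCompose V f p q)
        simp only [map_smul, freeEval_freeCompose, Operad.compose, tens_smul_left] }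
  rel {K K'} f f' e h p q := free_ext V fun a => by
    show app (freeEval V a) I (freeCompose V f' p q) =
      app (freeEval V a) I (freeCompose V f _ _)
    rw [freeEval_freeCompose, freeEval_freeCompose]
    refine congrArg (app (Operad.mul a.1) I) (tens_congr e h ?_ fun i η hη => ?_)
    · rw [app_act]
    · rw [app_act]
      exact act_congr _ (fun x => fib_ext (hη x)) _

/-- The composition of the free operad. -/
def freeMul : comp (freeColl V) (freeColl V) ⟶ freeColl V :=
  homMake (fun I => compLift (freeFam V I)) fun {I J} ε x => by
    have : compLift (freeFam V I) ∘ₗ act (comp (freeColl V) (freeColl V)) ε =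
        act (freeColl V) ε ∘ₗ compLift (freeFam V J) := comp_ext fun {K} f p q => by
      rw [LinearMap.comp_apply, LinearMap.comp_apply, act_tens, compLift_tens, compLift_tens]
      refine free_ext V fun a => ?_
      refine (freeEval_freeCompose V _ _ _ a).trans ?_
      refine Eq.trans ?_ (app_act _ _ _).symm
      refine Eq.trans ?_ (congrArg (act a.1.X ε) (freeEval_freeCompose V f p q a)).symm
      rw [Operad.act_compose]
      simp only [app_act]
    exact congrArg (fun t => t x) this

theorem freeMul_tens {I K : Obj S} (f : Surj I K) (p : (freeColl V).ev K)
    (q : ∀ i : K, (freeColl V).ev (fib f i)) :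
    app (freeMul V) I (tens f p q) = freeCompose V f p q := compLift_tens (freeFam V I) f p q

theorem freeMul_freeEval (a : Target V) :
    freeMul V ≫ freeEval V a = compHom (freeEval V a) (freeEval V a) ≫ Operad.mul a.1 :=
  comp_hom_ext fun {I K} f p q => by
    rw [app_comp, app_comp, freeMul_tens, freeEval_freeCompose, compHom_tens]
    rfl

/-- The unit of the free operad. -/
def freeOne : unit k S ⟶ freeColl V :=
  homMake (fun I => freeLift (Value.one I) fun c => .one c) fun {I J} ε c =>
    freeVal_injective V I <| by
      refine (freeVal_freeLift _ _ _).trans ?_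
      refine Eq.trans ?_ (freeVal_freeAct V ε _).symm
      exact (pull_one ε c).symm.trans (congrArg (pull ε) (freeVal_freeLift _ _ c).symm)

theorem freeOne_freeEval (a : Target V) : freeOne V ≫ freeEval V a = Operad.one a.1 :=
  coll_hom_ext fun _ => LinearMap.ext fun c => congrFun (freeVal_freeLift (V := V) _ _ c) a

/-- The generators of the free operad. -/
def freeGen : V ⟶ freeColl V :=
  homMake (fun I => freeLift (Value.gen I) fun v => .gen v) fun {I J} ε v =>
    freeVal_injective V I <| by
      refine (freeVal_freeLift _ _ _).trans ?_
      refine Eq.trans ?_ (freeVal_freeAct V ε _).symm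
      exact (pull_gen ε v).symm.trans (congrArg (pull ε) (freeVal_freeLift _ _ v).symm)

theorem freeGen_freeEval (a : Target V) : freeGen V ≫ freeEval V a = a.2 :=
  coll_hom_ext fun _ => LinearMap.ext fun c => congrFun (freeVal_freeLift (V := V) _ _ c) a

section mon

open MonoidalCategory

/-- An object with a jointly monic family of morphisms to monoids, compatible with a unit and a
multiplication, is a monoid. -/
@[reducible] def monObjOfJointlyMono {C : Type*} [Category C] [MonoidalCategory C] {X : C}
    {T : Type*} {A : T → C} [∀ a, MonObj (A a)] (ev : ∀ a, X ⟶ A a)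
    (hev : ∀ {Y : C} {θ φ : Y ⟶ X}, (∀ a, θ ≫ ev a = φ ≫ ev a) → θ = φ)
    (e : 𝟙_ C ⟶ X) (m : X ⊗ X ⟶ X) (he : ∀ a, e ≫ ev a = MonObj.one)
    (hm : ∀ a, m ≫ ev a = (ev a ⊗ₘ ev a) ≫ MonObj.mul) : MonObj X where
  one := e
  mul := m
  one_mul := hev fun a => by
    rw [Category.assoc, hm, ← Category.assoc, whiskerRight_comp_tensorHom, he,
      ← id_tensor_comp_tensor_id_assoc]
    simp
  mul_one := hev fun a => by
    rw [Category.assoc, hm, ← Category.assoc, whiskerLeft_comp_tensorHom, he,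
      ← tensor_id_comp_id_tensor_assoc]
    simp
  mul_assoc := hev fun a => by
    simp only [Category.assoc, hm]
    rw [← Category.assoc, whiskerRight_comp_tensorHom, hm, ← Category.assoc (X ◁ m),
      whiskerLeft_comp_tensorHom, hm]
    have h1 : ((ev a ⊗ₘ ev a) ≫ (MonObj.mul : A a ⊗ A a ⟶ A a)) ⊗ₘ ev a =
      ((ev a ⊗ₘ ev a) ⊗ₘ ev a) ≫ (MonObj.mul ▷ A a) := by
      rw [tensorHom_comp_whiskerRight]
    have h2 : ev a ⊗ₘ ((ev a ⊗ₘ ev a) ≫ (MonObj.mul : A a ⊗ A a ⟶ A a)) =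
      (ev a ⊗ₘ (ev a ⊗ₘ ev a)) ≫ (A a ◁ MonObj.mul) := by
      rw [tensorHom_comp_whiskerLeft]
    rw [h1, h2, Category.assoc, Category.assoc, MonObj.mul_assoc, associator_naturality_assoc]

instance : MonObj (freeColl V) :=
  monObjOfJointlyMono (freeEval V) (free_hom_ext V) (freeOne V) (freeMul V)
    (freeOne_freeEval V) (freeMul_freeEval V)

end mon

/-- The free operad. -/
def freeOperad : Operad k S := ⟨freeColl V⟩

theorem freeOperad_compose {I K : Obj S} (f : Surj I K) (p : (freeOperad V).X.ev K)
    (q : ∀ i : K, (freeOperad V).X.ev (fib f i)) :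
    (freeOperad V).compose f p q = freeCompose V f p q := freeMul_tens V f p q

/-- The morphism from the free operad to an operad. -/
def freeDesc (a : Target V) : freeOperad V ⟶ a.1 where
  hom := freeEval V a
  isMonHom_hom := ⟨freeOne_freeEval V a, freeMul_freeEval V a⟩

/-- Everything in the free operad is built from generators and units by linear combinations and
compositions, all of which morphisms of operads respect. -/
theorem freeOperad_hom_ext {A : Operad k S} {ψ ψ' : freeOperad V ⟶ A}
    (h : freeGen V ≫ ψ.hom = freeGen V ≫ ψ'.hom) : ψ = ψ' := by
  -- The induction runs over the value `w`; injectivity of `freeVal` identifies `x` with the element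
  -- assembled from preimages of the constituents of `w`.
  have key : ∀ {I : Obj S} {w : Value V I}, Generated I w → ∀ x : (freeOperad V).X.ev I,
      freeVal V I x = w → app ψ.hom I x = app ψ'.hom I x := by
    intro I w hw
    induction hw with
    | @gen I v =>
      intro x hx
      obtain rfl : x = app (freeGen V) I v :=
        freeVal_injective V I (hx.trans (freeVal_freeLift (V := V) _ _ v).symm)
      exact congrArg (fun t => app t I v) h
    | @one I c =>
      intro x hx
      obtain rfl : x = app (freeOne V) I c :=
        freeVal_injective V I (hx.trans (freeVal_freeLift (V := V) _ _ c).symm)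
      exact congrArg (fun t => app t I c) ((Operad.one_hom ψ).trans (Operad.one_hom ψ').symm)
    | @add I _ _ h1 h2 ih1 ih2 =>
      intro x hx
      obtain ⟨y, hy⟩ : ∃ y : (freeOperad V).X.ev _, freeVal V _ y = _ := exists_freeVal h1
      obtain ⟨z, hz⟩ : ∃ z : (freeOperad V).X.ev _, freeVal V _ z = _ := exists_freeVal h2
      obtain rfl : x = y + z := freeVal_injective V I
        (hx.trans ((congrArg₂ _ hy hz).symm.trans (map_add (freeVal V I) y z).symm))
      refine (map_add (app ψ.hom I) y z).trans ?_
      rw [ih1 y hy, ih2 z hz]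
      exact (map_add (app ψ'.hom I) y z).symm
    | @smul I c _ h1 ih1 =>
      intro x hx
      obtain ⟨y, hy⟩ : ∃ y : (freeOperad V).X.ev _, freeVal V _ y = _ := exists_freeVal h1
      obtain rfl : x = c • y := freeVal_injective V I
        (hx.trans ((congrArg _ hy).symm.trans (map_smul (freeVal V I) c y).symm))
      refine (map_smul (app ψ.hom I) c y).trans ?_
      rw [ih1 y hy]
      exact (map_smul (app ψ'.hom I) c y).symm
    | @compose I K f p q hp hq ihp ihq =>
      intro x hx
      obtain ⟨y, hy⟩ : ∃ y : (freeOperad V).X.ev _, freeVal V _ y = _ := exists_freeVal hp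
      have hq' : ∀ i, ∃ z : (freeOperad V).X.ev (fib f i), freeVal V _ z = q i := fun i =>
        exists_freeVal (hq i)
      choose z hz using hq'
      obtain rfl : x = (freeOperad V).compose f y z := by
        rw [freeOperad_compose]
        refine freeVal_injective V I (hx.trans (funext fun a => ?_))
        refine Eq.trans ?_ (freeEval_freeCompose V f y z a).symm
        subst hy
        obtain rfl := funext hz
        rfl
      rw [Operad.hom_compose, Operad.hom_compose]
      congr 1
      · exact ihp y hy
      · exact funext fun i => ihq i (z i) (hz i)
  exact Mon.Hom.ext (coll_hom_ext fun I => LinearMap.ext fun x =>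
    key (freeVal_generated V I x) x rfl)

/-- The pair `(A, φ)` is itself one of the indices of the product, and the extension of `φ` is the
projection to that factor. -/
theorem isFree_freeOperad : IsFree (freeOperad V) (freeGen V) := fun A φ =>
  ⟨freeDesc V ⟨A, φ⟩, freeGen_freeEval V ⟨A, φ⟩, fun _ h =>
    freeOperad_hom_ext V (h.trans (freeGen_freeEval V ⟨A, φ⟩).symm)⟩

end

/-! ### Generated ideals under isomorphism and under restriction. -/

section

section ideals

variable {S : Type → Type} [StdKind S] {k : Type u} [Field k] [CompModel k S] [AssocBijective k S]

theorem mem_idealSpan {O : Operad k S} {R : Subcollection O.X} {I : Obj S} {x : O.X.ev I} :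
    x ∈ (idealSpan O R).carrier I ↔ ∀ J : Subcollection O.X, IsIdeal O J →
      (∀ I, R.carrier I ≤ J.carrier I) → x ∈ J.carrier I :=
  (Submodule.mem_iInf _).trans ⟨fun h J hJ hR => h ⟨J, hJ, hR⟩, fun h J => h J.1 J.2.1 J.2.2⟩

theorem idealSpan_le {O : Operad k S} {R J : Subcollection O.X} (hJ : IsIdeal O J)
    (h : ∀ I, R.carrier I ≤ J.carrier I) (I : Obj S) : (idealSpan O R).carrier I ≤ J.carrier I :=
  fun _ hx => mem_idealSpan.1 hx J hJ h

theorem le_idealSpan (O : Operad k S) (R : Subcollection O.X) (I : Obj S) :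
    R.carrier I ≤ (idealSpan O R).carrier I :=
  fun _ hx => mem_idealSpan.2 fun _ _ h => h I hx

/-- The preimage of a subcollection under a morphism of collections. -/
def Subcollection.comap {P Q : Coll k S} (θ : P ⟶ Q) (R : Subcollection Q) : Subcollection P where
  carrier I := (R.carrier I).comap (app θ I)
  act_mem {I J} e x hx := by
    rw [Submodule.mem_comap, app_act]
    exact R.act_mem e hx

/-- Used in both directions of an isomorphism to compare generated ideals through their minimality.
-/
theorem IsIdeal.comap {O O' : Operad k S} (ψ : O ⟶ O') {J : Subcollection O'.X}
    (hJ : IsIdeal O' J) : IsIdeal O (J.comap ψ.hom) := fun f p q h => by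
  refine (congrArg (· ∈ J.carrier _) (Operad.hom_compose ψ f p q)).mpr ?_
  exact hJ f _ _ h

theorem Operad.hom_inv_apply {O O' : Operad k S} (e : O ≅ O') (I : Obj S) (x : O.X.ev I) :
    app e.inv.hom I (app e.hom.hom I x) = x :=
  congrArg (fun t => app (Mon.Hom.hom t) I x) e.hom_inv_id

/-- Isomorphisms of operads preserve generated ideals. -/
theorem map_idealSpan {O O' : Operad k S} (e : O ≅ O') (R : Subcollection O.X) :
    (idealSpan O R).map e.hom.hom = idealSpan O' (R.map e.hom.hom) := by
  refine Subcollection.ext (funext fun I => le_antisymm (Submodule.map_le_iff_le_comap.2 ?_) ?_)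
  · refine idealSpan_le (J := (idealSpan O' (R.map e.hom.hom)).comap e.hom.hom)
      (IsIdeal.comap e.hom (idealSpan_isIdeal O' _)) (fun J x hx => ?_) I
    exact le_idealSpan O' _ J ⟨x, hx, rfl⟩
  · intro y hy
    refine ⟨app e.inv.hom I y, ?_, Operad.hom_inv_apply e.symm I y⟩
    refine idealSpan_le (J := (idealSpan O R).comap e.inv.hom)
      (IsIdeal.comap e.inv (idealSpan_isIdeal O R)) (fun J y => ?_) I hy
    rintro ⟨x, hx, rfl⟩
    refine (congrArg (· ∈ (idealSpan O R).carrier J) (Operad.hom_inv_apply e J x)).mpr ?_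
    exact le_idealSpan O R J hx

/-- Free operads are unique up to a unique isomorphism. -/
theorem IsFree.existsUnique_iso {V : Coll k S} {F G : Operad k S} {ι : V ⟶ F.X} {j : V ⟶ G.X}
    (hF : IsFree F ι) (hG : IsFree G j) : ∃! e : F ≅ G, ι ≫ e.hom.hom = j := by
  obtain ⟨ψ, hψ, hψ'⟩ := hF G j
  obtain ⟨χ, hχ, -⟩ := hG F ι
  refine ⟨⟨ψ, χ, (hF F ι).unique ?_ (Category.comp_id ι), (hG G j).unique ?_ (Category.comp_id j)⟩,
    hψ, fun e he => Iso.ext (hψ' e.hom he)⟩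
  · show ι ≫ ψ.hom ≫ χ.hom = ι
    rw [← Category.assoc, hψ, hχ]
  · show j ≫ χ.hom ≫ ψ.hom = j
    rw [← Category.assoc, hχ, hψ]

end ideals

variable {k : Type u} [Field k]

/-- The multiplication of the restricted operad is the comparison map followed by the symmetric
multiplication, so shuffle composites are symmetric composites along shuffling surjections. -/
theorem forget_compose (F : Operad k NoStr) {I K : OrdSet} (f : Surj I K)
    (p : ((forgetColl k).obj F.X).ev K) (q : ∀ i : K, ((forgetColl k).obj F.X).ev (fib f i)) :
    Operad.compose ((forgetColl k).mapMon.obj F) f p q = Operad.compose F f.forget p q :=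
  congrArg (app (Operad.mul F) (forgetOrd.obj I)) (forgetMu_tens f p q)

/-- The elements of a symmetric collection that belong to a subcollection for all orders. -/
def Subcollection.allOrders {P : SymColl k} (J : Subcollection ((forgetColl k).obj P)) :
    Subcollection P where
  carrier X :=
    { carrier := {x | ∀ s : LinearOrder X.carrier,
        (show ((forgetColl k).obj P).ev (orderOn X s) from x) ∈ J.carrier (orderOn X s)}
      add_mem' := fun hx hy s => (J.carrier (orderOn X s)).add_mem (hx s) (hy s)
      zero_mem' := fun s => (J.carrier (orderOn X s)).zero_mem
      smul_mem' := fun c _ hx s => (J.carrier (orderOn X s)).smul_mem c (hx s) }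
  act_mem e _ hx := fun s => J.act_mem (orderedIso e s) (hx (transportOrder e s))

/-- Given an order on `X`, the target of `f` acquires the order making `f` shuffling, and the
symmetric composite is a shuffle composite. The ingredient lying in `J` for all orders lies in it
for the orders that arise on the target and on the fibres. -/
theorem IsIdeal.allOrders {F : Operad k NoStr}
    {J : Subcollection ((forgetColl k).obj F.X)}
    (hJ : IsIdeal ((forgetColl k).mapMon.obj F) J) : IsIdeal F J.allOrders :=
  fun {X K} f p q h s => by
    let g := toOrdered (orderOn X s) f
    refine (congrArg (· ∈ J.carrier (orderOn X s)) (forget_compose F g p q)).mp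
      (hJ g p q (h.imp (fun h => h _) ?_))
    rintro ⟨i, hi⟩
    exact ⟨i, hi (fib g i).str⟩

theorem IsIdeal.forget {F : Operad k NoStr} {J : Subcollection F.X} (hJ : IsIdeal F J) :
    IsIdeal ((forgetColl k).mapMon.obj F) (J.forget) := fun {I _} f p q h =>
  (congrArg (· ∈ J.carrier (forgetOrd.obj I)) (forget_compose F f p q)).mpr
    (hJ f.forget p q h)

/-- If a shuffle ideal `J` contains the restriction of `R`, then `J.allOrders` is a symmetric ideal
containing `R`, because `R` does not depend on the order. So it contains the symmetric ideal of `R`,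
and evaluating at the given order gives one inclusion. The other holds since restricted ideals are
ideals. -/
theorem forget_idealSpan (F : Operad k NoStr) (R : Subcollection F.X) :
    (idealSpan F R).forget = idealSpan ((forgetColl k).mapMon.obj F) R.forget := by
  refine Subcollection.ext (funext fun I => le_antisymm (fun x hx => ?_) ?_)
  · refine mem_idealSpan.2 fun J hJ h => ?_
    exact mem_idealSpan.1 hx _ (IsIdeal.allOrders hJ)
      (fun X x hx s => h (orderOn X s) hx) I.str
  · exact idealSpan_le (IsIdeal.forget (idealSpan_isIdeal F R)) (fun I => le_idealSpan F R _) I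

end

end ShuffleOperad

end

theorem mainTheorem2 (k : Type u) [Field k] :
    ∃ (_ : AssocBijective k NoStr) (_ : AssocBijective k LinearOrder)
      (_ : (forgetColl k).Monoidal),
      (∀ (P Q : SymColl k) (I K : OrdSet) (f : Surj I K) (p : ((forgetColl k).obj P).ev K)
        (q : ∀ i : K, ((forgetColl k).obj Q).ev (fib f i)),
        app (CategoryTheory.Functor.LaxMonoidal.μ (forgetColl k) P Q) I (tens f p q) =
          tens (P := P) (Q := Q) f.forget p q) ∧
      (∀ (I : OrdSet) (c : (unit k LinearOrder).ev I),
        unitVal (forgetOrd.obj I)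
          (app (CategoryTheory.Functor.LaxMonoidal.ε (forgetColl k)) I c) = unitVal I c) ∧
      ∀ V : SymColl k,
        (∃ (F : Operad k NoStr) (ι : V ⟶ F.X), IsFree F ι) ∧
        (∃ (G : Operad k LinearOrder) (j : (forgetColl k).obj V ⟶ G.X), IsFree G j) ∧
        ∀ (F : Operad k NoStr) (ι : V ⟶ F.X), IsFree F ι →
        ∀ (G : Operad k LinearOrder) (j : (forgetColl k).obj V ⟶ G.X), IsFree G j →
          ∃ e : (forgetColl k).mapMon.obj F ≅ G,
            (forgetColl k).map ι ≫ e.hom.hom = j ∧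
            (∀ e' : (forgetColl k).mapMon.obj F ≅ G,
              (forgetColl k).map ι ≫ e'.hom.hom = j → e' = e) ∧
            ∀ R : Subcollection F.X,
              (idealSpan F R).forget = idealSpan ((forgetColl k).mapMon.obj F) R.forget ∧
              (idealSpan F R).forget.map e.hom.hom = idealSpan G (R.forget.map e.hom.hom) := by
  refine ⟨inferInstance, inferInstance, forgetMonoidal k,
    fun P Q I K f p q => forgetMu_tens f p q, fun I c => unitVal_forgetEps I c,
    fun V => ⟨⟨freeOperad V, freeGen V, isFree_freeOperad V⟩,
      ⟨freeOperad _, freeGen _, isFree_freeOperad _⟩, fun F ι hF G j hG => ?_⟩⟩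
  -- The restricted symmetric operad and `G` are both free on the restriction of `V`.
  obtain ⟨e, he, huniq⟩ := IsFree.existsUnique_iso hF.forget hG
  refine ⟨e, he, huniq, fun R => ⟨forget_idealSpan F R, ?_⟩⟩
  rw [forget_idealSpan F R]
  exact map_idealSpan e R.forget
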